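/- **Setting.** Let $p\ge 1$ be odd, $q$ a primitive $p$-th root of unity with a fixed square root $q^{1/2}$, and $\mathsf N\ge 1$. On $\mathcal H=\bigotimes_{n=1}^{\mathsf N}\mathbb C^p$ let $u_n,v_n$ be the Weyl operators with $\langle h,n|v_n=q^{h}\langle h,n|$, $\langle h,n|u_n=\langle h+1,n|$ ($h\in\mathbb Z/p$). Let $a_n,b_n,c_n,d_n,\alpha_n,\beta_n$ be nonzero complex numbers, $\gamma_n=a_nc_n/\alpha_n$, $\delta_n=b_nd_n/\beta_n$, and let $a_n^p+b_n^p\ne0$, $c_n^p+d_n^p\neq 0$ for all $n$. Put $$L_n(\lambda)=\begin{pmatrix}\lambda\alpha_nv_n-\beta_n\lambda^{-1}v_n^{-1}&u_n(q^{-1/2}a_nv_n+q^{1/2}b_nv_n^{-1})\\u_n^{-1}(q^{1/2}c_nv_n+q^{-1/2}d_nv_n^{-1})&\gamma_nv_n/\lambda-\delta_n\lambda v_n^{-1}\end{pmatrix},\quad M(\lambda)=L_{\mathsf N}(\lambda q^{-1/2})\cdots L_1(\lambda q^{-1/2}),$$ $\hat M(\lambda)=(-1)^{\mathsf N}\sigma^yM^{t}(1/\lambda)\sigma^y$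 ($t$: transposition of the $2\times2$ matrix), and, for $\zeta_-,\kappa_-,\tau_-\in\mathbb C$ with $\zeta_-\ne0$, $\zeta_-^2\neq1$, $\kappa_-\neq0$, $$K_-(\lambda)=\frac1{\zeta_--1/\zeta_-}\begin{pmatrix}\frac{\lambda\zeta_-}{q^{1/2}}-\frac{q^{1/2}}{\lambda\zeta_-}&\kappa_-e^{\tau_-}(\frac{\lambda^2}q-\frac q{\lambda^2})\\\kappa_-e^{-\tau_-}(\frac{\lambda^2}q-\frac q{\lambda^2})&\frac{q^{1/2}\zeta_-}\lambda-\frac\lambda{\zeta_-q^{1/2}}\end{pmatrix},\qquad M(\lambda)K_-(\lambda)\hat M(\lambda)=\begin{pmatrix}\mathcal A_-&\mathcal B_-\\\mathcal C_-&\mathcal D_-\end{pmatrix}(\lambda).$$ For a nonzero gauge parameter $\alpha$ put $$\mathcal A_-(\lambda|\beta)=\frac{-\frac{\lambda q^{3/2}}\beta\mathcal A_--\alpha q\,\mathcal B_-+\frac1{\alpha q}\mathcal C_-+\frac{\beta}{\lambda q^{3/2}}\mathcal D_-}{\beta/q^2-q^2/\beta},\qquad \mathcal B_-(\lambda|\beta)=\frac{-\frac{\lambda\beta}{q^{1/2}}\mathcal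 A_--\alpha q\,\mathcal B_-+\frac{\beta^2}{\alpha q}\mathcal C_-+\frac{\beta q^{1/2}}\lambda\mathcal D_-}{\beta-1/\beta},$$ $$\mathcal D_-(\lambda|\beta)=\frac{\frac{\lambda\beta}{q^{1/2}}\mathcal A_-+\alpha q\,\mathcal B_--\frac1{\alpha q}\mathcal C_--\frac{q^{1/2}}{\lambda\beta}\mathcal D_-}{\beta-1/\beta},$$ where the ungauged operators on the right are taken at $\lambda$. Let $\alpha_-,\beta_-\neq 0$ satisfy $(\alpha_-\mp1/\alpha_-)(\beta_-\pm1/\beta_-)=(\zeta_-\mp1/\zeta_-)/\kappa_-$ (upper signs, and lower signs). Put $\mathsf A_-(\lambda)=g_-(\lambda)\,a(\lambda q^{-1/2})\,d(1/(q^{1/2}\lambda))$ and $\mathsf D_-(\lambda)=\frac{\lambda^2-\lambda^{-2}}{\lambda^2/q^2-q^2/\lambda^2}\mathsf A_-(q/\lambda)$, where $$g_-(\lambda)=\frac{(\frac{\lambda\alpha_-}{q^{1/2}}-\frac{q^{1/2}}{\lambda\alpha_-})(\frac{\lambda\beta_-}{q^{1/2}}+\frac{q^{1/2}}{\lambda\beta_-})}{(\alpha_--1/\alpha_-)(\beta_-+1/\beta_-)},$$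 $$a(\lambda)=a_0\prod_n\Big(\frac{\beta_n}\lambda+\frac{b_n\alpha_n}{q\,a_n}\lambda\Big),\qquad d(\lambda)=\frac{(-1)^{\mathsf N}}{a_0}\prod_n\frac{a_nc_n}{\alpha_n}\Big(\frac1\lambda+q\frac{d_n\alpha_n}{c_n\beta_n}\lambda\Big),\qquad a_0\ne0 .$$ Fix square roots $\mu_{n,\pm}$ of $\mu_{n,+}^2=-q\,a_n\beta_n/(\alpha_nb_n)$, $\mu_{n,-}^2=-q\,c_n\beta_n/(\alpha_nd_n)$, and $p$-th roots $\rho_n$ with $\rho_n^p=(c_n^p+d_n^p)/(a_n^p+b_n^p)$. For $\epsilon=\pm1$, $k\in\mathbb Z$ put $$z_n^{(\epsilon,k)}=-q^{k+1/2}\Big[\rho_n\frac{a_n}{c_n}\Big]^{\frac{1+\epsilon}2}\frac{\alpha_n}{a_n},\qquad w_n^{(\epsilon,k)}=-q^{1/2-k}\Big[\rho_n^{-1}\frac{d_n}{b_n}\Big]^{\frac{1+\epsilon}2}\frac{\beta_n}{d_n},$$ and $f(\alpha,\beta,\gamma)=(-1)^{\mathsf N}\gamma(1-\beta^2)/(\alpha\beta)$.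 Fix $\epsilon_n=\pm1$ and $k_n\in\mathbb Z$ (only $k_n$ mod $p$ matters) for $n=1,\dots,\mathsf N$, let $\beta\in\mathbb C$ with $\beta^{2p}\ne1$, put $\beta_j=\beta q^{-2j}$ for $j\in\mathbb Z$, and let $\mathsf n\neq 0$ be a normalization constant. Assume $$\big(z_1^{(\epsilon_1,k_1)}\big)^p\neq\frac{(-\zeta_-+\epsilon_0\sqrt{\zeta_-^2+4\kappa_-^2})^p}{(2qe^{\tau_-}\kappa_-)^p}\quad(\epsilon_0=\pm1),$$ and, for all $n,m$ and $\epsilon=\pm1$, $$\mu_{n,\epsilon_n}^{2p}\ne\pm1,\quad\mu_{n,\epsilon_n}^{2p}\neq\alpha_-^{2p\epsilon},\quad\mu_{n,\epsilon_n}^{2p}\neq-\beta_-^{2p\epsilon},\quad\mu_{n,+}^{2p}\ne\mu_{m,-}^{2p\epsilon},\quad\mu_{n,\epsilon_n}^{2p}\neq\mu_{m,\epsilon_n}^{2p\epsilon}\ (n\neq m).$$ Put $\mathsf b_n=\mu_{n,\epsilon_n}q^{1/2}$ and, for $\mathbf h\in\{0,\dots,p-1\}^{\mathsf N}$, a prefactor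 $\mathsf b$ and zeros $x_1,\dots,x_{\mathsf N}$, $$E_{\mathbf h}(\lambda;\mathsf b,x)=\mathsf b\Big(\frac{\lambda^2}q-\frac q{\lambda^2}\Big)\prod_{n=1}^{\mathsf N}\Big(\frac\lambda{x_nq^{h_n}}-\frac{x_nq^{h_n}}\lambda\Big)\Big(\lambda x_nq^{h_n}-\frac1{\lambda x_nq^{h_n}}\Big),$$ $$\mathsf b_-^{\pm}(\beta_j)=f(\alpha,\beta_j/q,y)\,\frac{\beta_j^4/q^2}{(1-\beta_j^2)(1-(\beta_j/q)^2)}(-1)^{\mathsf N}\prod_{n=1}^{\mathsf N}\frac{\gamma_n^2}{\mu_{n,\epsilon_n}^2}\;\frac{y\,e^{\tau_-}\kappa_-+\zeta_--\kappa_- /(y\,e^{\tau_-})}{\zeta_--1/\zeta_-},\qquad y=z_1^{(\epsilon_1,k_1+2j\pm1)} .$$ **Theorem.** *(Left.)* Assume $\beta=\alpha w_{\mathsf N}^{(\epsilon_{\mathsf N},k_{\mathsf N})}$ and $z_{n+1}^{(\epsilon_{n+1},k_{n+1})}=1/w_n^{(\epsilon_n,k_n)}$ for $1\le n\le\mathsf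 N-1$. Let $$\langle\Omega_{\beta_j}|=\bigotimes_{n=1}^{\mathsf N}\sum_{h=0}^{p-1}q^{h(k_n+2j+1)}\Big[\prod_{r=1}^{h}\frac{a_nq^{r-1/2}+b_nq^{1/2-r}}{c_nq^{r-1/2}+d_nq^{1/2-r}}\rho_n\Big]^{\frac{1+\epsilon_n}2}\langle h,n|,$$ $$\langle\beta_j,\mathbf h|=\frac1{\mathsf n}\langle\Omega_{\beta_j}|\prod_{n=1}^{\mathsf N}\prod_{k=1}^{h_n}\frac{\mathcal A_-(q^{1-k}/\mathsf b_n|\beta_jq^2)}{\mathsf A_-(q^{1-k}/\mathsf b_n)}$$ (factors ordered from left to right). Then all the denominators $\mathsf A_-(q^{1-k}/\mathsf b_n)$, $1\le k\le p-1$, are nonzero and, for all $j\in\mathbb Z$, $\lambda\ne0$ and $\mathbf h$, $$\langle\beta_j,\mathbf h|\,\mathcal B_-(\lambda|\beta_j)=E_{\mathbf h}(\lambda;\mathsf b_-^+(\beta_j),\mathsf b_\bullet)\,\langle\beta_{j+1},\mathbf h| .$$ The pseudo-spectrum is simple: $\mathsf b_-^+(\beta_j)\ne0$, $\mathsf b_n^{2p}\neq\pm1$,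 $\mathsf b_n^p\ne\mathsf b_m^p$ for $n\neq m$, and $E_{\mathbf h}(\cdot\,;\mathsf b_-^+(\beta_j),\mathsf b_\bullet)$ are pairwise distinct functions for distinct $\mathbf h$. For each $j$ the states $\langle\beta_j,\mathbf h|$, $\mathbf h\in\{0,\dots,p-1\}^{\mathsf N}$, form a basis of the space of left states. *(Right.)* Assume $\beta=\alpha w_{\mathsf N}^{(\epsilon_{\mathsf N},k_{\mathsf N})}$ and $z_{n+1}^{(\epsilon_{n+1},k_{n+1}-2)}=1/w_n^{(\epsilon_n,k_n)}$ for $1\le n\le\mathsf N-1$. Let $$|\bar\Omega_{\beta_j}\rangle=\Big(\frac{\beta_j}q\Big)^{\mathsf N}\bigotimes_{n=1}^{\mathsf N}\sum_{h=0}^{p-1}q^{-h(k_n+2j+1)}\Big[\prod_{r=1}^{h}\frac{c_nq^{r-1/2}+d_nq^{1/2-r}}{a_nq^{r-1/2}+b_nq^{1/2-r}}\rho_n^{-1}\Big]^{\frac{1+\epsilon_n}2}|h,n\rangle ,$$ $$|\Omega_{\beta_j}\rangle=\prod_{n=1}^{\mathsf N}\prod_{r=1}^{p-1}\mathcal D_-(\mathsf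 b_n/q^r|\beta_j)\,|\bar\Omega_{\beta_j}\rangle,\qquad |\beta_j,\mathbf h\rangle=\frac1{\mathsf n}\prod_{n=1}^{\mathsf N}\prod_{k=1}^{h_n}\frac{\mathcal D_-(q^{1-k}/\mathsf b_n|\beta_j)}{\mathsf D_-(q^{1-k}/\mathsf b_n)}\,|\Omega_{\beta_j}\rangle$$ (for each $n$ the factors with smaller $r$, resp. $k$, act first; the site-$\mathsf N$ factors act before those of site $\mathsf N-1$, etc.). Then the denominators $\mathsf D_-(q^{1-k}/\mathsf b_n)$, $1\le k\le p-1$, are nonzero; $|\bar\Omega_{\beta_j}\rangle\ne0$ is a pseudo-eigenstate with zeros $\mu_{n,\epsilon_n}q^{-1/2}$, $$\mathcal B_-(\lambda|\beta_j)|\bar\Omega_{\beta_j}\rangle=|\bar\Omega_{\beta_{j-1}}\rangle\,E_{\mathbf 0}(\lambda;\mathsf b_-^-(\beta_j),\mu_{\bullet,\epsilon_\bullet}q^{-1/2})\qquad(\lambda\neq0);$$ for all $j$, $\lambda\neq0$ and $\mathbf h$, $$\mathcal B_-(\lambda|\beta_j)|\beta_j,\mathbf h\rangle=|\beta_{j-1},\mathbf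 h\rangle\,E_{\mathbf h}(\lambda;\mathsf b_-^-(\beta_j),\mathsf b_\bullet),$$ with simple pseudo-spectrum (in the sense above, with $\mathsf b_-^-$ in place of $\mathsf b_-^+$); and for each $j$ the states $|\beta_j,\mathbf h\rangle$ form a basis of the space of right states. -/

import Mathlib

open Matrix

noncomputable section

namespace CyclicReflection

/-- Basis labels `(h₁, …, h_N) ∈ {0, …, p-1}^N` of the quantum space
`⨂ₙ ℂ^p`; addition in `Fin p` is modulo `p`. -/
abbrev Lab (p N : ℕ) := Fin N → Fin p

/-- Operators on `⨂ₙ ℂ^p`, written in the joint eigenbasis of the `vₙ`: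
the entry at `(h, h')` is `⟨h| O |h'⟩`. Left (bra) states are row vectors, on which
operators act by `ᵥ*`; right (ket) states are column vectors, with action `*ᵥ`. -/
abbrev Op (p N : ℕ) := Matrix (Lab p N) (Lab p N) ℂ

/-- Left or right states, through their coordinates in the joint eigenbasis of the `vₙ`. -/
abbrev State (p N : ℕ) := Lab p N → ℂ

/-- The parameters of the model with `N` sites (pure data, constraints are in
`Params.Admissible`). -/
structure Params (N : ℕ) where
  /-- the fixed square root `q^{1/2}` -/
  s : ℂ
  /-- bulk parameters `aₙ, bₙ, cₙ, dₙ, αₙ, βₙ` -/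
  a : Fin N → ℂ
  b : Fin N → ℂ
  c : Fin N → ℂ
  d : Fin N → ℂ
  al : Fin N → ℂ
  be : Fin N → ℂ
  /-- boundary parameters `ζ₋, κ₋, τ₋` -/
  zeta : ℂ
  kappa : ℂ
  tau : ℂ
  /-- boundary parameters `α₋, β₋` -/
  alm : ℂ
  bem : ℂ
  /-- the gauge parameter `α` -/
  ga : ℂ
  /-- the free parameter `a₀` -/
  a0 : ℂ
  /-- the chosen `p`-th roots `((cₙ^p + dₙ^p) / (aₙ^p + bₙ^p))^{1/p}` -/
  rho : Fin N → ℂ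
  /-- the square roots `μ_{n,+}` (at `1`) and `μ_{n,-}` (at `-1`) -/
  mu : ℤˣ → Fin N → ℂ

namespace Params

variable {N : ℕ} (P : Params N) (p : ℕ)

/-- `q`. -/
def q : ℂ := P.s ^ 2

/-- The bulk parameter `γₙ = aₙ cₙ / αₙ`. -/
def gam (n : Fin N) : ℂ := P.a n * P.c n / P.al n

/-- The bulk parameter `δₙ = bₙ dₙ / βₙ`. -/
def del (n : Fin N) : ℂ := P.b n * P.d n / P.be n

/-- Standing assumptions: `q` is a primitive `p`-th root of unity, everything that is divided
by is nonzero, `aₙ^p + bₙ^p ≠ 0` and `cₙ^p + dₙ^p ≠ 0`, and the defining equations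
of `α₋, β₋`, of the `p`-th roots and of `μ_{n,±}`. -/
structure Admissible : Prop where
  q_prim : IsPrimitiveRoot P.q p
  a_ne : ∀ n, P.a n ≠ 0
  b_ne : ∀ n, P.b n ≠ 0
  c_ne : ∀ n, P.c n ≠ 0
  d_ne : ∀ n, P.d n ≠ 0
  al_ne : ∀ n, P.al n ≠ 0
  be_ne : ∀ n, P.be n ≠ 0
  zeta_ne : P.zeta ≠ 0
  zeta_sq_ne : P.zeta ^ 2 ≠ 1
  kappa_ne : P.kappa ≠ 0
  ga_ne : P.ga ≠ 0
  a0_ne : P.a0 ≠ 0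
  alm_ne : P.alm ≠ 0
  bem_ne : P.bem ≠ 0
  alm_bem₁ : (P.alm - 1 / P.alm) * (P.bem + 1 / P.bem) = (P.zeta - 1 / P.zeta) / P.kappa
  alm_bem₂ : (P.alm + 1 / P.alm) * (P.bem - 1 / P.bem) = (P.zeta + 1 / P.zeta) / P.kappa
  ab_ne : ∀ n, P.a n ^ p + P.b n ^ p ≠ 0
  cd_ne : ∀ n, P.c n ^ p + P.d n ^ p ≠ 0
  rho_pow : ∀ n, P.rho n ^ p = (P.c n ^ p + P.d n ^ p) / (P.a n ^ p + P.b n ^ p)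
  mu_plus : ∀ n, P.mu 1 n ^ 2 = -P.q * (P.a n * P.be n / (P.al n * P.b n))
  mu_minus : ∀ n, P.mu (-1) n ^ 2 = -P.q * (P.c n * P.be n / (P.al n * P.d n))

/-! ### Operators -/

section Operators

variable {p} [NeZero p]

/-- `vₙ`, with `⟨h| vₙ = q^{hₙ} ⟨h|`. -/
def v (n : Fin N) : Op p N := diagonal fun h => P.q ^ (h n : ℕ)

/-- `vₙ⁻¹`. -/
def vInv (n : Fin N) : Op p N := diagonal fun h => (P.q ^ (h n : ℕ))⁻¹

/-- `uₙ`, with `⟨…, hₙ, …| uₙ = ⟨…, hₙ + 1, …|`. -/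
def u (n : Fin N) : Op p N :=
  Matrix.of fun h h' => if h' = Function.update h n (h n + 1) then 1 else 0

/-- `uₙ⁻¹ = uₙᵀ` (`uₙ` is a permutation matrix). -/
def uInv (n : Fin N) : Op p N := (u n)ᵀ

/-- The Bazhanov–Stroganov Lax operator `L_{a,n}(x)`, as a `2 × 2` matrix of operators. -/
def lax (n : Fin N) (x : ℂ) : Matrix (Fin 2) (Fin 2) (Op p N) :=
  !![(x * P.al n) • P.v n - (P.be n / x) • P.vInv n,
     u n * ((P.a n / P.s) • P.v n + (P.s * P.b n) • P.vInv n);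
     uInv n * ((P.s * P.c n) • P.v n + (P.d n / P.s) • P.vInv n),
     (P.gam n / x) • P.v n - (P.del n * x) • P.vInv n]

/-- The bulk monodromy matrix `M(x) = L_N(x q^{-1/2}) ⋯ L_1(x q^{-1/2})`. -/
def mono (x : ℂ) : Matrix (Fin 2) (Fin 2) (Op p N) :=
  (List.ofFn fun n : Fin N => P.lax (p := p) n.rev (x / P.s)).prod

/-- `M̂(x) = (-1)^N σ^y M^{t}(1/x) σ^y`, the transposition being that of the `2 × 2` auxiliary
space only: with `M = (A, B; C, D)` this is `(-1)^N (D, -B; -C, A)` at `1/x`. -/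
def monoHat (x : ℂ) : Matrix (Fin 2) (Fin 2) (Op p N) :=
  (-1 : ℂ) ^ N • !![P.mono x⁻¹ 1 1, -P.mono x⁻¹ 0 1; -P.mono x⁻¹ 1 0, P.mono x⁻¹ 0 0]

/-- The boundary matrix `K₋(x) = K(x; ζ₋, κ₋, τ₋)`. -/
def K (x : ℂ) : Matrix (Fin 2) (Fin 2) ℂ :=
  (1 / (P.zeta - 1 / P.zeta)) •
    !![x * P.zeta / P.s - P.s / (x * P.zeta),
       P.kappa * Complex.exp P.tau * (x ^ 2 / P.q - P.q / x ^ 2);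
       P.kappa * Complex.exp (-P.tau) * (x ^ 2 / P.q - P.q / x ^ 2),
       P.s * P.zeta / x - x / (P.zeta * P.s)]

/-- The boundary monodromy matrix `𝒰₋(x) = M(x) K₋(x) M̂(x) = (𝒜₋, ℬ₋; 𝒞₋, 𝒟₋)`. -/
def U (x : ℂ) : Matrix (Fin 2) (Fin 2) (Op p N) :=
  P.mono x * (P.K x).map (fun z => z • (1 : Op p N)) * P.monoHat x

/-- The gauge transformed operator `𝒜₋(x|B)`. -/
def gaugeA (x B : ℂ) : Op p N :=
  (1 / (B / P.q ^ 2 - P.q ^ 2 / B)) •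
    (-(x * P.s ^ 3 / B) • P.U x 0 0 - (P.ga * P.q) • P.U x 0 1
      + (1 / (P.ga * P.q)) • P.U x 1 0 + (B / (x * P.s ^ 3)) • P.U x 1 1)

/-- The gauge transformed operator `ℬ₋(x|B)`. -/
def gaugeB (x B : ℂ) : Op p N :=
  (1 / (B - 1 / B)) •
    (-(x * B / P.s) • P.U x 0 0 - (P.ga * P.q) • P.U x 0 1
      + (B ^ 2 / (P.ga * P.q)) • P.U x 1 0 + (B * P.s / x) • P.U x 1 1)

/-- The gauge transformed operator `𝒟₋(x|B)`. -/
def gaugeD (x B : ℂ) : Op p N :=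
  (1 / (B - 1 / B)) •
    ((x * B / P.s) • P.U x 0 0 + (P.ga * P.q) • P.U x 0 1
      - (1 / (P.ga * P.q)) • P.U x 1 0 - (P.s / (x * B)) • P.U x 1 1)

end Operators

/-! ### Scalar functions -/

/-- `g₋(x)`. -/
def g (x : ℂ) : ℂ :=
  (x * P.alm / P.s - P.s / (x * P.alm)) * (x * P.bem / P.s + P.s / (x * P.bem)) /
    ((P.alm - 1 / P.alm) * (P.bem + 1 / P.bem))

/-- `a(x)`. -/
def aFun (x : ℂ) : ℂ :=
  P.a0 * ∏ n, (P.be n / x + P.q⁻¹ * (P.b n * P.al n / P.a n) * x)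

/-- `d(x)`. -/
def dFun (x : ℂ) : ℂ :=
  (-1) ^ N / P.a0 *
    ∏ n, (P.a n * P.c n / P.al n * (1 / x + P.q * (P.d n * P.al n / (P.c n * P.be n)) * x))

/-- `𝖠₋(x) = g₋(x) a(x q^{-1/2}) d(1/(q^{1/2} x))`. -/
def sfA (x : ℂ) : ℂ := P.g x * P.aFun (x / P.s) * P.dFun (1 / (P.s * x))

/-- `𝖣₋(x) = k(x) 𝖠₋(q/x)`. -/
def sfD (x : ℂ) : ℂ :=
  (x ^ 2 - 1 / x ^ 2) / (x ^ 2 / P.q ^ 2 - P.q ^ 2 / x ^ 2) * P.sfA (P.q / x)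

/-- `zₙ^{(ε,k)}`. -/
def z (ε : ℤˣ) (k : ℤ) (n : Fin N) : ℂ :=
  -(P.q ^ k * P.s) * (if ε = 1 then P.rho n * (P.a n / P.c n) else 1) * (P.al n / P.a n)

/-- `wₙ^{(ε,k)}`. -/
def w (ε : ℤˣ) (k : ℤ) (n : Fin N) : ℂ :=
  -(P.s * P.q ^ (-k)) * (if ε = 1 then (P.rho n)⁻¹ * (P.d n / P.b n) else 1) *
    (P.be n / P.d n)

/-- `f(α, B, γ) = (-1)^N γ (1 - B²) / (α B)`. -/
def f (B γ : ℂ) : ℂ := (-1) ^ N * (γ * (1 - B ^ 2) / (P.ga * B))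

/-- The prefactor `b₋(B)` of the pseudo-eigenvalues, where `y` is the value of the internal
gauge parameter `z₁^{(ε₁, k₁ ± 1)}`. -/
def prefactor (ε : Fin N → ℤˣ) (B y : ℂ) : ℂ :=
  P.f (B / P.q) y * (B ^ 4 / P.q ^ 2 / ((1 - B ^ 2) * (1 - (B / P.q) ^ 2))) *
    (-1) ^ N * (∏ n, P.gam n ^ 2 / P.mu (ε n) n ^ 2) *
    ((y * Complex.exp P.tau * P.kappa + P.zeta - P.kappa / (y * Complex.exp P.tau)) /
      (P.zeta - 1 / P.zeta))

/-- The pseudo-eigenvalue `b_h(x)` with prefactor `bm` and zeros given by `b`. -/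
def pseudoEig (bm : ℂ) (b : Fin N → ℂ) (h : Lab p N) (x : ℂ) : ℂ :=
  bm * (x ^ 2 / P.q - P.q / x ^ 2) *
    ∏ n, ((x / (b n * P.q ^ (h n : ℕ)) - b n * P.q ^ (h n : ℕ) / x) *
      (x * P.q ^ (h n : ℕ) * b n - 1 / (x * P.q ^ (h n : ℕ) * b n)))

/-! ### States -/

/-- The ratio `(aₙ q^{r-1/2} + bₙ q^{1/2-r}) / (cₙ q^{r-1/2} + dₙ q^{1/2-r})`. -/
def ratio (n : Fin N) (r : ℕ) : ℂ :=
  (P.a n * P.s ^ (2 * (r : ℤ) - 1) + P.b n * P.s ^ (1 - 2 * (r : ℤ))) /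
    (P.c n * P.s ^ (2 * (r : ℤ) - 1) + P.d n * P.s ^ (1 - 2 * (r : ℤ)))

/-- Coordinate at `⟨h, n|` of the local left reference state with integer `k`. -/
def leftLocal (ε : ℤˣ) (k : ℤ) (n : Fin N) (h : ℕ) : ℂ :=
  P.q ^ ((h : ℤ) * (k + 1)) *
    (if ε = 1 then ∏ r ∈ Finset.Icc 1 h, P.ratio n r * P.rho n else 1)

/-- Coordinate at `|h, n⟩` of the local right reference state with integer `k`. -/
def rightLocal (ε : ℤˣ) (k : ℤ) (n : Fin N) (h : ℕ) : ℂ :=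
  P.q ^ (-((h : ℤ) * k)) *
    (if ε = 1 then ∏ r ∈ Finset.Icc 1 h, (P.ratio n r)⁻¹ * (P.rho n)⁻¹ else 1)

/-- The left reference state: the tensor product of the local left states. -/
def leftRef (ε : Fin N → ℤˣ) (k : Fin N → ℤ) : State p N :=
  fun h => ∏ n, P.leftLocal (ε n) (k n) n (h n)

/-- The tensor product of the local right states. -/
def rightRef (ε : Fin N → ℤˣ) (k : Fin N → ℤ) : State p N :=
  fun h => ∏ n, P.rightLocal (ε n) (k n) n (h n)

variable {p} [NeZero p]

/-- `⟨B, h| = (1/𝗇) ⟨Ω| ∏ₙ ∏_{k=1}^{hₙ} 𝒜₋(q^{1-k}/bₙ | B q²) / 𝖠₋(q^{1-k}/bₙ)`,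
factors ordered from left to right by increasing `n`, then increasing `k` (here `k = j + 1`). -/
def leftState (nrm : ℂ) (Ω : State p N) (b : Fin N → ℂ) (B : ℂ) (h : Lab p N) : State p N :=
  nrm⁻¹ • (Ω ᵥ* (List.ofFn fun n : Fin N => ((List.range (h n)).map fun j =>
    (P.sfA ((P.q ^ j)⁻¹ / b n))⁻¹ • P.gaugeA (p := p) ((P.q ^ j)⁻¹ / b n) (B * P.q ^ 2)).prod).prod)

/-- `|B, h⟩ = (1/𝗇) ∏ₙ ∏_{k=1}^{hₙ} (𝒟₋(q^{1-k}/bₙ | B) / 𝖣₋(q^{1-k}/bₙ)) |Ω⟩`,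
where, within site `n`, the factor `k = 1` acts first. -/
def rightState (nrm : ℂ) (Ω : State p N) (b : Fin N → ℂ) (B : ℂ) (h : Lab p N) : State p N :=
  nrm⁻¹ • ((List.ofFn fun n : Fin N => ((List.range (h n)).reverse.map fun j =>
    (P.sfD ((P.q ^ j)⁻¹ / b n))⁻¹ • P.gaugeD (p := p) ((P.q ^ j)⁻¹ / b n) B).prod).prod *ᵥ Ω)

/-- `∏ₙ ∏_{r=1}^{p-1} 𝒟₋(bₙ / q^r | B) |Ω̄⟩`, where, within site `n`, the factor `r = 1` acts
first (here `r = j + 1`). -/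
def rightOmega (Ωbar : State p N) (b : Fin N → ℂ) (B : ℂ) : State p N :=
  (List.ofFn fun n : Fin N => ((List.range (p - 1)).reverse.map fun j =>
    P.gaugeD (p := p) (b n / P.q ^ (j + 1)) B).prod).prod *ᵥ Ωbar

end Params

end CyclicReflection

end

/-! The boundary monodromy matrix U(x) = M(x) K₋(x) M̂(x) satisfies the reflection equation: the Lax
operators obey the six-vertex exchange relation (`lax_exchange`), K₋ is a scalar solution
(`K_reflection`), and Sklyanin's dressing combines the two (`Reflection.dress`, `U_reflection`). Up
to a scalar, ℬ₋(x|B) is U(x) contracted between a gauge row (-1, g/x) and a gauge column (x g/q, 1),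
with g proportional to B (`gaugeB_eq`).

The states are built by a ladder. On a bra annihilated by ℬ₋(y|β_j), the operator 𝒜₋(y|β_j q²)
reduces to a multiple of U₀₀(y) - (g/y) U₁₀(y), and the suitably contracted reflection equation has
a single exchange term (`Reflection.bra_shift`, `bra_exchange`). Its coefficient is exactly the
ratio by which the pseudo-eigenvalue changes when a zero z becomes q z (`zeroForm_update`), so
acting with 𝒜₋ at y = 1/z multiplies that zero by q and leaves the other zeros and the prefactor
alone (`BraChain.shift`). The new bra is nonzero because U(y) U(q/y) is a scalar, a product of
quantum determinants (`U_mul_U`, `bra_shift_ne_zero`), and genericity keeps the points in use away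
from its zeros (`Generic.regular`). Kets are the mirror image, with 𝒟₋ and j lowered.

The ladder starts from tensor products. A gauge row with the right parameter passes through L_n: it
changes the integer k of the local state by one and leaves as a gauge row with a new parameter
(`leftRef_lax`, `rightRef_lax`). The relations between z_{n+1} and w_n make consecutive sites fit, β
= α w_N fits the external gauge, and K₋ contributes the boundary factor (`K_contract`). For bras the
resulting zeros are already μ q^{1/2}. For kets they are μ q^{-1/2}; p - 1 steps on the reciprocal
zeros lead to μ q^{1/2}, since q^p = 1 (`rightOmega_chain`).

Finally, distinct labels give pseudo-eigenvalues with separated zeros, which forces linear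
independence although the operators move j (`linearIndependent_of_pseudoEigen`); a dimension count
then gives bases. -/

noncomputable section

namespace CyclicReflection

set_option linter.unusedSectionVars false

open Topology Filter

/-! ### Six-vertex exchange relations and crossing -/

section SixVertex

variable {𝒜 : Type*} [Ring 𝒜]

/-- `X ⊗ 1` on the tensor product of two auxiliary spaces. -/
def fstAux (X : Matrix (Fin 2) (Fin 2) 𝒜) : Matrix (Fin 2 × Fin 2) (Fin 2 × Fin 2) 𝒜 :=
  Matrix.of fun i j => if i.2 = j.2 then X i.1 j.1 else 0

/-- `1 ⊗ X` on the tensor product of two auxiliary spaces. -/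
def sndAux (X : Matrix (Fin 2) (Fin 2) 𝒜) : Matrix (Fin 2 × Fin 2) (Fin 2 × Fin 2) 𝒜 :=
  Matrix.of fun i j => if i.1 = j.1 then X i.2 j.2 else 0

/-- The adjugate `σ^y Xᵗ σ^y` of a `2 × 2` matrix of operators. -/
def adj2 (X : Matrix (Fin 2) (Fin 2) 𝒜) : Matrix (Fin 2) (Fin 2) 𝒜 :=
  !![X 1 1, -X 0 1; -X 1 0, X 0 0]

theorem fstAux_mul (X Y : Matrix (Fin 2) (Fin 2) 𝒜) : fstAux (X * Y) = fstAux X * fstAux Y := by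
  ext ⟨i, k⟩ ⟨j, l⟩
  fin_cases i <;> fin_cases j <;> fin_cases k <;> fin_cases l <;>
    simp [fstAux, Matrix.mul_apply, Fintype.sum_prod_type]

theorem sndAux_mul (X Y : Matrix (Fin 2) (Fin 2) 𝒜) : sndAux (X * Y) = sndAux X * sndAux Y := by
  ext ⟨i, k⟩ ⟨j, l⟩
  fin_cases i <;> fin_cases j <;> fin_cases k <;> fin_cases l <;>
    simp [sndAux, Matrix.mul_apply, Fintype.sum_prod_type]

theorem fstAux_sndAux_comm {X Y : Matrix (Fin 2) (Fin 2) 𝒜}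
    (h : ∀ i j k l, Commute (X i j) (Y k l)) : Commute (fstAux X) (sndAux Y) := by
  ext ⟨i, k⟩ ⟨j, l⟩
  fin_cases i <;> fin_cases j <;> fin_cases k <;> fin_cases l <;>
    simp [fstAux, sndAux, Matrix.mul_apply, Fintype.sum_prod_type, (h _ _ _ _).eq]

variable [Algebra ℂ 𝒜]

/-- The six-vertex matrix with weights `a, b, c`. -/
def sixVertex (𝒜 : Type*) [Ring 𝒜] [Algebra ℂ 𝒜] (a b c : ℂ) :
    Matrix (Fin 2 × Fin 2) (Fin 2 × Fin 2) 𝒜 :=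
  Matrix.of fun i j =>
    (if i = j then (if i.1 = i.2 then a else b) else if i.1 = j.2 ∧ i.2 = j.1 then c else 0) •
      (1 : 𝒜)

/-- The Yang–Baxter exchange relation between `X` and `Y`. -/
def Exchange (a b c : ℂ) (X Y : Matrix (Fin 2) (Fin 2) 𝒜) : Prop :=
  sixVertex 𝒜 a b c * fstAux X * sndAux Y = sndAux Y * fstAux X * sixVertex 𝒜 a b c

/-- The train argument: because X' commutes with Y and X with Y', the six-vertex matrix can be
pulled through the two factors one after the other. -/
theorem Exchange.mul {a b c : ℂ} {X Y X' Y' : Matrix (Fin 2) (Fin 2) 𝒜}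
    (h : Exchange a b c X Y) (h' : Exchange a b c X' Y')
    (h₁ : ∀ i j k l, Commute (X' i j) (Y k l)) (h₂ : ∀ i j k l, Commute (X i j) (Y' k l)) :
    Exchange a b c (X * X') (Y * Y') := by
  have e₁ := (fstAux_sndAux_comm h₁).eq
  have e₂ := (fstAux_sndAux_comm h₂).eq
  unfold Exchange at *
  rw [fstAux_mul, sndAux_mul]
  calc sixVertex 𝒜 a b c * (fstAux X * fstAux X') * (sndAux Y * sndAux Y')
      = sixVertex 𝒜 a b c * fstAux X * (fstAux X' * sndAux Y) * sndAux Y' := by noncomm_ring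
    _ = (sixVertex 𝒜 a b c * fstAux X * sndAux Y) * fstAux X' * sndAux Y' := by
        rw [e₁]; noncomm_ring
    _ = sndAux Y * fstAux X * (sixVertex 𝒜 a b c * fstAux X' * sndAux Y') := by
        rw [h]; noncomm_ring
    _ = sndAux Y * (fstAux X * sndAux Y') * fstAux X' * sixVertex 𝒜 a b c := by
        rw [h']; noncomm_ring
    _ = _ := by rw [e₂]; noncomm_ring

theorem Exchange.one (a b c : ℂ) : Exchange a b c (1 : Matrix (Fin 2) (Fin 2) 𝒜) 1 := by
  have e₁ : fstAux (1 : Matrix (Fin 2) (Fin 2) 𝒜) = 1 := by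
    ext ⟨i, k⟩ ⟨j, l⟩
    fin_cases i <;> fin_cases j <;> fin_cases k <;> fin_cases l <;> simp [fstAux]
  have e₂ : sndAux (1 : Matrix (Fin 2) (Fin 2) 𝒜) = 1 := by
    ext ⟨i, k⟩ ⟨j, l⟩
    fin_cases i <;> fin_cases j <;> fin_cases k <;> fin_cases l <;> simp [sndAux]
  simp [Exchange, e₁, e₂]

/-- The exchange relation, entry by entry. -/
theorem exchange_iff (a b c : ℂ) (X Y : Matrix (Fin 2) (Fin 2) 𝒜) :
    Exchange a b c X Y ↔ ∀ i k j l : Fin 2,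
      (if i = k then a • (X i j * Y k l) else b • (X i j * Y k l) + c • (X k j * Y i l)) =
      (if j = l then a • (Y k l * X i j) else b • (Y k l * X i j) + c • (Y k j * X i l)) := by
  constructor
  · intro h i k j l
    have := congrFun (congrFun h (i, k)) (j, l)
    revert this
    fin_cases i <;> fin_cases k <;> fin_cases j <;> fin_cases l <;>
      simp [sixVertex, fstAux, sndAux, Matrix.mul_apply, Fintype.sum_prod_type] <;>
      intro h <;> linear_combination (norm := module) h
  · intro h
    ext ⟨i, k⟩ ⟨j, l⟩
    have := h i k j l
    revert this
    fin_cases i <;> fin_cases k <;> fin_cases j <;> fin_cases l <;>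
      simp [sixVertex, fstAux, sndAux, Matrix.mul_apply, Fintype.sum_prod_type] <;>
      intro h <;> linear_combination (norm := module) h

/-- Crossing symmetry. Taking the adjugate in one auxiliary space permutes the entries of the
exchange relation up to sign, and the partially transposed six-vertex matrix is again six-vertex,
with weights -b, -a, c. -/
theorem Exchange.adj2_fst {a b c : ℂ} {X Y : Matrix (Fin 2) (Fin 2) 𝒜} (h : Exchange a b c X Y) :
    fstAux (adj2 X) * sixVertex 𝒜 (-b) (-a) c * sndAux Y =
      sndAux Y * sixVertex 𝒜 (-b) (-a) c * fstAux (adj2 X) := by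
  rw [exchange_iff] at h
  ext ⟨i, k⟩ ⟨j, l⟩
  have := h (1 - j) k (1 - i) l
  revert this
  fin_cases i <;> fin_cases k <;> fin_cases j <;> fin_cases l <;>
    simp [sixVertex, fstAux, sndAux, adj2, Matrix.mul_apply, Fintype.sum_prod_type] <;>
    intro h <;> first
      | linear_combination (norm := module) h
      | linear_combination (norm := module) -h

theorem Exchange.adj2_snd {a b c : ℂ} {X Y : Matrix (Fin 2) (Fin 2) 𝒜} (h : Exchange a b c Y X) :
    fstAux X * sixVertex 𝒜 (-b) (-a) c * sndAux (adj2 Y) =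
      sndAux (adj2 Y) * sixVertex 𝒜 (-b) (-a) c * fstAux X := by
  rw [exchange_iff] at h
  ext ⟨i, k⟩ ⟨j, l⟩
  have := h (1 - l) i (1 - k) j
  revert this
  fin_cases i <;> fin_cases k <;> fin_cases j <;> fin_cases l <;>
    simp [sixVertex, fstAux, sndAux, adj2, Matrix.mul_apply, Fintype.sum_prod_type] <;>
    intro h <;> first
      | linear_combination (norm := module) h
      | linear_combination (norm := module) -h

/-- Transposing in both auxiliary spaces reverses the matrix factors but not the operator entries.
The six-vertex matrix is unchanged by this and by exchanging the two spaces, so the relation returns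
with its two arguments interchanged. -/
theorem Exchange.adj2_adj2 {a b c : ℂ} {X Y : Matrix (Fin 2) (Fin 2) 𝒜}
    (h : Exchange a b c Y X) : Exchange a b c (adj2 X) (adj2 Y) := by
  rw [exchange_iff] at h ⊢
  intro i k j l
  have := h (1 - l) (1 - j) (1 - k) (1 - i)
  revert this
  fin_cases i <;> fin_cases k <;> fin_cases j <;> fin_cases l <;>
    simp [adj2] <;> intro h <;> first
      | linear_combination (norm := module) h
      | linear_combination (norm := module) -h

end SixVertex

/-! ### The reflection equation and its gauge contractions -/

section Reflection

variable {𝒜 : Type*} [Ring 𝒜] [Algebra ℂ 𝒜]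

/-- The reflection equation, entry-free form, with weights `a, b, c` and `a', b', c`. -/
def Reflection (a b a' b' c : ℂ) (U V : Matrix (Fin 2) (Fin 2) 𝒜) : Prop :=
  sixVertex 𝒜 a b c * fstAux U * sixVertex 𝒜 a' b' c * sndAux V =
    sndAux V * sixVertex 𝒜 a' b' c * fstAux U * sixVertex 𝒜 a b c

/-- Sklyanin's dressing: the entries of K and L are central, so K and L pass through the other
factors, and each crossing of two dressed factors is one of the four exchange relations. -/
theorem Reflection.dress {a b a' b' c : ℂ} {X Y X' Y' K L : Matrix (Fin 2) (Fin 2) 𝒜}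
    (hXY : Exchange a b c X Y) (hXY' : Exchange a b c X' Y')
    (h₁ : fstAux X' * sixVertex 𝒜 a' b' c * sndAux Y = sndAux Y * sixVertex 𝒜 a' b' c * fstAux X')
    (h₂ : fstAux X * sixVertex 𝒜 a' b' c * sndAux Y' = sndAux Y' * sixVertex 𝒜 a' b' c * fstAux X)
    (hK : Reflection a b a' b' c K L)
    (cK : ∀ i j x, Commute (K i j) x) (cL : ∀ i j x, Commute (L i j) x) :
    Reflection a b a' b' c (X * K * X') (Y * L * Y') := by
  have k₁ := (fstAux_sndAux_comm (X := K) (Y := Y) fun i j k l => cK _ _ _).eq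
  have k₂ := (fstAux_sndAux_comm (X := K) (Y := Y') fun i j k l => cK _ _ _).eq
  have l₁ := (fstAux_sndAux_comm (X := X) (Y := L) fun i j k l => (cL _ _ _).symm).eq
  have l₂ := (fstAux_sndAux_comm (X := X') (Y := L) fun i j k l => (cL _ _ _).symm).eq
  unfold Reflection Exchange at *
  simp only [fstAux_mul, sndAux_mul]
  generalize sixVertex 𝒜 a b c = R at *
  generalize sixVertex 𝒜 a' b' c = R' at *
  generalize fstAux X = x at *
  generalize fstAux X' = x' at *
  generalize fstAux K = k at *
  generalize sndAux Y = y at *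
  generalize sndAux Y' = y' at *
  generalize sndAux L = l at *
  calc R * (x * k * x') * R' * (y * l * y')
      = R * x * k * (x' * R' * y) * l * y' := by noncomm_ring
    _ = R * x * (k * y) * R' * (x' * l) * y' := by rw [h₁]; noncomm_ring
    _ = (R * x * y) * k * R' * l * x' * y' := by rw [k₁, l₂]; noncomm_ring
    _ = y * x * (R * k * R' * l) * x' * y' := by rw [hXY]; noncomm_ring
    _ = y * x * l * R' * k * (R * x' * y') := by rw [hK]; noncomm_ring
    _ = y * (x * l) * R' * (k * y') * x' * R := by rw [hXY']; noncomm_ring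
    _ = y * l * (x * R' * y') * k * x' * R := by rw [l₁, k₂]; noncomm_ring
    _ = y * l * y' * R' * (x * k * x') * R := by rw [h₂]; noncomm_ring
    _ = _ := by noncomm_ring

theorem Reflection.smul {a b a' b' c : ℂ} {U V : Matrix (Fin 2) (Fin 2) 𝒜}
    (h : Reflection a b a' b' c U V) (r t : ℂ) : Reflection a b a' b' c (r • U) (t • V) := by
  have e₁ : fstAux (r • U) = r • fstAux U := by ext i j; simp [fstAux]
  have e₂ : sndAux (t • V) = t • sndAux V := by ext i j; simp [sndAux]
  unfold Reflection at *
  simp only [e₁, e₂, mul_smul_comm, smul_mul_assoc, h]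
  rw [smul_comm]

/-- The row-column contraction `r U c` with gauge row `(-1, g/x)` and gauge column `(x g/q, 1)`. -/
def gaugeContract (q g x : ℂ) (U : Matrix (Fin 2) (Fin 2) 𝒜) : 𝒜 :=
  -(x * g / q) • U 0 0 - U 0 1 + (g ^ 2 / q) • U 1 0 + (g / x) • U 1 1

/-- The hypotheses say that the row (1, -g/y) V, applied to Φ, equals Φ' (1, -g y/q), that is, it
vanishes on the gauge column (y g/q, 1). This is what removes the unwanted terms of the reflection
equation, leaving one exchange term in which g becomes g/q² inside the shift. -/
theorem Reflection.bra_shift {q x y g : ℂ} (hq : q ≠ 0) (hx : x ≠ 0) (hy : y ≠ 0)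
    {U V : Matrix (Fin 2) (Fin 2) 𝒜}
    (h : Reflection (x / y * q - y / (x * q)) (x / y - y / x) (x * y - 1 / (x * y))
      (x * y / q - q / (x * y)) (q - 1 / q) U V)
    {Φ Φ' : 𝒜} (h₀ : Φ * V 0 0 = (g / y) • (Φ * V 1 0) + Φ')
    (h₁ : Φ * V 0 1 = (g / y) • (Φ * V 1 1) - (g * y / q) • Φ') :
    ((x / y * q - y / (x * q)) * (x * y / q - q / (x * y))) •
        (Φ * gaugeContract q g x U * (V 0 0 - (g / (q ^ 2 * y)) • V 1 0)) =
      ((x * y - 1 / (x * y)) * (x / y - y / x)) • (Φ' * gaugeContract q g x U) := by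
  have e : ∀ i k j : Fin 2, _ := fun i k j => congrArg (Φ * ·) (congrFun (congrFun h (i, k)) (j, 0))
  have e000 := e 0 0 0
  have e001 := e 0 0 1
  have e010 := e 0 1 0
  have e011 := e 0 1 1
  have e100 := e 1 0 0
  have e101 := e 1 0 1
  have e110 := e 1 1 0
  have e111 := e 1 1 1
  clear e h
  simp [sixVertex, fstAux, sndAux, Matrix.mul_apply, Fintype.sum_prod_type, mul_add, add_mul,
    ← mul_assoc, h₀, h₁, sub_mul, smul_add, smul_sub, smul_smul] at e000 e001 e010 e011 e100 e101 e110 e111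
  simp only [gaugeContract, mul_add, mul_sub, add_mul, sub_mul, mul_neg, neg_mul, mul_smul_comm, smul_mul_assoc,
    neg_smul]
  -- The coefficients contract the equation with the row (-1, g/(q x)) ⊗ (1, -g/y) and the column (x
  -- g/q², 1) ⊗ e₀: in the first space these are the gauge vectors at x with g replaced by g/q.
  linear_combination (norm := skip) (-1 * (x * g / q ^ 2) : ℂ) • e000 +
    (-1 * 1 : ℂ) • e001 +
    ((g / y) * (x * g / q ^ 2) : ℂ) • e010 +
    ((g / y) * 1 : ℂ) • e011 +
    ((g / (q * x)) * (x * g / q ^ 2) : ℂ) • e100 +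
    ((g / (q * x)) * 1 : ℂ) • e101 +
    (-(g / (q * x)) * (g / y) * (x * g / q ^ 2) : ℂ) • e110 +
    (-(g / (q * x)) * (g / y) * 1 : ℂ) • e111
  match_scalars
  all_goals field_simp
  all_goals ring

/-- Mirror image of `Reflection.bra_shift`: V (y g/q, 1)ᵗ applied to Ψ equals (g/y, 1)ᵗ Ψ', which
the gauge row (-1, g/y) kills. Here g becomes g q² in the shift. -/
theorem Reflection.ket_shift {q x y g : ℂ} (hq : q ≠ 0) (hx : x ≠ 0) (hy : y ≠ 0)
    {U V : Matrix (Fin 2) (Fin 2) 𝒜}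
    (h : Reflection (x / y * q - y / (x * q)) (x / y - y / x) (x * y - 1 / (x * y))
      (x * y / q - q / (x * y)) (q - 1 / q) U V)
    {Ψ Ψ' : 𝒜} (h₀ : V 0 1 * Ψ = (g / y) • Ψ' - (y * g / q) • (V 0 0 * Ψ))
    (h₁ : V 1 1 * Ψ = Ψ' - (y * g / q) • (V 1 0 * Ψ)) :
    ((x / y * q - y / (x * q)) * (x * y / q - q / (x * y))) •
        (((y * g * q) • V 1 0 + V 1 1) * (gaugeContract q g x U * Ψ)) =
      ((x * y - 1 / (x * y)) * (x / y - y / x)) • (gaugeContract q g x U * Ψ') := by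
  have e : ∀ i j l : Fin 2, _ := fun i j l => congrArg (· * Ψ) (congrFun (congrFun h (i, 1)) (j, l))
  have e000 := e 0 0 0
  have e001 := e 0 0 1
  have e010 := e 0 1 0
  have e011 := e 0 1 1
  have e100 := e 1 0 0
  have e101 := e 1 0 1
  have e110 := e 1 1 0
  have e111 := e 1 1 1
  clear e h
  simp [sixVertex, fstAux, sndAux, Matrix.mul_apply, Fintype.sum_prod_type, mul_add, add_mul,
    mul_assoc, h₀, h₁, mul_sub, smul_add, smul_sub, smul_smul] at e000 e001 e010 e011 e100 e101 e110 e111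
  simp only [gaugeContract, mul_add, mul_sub, add_mul, sub_mul, mul_neg, neg_mul, mul_smul_comm, smul_mul_assoc,
    mul_assoc, neg_smul]
  -- The contraction is with the row (1, -g q/x) ⊗ e₁ and the column (x g, 1) ⊗ (y g/q, 1): in the
  -- first space these are, up to sign, the gauge vectors at x with g replaced by g q.
  linear_combination (norm := skip) ((x * g) * (y * g / q) : ℂ) • e000 +
    ((x * g) * 1 : ℂ) • e001 +
    (1 * (y * g / q) : ℂ) • e010 +
    (1 * 1 : ℂ) • e011 +
    (-(g * q / x) * (x * g) * (y * g / q) : ℂ) • e100 +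
    (-(g * q / x) * (x * g) * 1 : ℂ) • e101 +
    (-(g * q / x) * 1 * (y * g / q) : ℂ) • e110 +
    (-(g * q / x) * 1 * 1 : ℂ) • e111
  match_scalars
  all_goals field_simp
  all_goals ring

end Reflection
-- Weyl algebra and the exchange relation of a single site
/-- The cyclic raising of the label of site `n`. -/
def raise (p : ℕ) [NeZero p] {N : ℕ} (n : Fin N) : Equiv.Perm (Lab p N) where
  toFun h := Function.update h n (h n + 1)
  invFun h := Function.update h n (h n - 1)
  left_inv h := by simp
  right_inv h := by simp

theorem raise_comm (p : ℕ) [NeZero p] {N : ℕ} {n m : Fin N} (h : n ≠ m) (x : Lab p N) :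
    raise p n (raise p m x) = raise p m (raise p n x) := by
  simp only [raise, Equiv.coe_fn_mk, Function.update_of_ne h, Function.update_of_ne h.symm]
  exact Function.update_comm h.symm _ _ _

theorem raise_symm_apply_of_ne (p : ℕ) [NeZero p] {N : ℕ} {n m : Fin N} (h : m ≠ n)
    (x : Lab p N) : (raise p n).symm x m = x m := by
  simp [raise, Function.update_of_ne h]

theorem raise_apply_of_ne (p : ℕ) [NeZero p] {N : ℕ} {n m : Fin N} (h : m ≠ n)
    (x : Lab p N) : raise p n x m = x m := by
  simp [raise, Function.update_of_ne h]

theorem pow_val_add_one {p : ℕ} [NeZero p] {q : ℂ} (hq : q ^ p = 1) (i : Fin p) :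
    q ^ ((i + 1 : Fin p) : ℕ) = q ^ (i : ℕ) * q := by
  rw [← pow_succ, Fin.val_add, ← pow_eq_pow_mod _ hq, Fin.val_one', pow_add,
    ← pow_eq_pow_mod _ hq, pow_add]

namespace Params

variable {N : ℕ} (P : Params N) {p : ℕ} [NeZero p]

theorem u_apply (n : Fin N) (h h' : Lab p N) :
    u n h h' = if h' = raise p n h then 1 else 0 := rfl

theorem u_mul_apply (n : Fin N) (X : Op p N) (h h' : Lab p N) :
    (u n * X : Op p N) h h' = X (raise p n h) h' := by
  simp [Matrix.mul_apply, u_apply]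

theorem uInv_mul_apply (n : Fin N) (X : Op p N) (h h' : Lab p N) :
    (uInv n * X : Op p N) h h' = X ((raise p n).symm h) h' := by
  simp [Matrix.mul_apply, uInv, u_apply, ← Equiv.symm_apply_eq]

theorem u_mul_uInv (n : Fin N) : (u n * uInv n : Op p N) = 1 := by
  ext h h'
  simp [u_mul_apply, uInv, u_apply, Matrix.one_apply, eq_comm]

theorem uInv_mul_u (n : Fin N) : (uInv n * u n : Op p N) = 1 :=
  mul_eq_one_comm.mp (u_mul_uInv n)

theorem diagonal_mul_u (n : Fin N) (f : Lab p N → ℂ) :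
    diagonal f * u n = u n * diagonal fun h => f ((raise p n).symm h) := by
  ext h h'
  rw [u_mul_apply, Matrix.diagonal_mul, u_apply, Matrix.diagonal_apply]
  by_cases e : h' = raise p n h <;> simp [e, eq_comm]

theorem diagonal_mul_uInv (n : Fin N) (f : Lab p N → ℂ) :
    diagonal f * uInv n = uInv n * diagonal fun h => f (raise p n h) := by
  ext h h'
  rw [uInv_mul_apply, Matrix.diagonal_mul, uInv, Matrix.transpose_apply, u_apply,
    Matrix.diagonal_apply]
  by_cases e : (raise p n).symm h = h'
  · simp [← e]
  · have : ¬ h = raise p n h' := fun e' => e (by simp [e'])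
    simp [e, this]

theorem u_comm {n m : Fin N} (h : n ≠ m) : Commute (u n : Op p N) (u m) := by
  ext x y
  rw [u_mul_apply, u_mul_apply, u_apply, u_apply, raise_comm p h]

theorem uInv_comm_right {n : Fin N} {X : Op p N} (h : Commute X (u n)) : Commute X (uInv n) := by
  have e : X * uInv n = (uInv n * u n) * (X * uInv n) := by rw [uInv_mul_u, one_mul]
  rw [Commute, SemiconjBy, e]
  calc uInv n * u n * (X * uInv n) = uInv n * (u n * X) * uInv n := by simp only [mul_assoc]
    _ = uInv n * X * (u n * uInv n) := by rw [← h.eq]; simp only [mul_assoc]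
    _ = _ := by rw [u_mul_uInv, mul_one]

theorem diagonal_comm_u (n : Fin N) {f : Lab p N → ℂ} (h : ∀ x, f ((raise p n).symm x) = f x) :
    Commute (diagonal f) (u n) := by
  rw [Commute, SemiconjBy, diagonal_mul_u]
  simp [h]

theorem v_comm (n m : Fin N) : Commute (P.v n : Op p N) (P.v m) := by
  simp [Commute, SemiconjBy, v, Matrix.diagonal_mul_diagonal, mul_comm]

theorem v_comm_vInv (n m : Fin N) : Commute (P.v n : Op p N) (P.vInv m) := by
  simp [Commute, SemiconjBy, v, vInv, Matrix.diagonal_mul_diagonal, mul_comm]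

theorem vInv_comm (n m : Fin N) : Commute (P.vInv n : Op p N) (P.vInv m) := by
  simp [Commute, SemiconjBy, vInv, Matrix.diagonal_mul_diagonal, mul_comm]

theorem v_comm_u {n m : Fin N} (h : n ≠ m) : Commute (P.v n : Op p N) (u m) :=
  diagonal_comm_u m fun x => by rw [raise_symm_apply_of_ne p h]

theorem vInv_comm_u {n m : Fin N} (h : n ≠ m) : Commute (P.vInv n : Op p N) (u m) :=
  diagonal_comm_u m fun x => by rw [raise_symm_apply_of_ne p h]

/-- An operator commuting with the Weyl operators of site `n` commutes with its Lax operator. -/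
theorem comm_lax {n : Fin N} {X : Op p N} (hv : Commute X (P.v n)) (hv' : Commute X (P.vInv n))
    (hu : Commute X (u n)) (x : ℂ) (i j : Fin 2) : Commute X (P.lax n x i j) := by
  have hu' := uInv_comm_right hu
  fin_cases i <;> fin_cases j
  · exact (hv.smul_right _).sub_right (hv'.smul_right _)
  · exact hu.mul_right ((hv.smul_right _).add_right (hv'.smul_right _))
  · exact hu'.mul_right ((hv.smul_right _).add_right (hv'.smul_right _))
  · exact (hv.smul_right _).sub_right (hv'.smul_right _)

theorem lax_comm {n m : Fin N} (h : n ≠ m) (x y : ℂ) (i j k l : Fin 2) :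
    Commute (P.lax (p := p) n x i j) (P.lax m y k l) := by
  refine P.comm_lax ?_ ?_ ?_ y k l <;> refine Commute.symm (P.comm_lax ?_ ?_ ?_ x i j)
  · exact P.v_comm m n
  · exact P.v_comm_vInv m n
  · exact P.v_comm_u h.symm
  · exact (P.v_comm_vInv n m).symm
  · exact P.vInv_comm m n
  · exact P.vInv_comm_u h.symm
  · exact (P.v_comm_u h).symm
  · exact (P.vInv_comm_u h).symm
  · exact u_comm h.symm

/-- The operator `f(vₙ)`. -/
def fv (n : Fin N) (f : ℂ → ℂ) : Op p N := diagonal fun h => f (P.q ^ (h n : ℕ))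

variable {P}

theorem fv_mul (n : Fin N) (f g : ℂ → ℂ) :
    P.fv n f * P.fv n g = (P.fv n fun x => f x * g x : Op p N) := by
  simp [fv, Matrix.diagonal_mul_diagonal]

/-- Together with `fv_mul_uInv` this moves every function of v to the right of u^{±1}; identities
between products of Lax entries then become scalar identities in the eigenvalue of v. -/
theorem fv_mul_u (hP : P.Admissible p) (n : Fin N) (f : ℂ → ℂ) :
    P.fv n f * u n = (u n * P.fv n fun x => f (x / P.q) : Op p N) := by
  have hq := hP.q_prim.ne_zero (NeZero.ne p)
  simp only [fv, diagonal_mul_u]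
  congr 3 with h
  have := pow_val_add_one hP.q_prim.pow_eq_one (h n - 1)
  rw [sub_add_cancel] at this
  rw [this]
  simp [raise, hq]

theorem fv_mul_uInv (hP : P.Admissible p) (n : Fin N) (f : ℂ → ℂ) :
    P.fv n f * uInv n = (uInv n * P.fv n fun x => f (x * P.q) : Op p N) := by
  simp only [fv, diagonal_mul_uInv]
  congr 3 with h
  rw [← pow_val_add_one hP.q_prim.pow_eq_one]
  simp [raise]

theorem smul_fv (n : Fin N) (r : ℂ) (f : ℂ → ℂ) :
    r • P.fv n f = (P.fv n fun x => r * f x : Op p N) := by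
  simp only [fv, ← Matrix.diagonal_smul]; rfl

theorem fv_add (n : Fin N) (f g : ℂ → ℂ) :
    P.fv n f + P.fv n g = (P.fv n fun x => f x + g x : Op p N) := by
  simp [fv, Matrix.diagonal_add]

theorem fv_sub (n : Fin N) (f g : ℂ → ℂ) :
    P.fv n f - P.fv n g = (P.fv n fun x => f x - g x : Op p N) := by
  simp [fv, Matrix.diagonal_sub]

/-- The eigenvalues of v are powers of q, so identities need only be checked for x ≠ 0, where x⁻¹ is
a genuine inverse. -/
theorem fv_congr (hP : P.Admissible p) (n : Fin N) {f g : ℂ → ℂ} (h : ∀ x ≠ 0, f x = g x) :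
    (P.fv n f : Op p N) = P.fv n g := by
  have hq := hP.q_prim.ne_zero (NeZero.ne p)
  simp only [fv]
  congr 1 with y
  exact h _ (pow_ne_zero _ hq)

theorem lax_eq (n : Fin N) (t : ℂ) : P.lax (p := p) n t =
    !![P.fv n fun x => t * P.al n * x - P.be n / t * x⁻¹,
       u n * P.fv n fun x => P.a n / P.s * x + P.s * P.b n * x⁻¹;
       uInv n * P.fv n fun x => P.s * P.c n * x + P.d n / P.s * x⁻¹,
       P.fv n fun x => P.gam n / t * x - P.del n * t * x⁻¹] := by
  have e₁ : (P.v n : Op p N) = P.fv n fun x => x := rfl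
  have e₂ : (P.vInv n : Op p N) = P.fv n fun x => x⁻¹ := rfl
  simp only [lax, e₁, e₂, smul_fv, fv_add, fv_sub]

theorem fv_mul_u_mul (hP : P.Admissible p) (n : Fin N) (f : ℂ → ℂ) (X : Op p N) :
    P.fv n f * (u n * X) = u n * ((P.fv n fun x => f (x / P.q)) * X) := by
  rw [← mul_assoc, fv_mul_u hP, mul_assoc]

theorem fv_mul_uInv_mul (hP : P.Admissible p) (n : Fin N) (f : ℂ → ℂ) (X : Op p N) :
    P.fv n f * (uInv n * X) = uInv n * ((P.fv n fun x => f (x * P.q)) * X) := by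
  rw [← mul_assoc, fv_mul_uInv hP, mul_assoc]

theorem u_mul_uInv_mul (n : Fin N) (X : Op p N) : u n * (uInv n * X) = X := by
  rw [← mul_assoc, u_mul_uInv, one_mul]

theorem uInv_mul_u_mul (n : Fin N) (X : Op p N) : uInv n * (u n * X) = X := by
  rw [← mul_assoc, uInv_mul_u, one_mul]

theorem u_mul_congr (n : Fin N) {X Y : Op p N} (h : X = Y) : u n * X = u n * Y := by rw [h]

theorem uInv_mul_congr (n : Fin N) {X Y : Op p N} (h : X = Y) : uInv n * X = uInv n * Y := by
  rw [h]

theorem q_ne (hP : P.Admissible p) : P.q ≠ 0 := hP.q_prim.ne_zero (NeZero.ne p)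

theorem s_ne (hP : P.Admissible p) : P.s ≠ 0 := fun h => q_ne hP (by simp [q, h])

-- The exchange relation is checked entry by entry: after normal ordering, each nontrivial entry is
-- a rational identity in the eigenvalue of v.
set_option maxHeartbeats 2000000 in
theorem lax_exchange (hP : P.Admissible p) (n : Fin N) {t t' : ℂ} (ht : t ≠ 0) (ht' : t' ≠ 0) :
    Exchange (t / t' * P.q - t' / (t * P.q)) (t / t' - t' / t) (P.q - 1 / P.q)
      (P.lax (p := p) n t) (P.lax n t') := by
  have hs := s_ne hP
  have ha := hP.al_ne n
  have hb := hP.be_ne n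
  rw [exchange_iff]
  intro i k j l
  fin_cases i <;> fin_cases k <;> fin_cases j <;> fin_cases l <;>
    simp only [Fin.zero_eta, Fin.mk_one, Fin.isValue, if_true, if_false, zero_ne_one, one_ne_zero,
      lax_eq, Matrix.of_apply, Matrix.cons_val', Matrix.cons_val_zero, Matrix.cons_val_one,
      Matrix.cons_val_fin_one,
      mul_assoc, fv_mul_u_mul hP, fv_mul_uInv_mul hP, u_mul_uInv_mul, uInv_mul_u_mul, fv_mul,
      ← mul_smul_comm, ← mul_add, smul_fv, fv_add] <;>
    (first
      | with_reducible refine fv_congr hP n fun x hx => ?_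
      | with_reducible refine u_mul_congr n (fv_congr hP n fun x hx => ?_)
      | with_reducible refine uInv_mul_congr n (fv_congr hP n fun x hx => ?_)) <;>
    simp only [q, gam, del] <;> field_simp <;> ring

end Params

/-! ### Products over the sites -/

section Chains

variable {𝒜 : Type*} [Ring 𝒜] [Algebra ℂ 𝒜]

theorem commute_mul_entries {x : 𝒜} {X Y : Matrix (Fin 2) (Fin 2) 𝒜}
    (hX : ∀ i j, Commute x (X i j)) (hY : ∀ i j, Commute x (Y i j)) (i j : Fin 2) :
    Commute x ((X * Y) i j) := by
  rw [Matrix.mul_apply]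
  exact Commute.sum_right _ _ _ fun k _ => (hX i k).mul_right (hY k j)

theorem commute_prod_entries {x : 𝒜} {m : ℕ} (F : Fin m → Matrix (Fin 2) (Fin 2) 𝒜)
    (h : ∀ n i j, Commute x (F n i j)) (i j : Fin 2) : Commute x ((List.ofFn F).prod i j) := by
  induction m generalizing i j with
  | zero => fin_cases i <;> fin_cases j <;> simp
  | succ m ih =>
    rw [List.ofFn_succ, List.prod_cons]
    exact commute_mul_entries (h 0) (ih (fun n => F n.succ) fun n => h n.succ) i j

theorem Exchange.prod {a b c : ℂ} {m : ℕ} (F G : Fin m → Matrix (Fin 2) (Fin 2) 𝒜)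
    (h : ∀ n, Exchange a b c (F n) (G n))
    (hc : ∀ n n', n ≠ n' → ∀ i j k l, Commute (F n i j) (G n' k l)) :
    Exchange a b c (List.ofFn F).prod (List.ofFn G).prod := by
  induction m with
  | zero => simpa using Exchange.one a b c
  | succ m ih =>
    rw [List.ofFn_succ, List.ofFn_succ, List.prod_cons, List.prod_cons]
    refine (h 0).mul (ih _ _ (fun n => h n.succ) fun n n' hn => hc _ _ (by simpa using hn)) ?_ ?_
    · intro i j k l
      refine (commute_prod_entries _ (fun n i j => ?_) i j).symm
      exact (hc _ _ (Fin.succ_ne_zero n) _ _ _ _).symm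
    · intro i j k l
      refine commute_prod_entries _ (fun n k l => ?_) k l
      exact hc _ _ (Fin.succ_ne_zero n).symm _ _ _ _

theorem adj2_mul {X Y : Matrix (Fin 2) (Fin 2) 𝒜} (h : ∀ i j k l, Commute (X i j) (Y k l)) :
    adj2 (X * Y) = adj2 Y * adj2 X := by
  ext i j
  fin_cases i <;> fin_cases j <;>
    simp [adj2, Matrix.mul_apply, (h _ _ _ _).eq, add_comm]

/-- The adjugate of a product reverses its order because different sites commute. The innermost pair
thus belongs to a single site and is scalar, and the product collapses outwards.
`adj2_prod_mul_prod` collapses from the other end. -/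
theorem prod_mul_adj2_prod {m : ℕ} (F G : Fin m → Matrix (Fin 2) (Fin 2) 𝒜) (r : Fin m → ℂ)
    (h : ∀ n, F n * adj2 (G n) = r n • 1)
    (hc : ∀ n n', n ≠ n' → ∀ i j k l, Commute (G n i j) (G n' k l)) :
    (List.ofFn F).prod * adj2 (List.ofFn G).prod = (∏ n, r n) • 1 := by
  induction m with
  | zero =>
    ext i j
    fin_cases i <;> fin_cases j <;> simp [adj2]
  | succ m ih =>
    rw [List.ofFn_succ, List.ofFn_succ, List.prod_cons, List.prod_cons, adj2_mul, mul_assoc,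
      ← mul_assoc _ _ (adj2 (G 0)),
      ih _ _ (fun n => r n.succ) (fun n => h n.succ) fun n n' hn => hc _ _ (by simpa using hn)]
    · rw [smul_mul_assoc, one_mul, mul_smul_comm, h, smul_smul, Fin.prod_univ_succ, mul_comm]
    · intro i j k l
      exact commute_prod_entries _ (fun n k l => hc _ _ (Fin.succ_ne_zero n).symm _ _ _ _) k l

theorem adj2_prod_mul_prod {m : ℕ} (F G : Fin m → Matrix (Fin 2) (Fin 2) 𝒜) (r : Fin m → ℂ)
    (h : ∀ n, adj2 (G n) * F n = r n • 1)
    (hc : ∀ n n', n ≠ n' → ∀ i j k l, Commute (G n i j) (G n' k l)) :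
    adj2 (List.ofFn G).prod * (List.ofFn F).prod = (∏ n, r n) • 1 := by
  induction m with
  | zero =>
    ext i j
    fin_cases i <;> fin_cases j <;> simp [adj2]
  | succ m ih =>
    rw [List.ofFn_succ, List.ofFn_succ, List.prod_cons, List.prod_cons, adj2_mul, mul_assoc,
      ← mul_assoc (adj2 (G 0)), h, smul_mul_assoc, one_mul, mul_smul_comm,
      ih _ _ (fun n => r n.succ) (fun n => h n.succ) fun n n' hn => hc _ _ (by simpa using hn)]
    · rw [smul_smul, Fin.prod_univ_succ]
    · intro i j k l
      exact commute_prod_entries _ (fun n k l => hc _ _ (Fin.succ_ne_zero n).symm _ _ _ _) k l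

theorem Reflection.map {a b a' b' c : ℂ} {K L : Matrix (Fin 2) (Fin 2) ℂ}
    (h : Reflection a b a' b' c K L) :
    Reflection a b a' b' c (K.map fun z => z • (1 : 𝒜)) (L.map fun z => z • (1 : 𝒜)) := by
  have e₁ (K : Matrix (Fin 2) (Fin 2) ℂ) : fstAux (K.map fun z => z • (1 : 𝒜)) =
      (algebraMap ℂ 𝒜).mapMatrix (fstAux K) := by
    ext i j
    simp only [fstAux, Matrix.of_apply, RingHom.mapMatrix_apply, Matrix.map_apply]
    split_ifs <;> simp [Algebra.algebraMap_eq_smul_one]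
  have e₂ (K : Matrix (Fin 2) (Fin 2) ℂ) : sndAux (K.map fun z => z • (1 : 𝒜)) =
      (algebraMap ℂ 𝒜).mapMatrix (sndAux K) := by
    ext i j
    simp only [sndAux, Matrix.of_apply, RingHom.mapMatrix_apply, Matrix.map_apply]
    split_ifs <;> simp [Algebra.algebraMap_eq_smul_one]
  have e₃ (a b c : ℂ) : sixVertex 𝒜 a b c = (algebraMap ℂ 𝒜).mapMatrix (sixVertex ℂ a b c) := by
    ext i j
    simp only [sixVertex, Matrix.of_apply, RingHom.mapMatrix_apply, Matrix.map_apply]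
    split_ifs <;> simp [Algebra.algebraMap_eq_smul_one]
  unfold Reflection at *
  rw [e₁, e₂, e₃, e₃, ← map_mul, ← map_mul, ← map_mul, h]
  simp only [map_mul]

theorem commute_map_smul_one (K : Matrix (Fin 2) (Fin 2) ℂ) (i j : Fin 2) (x : 𝒜) :
    Commute (K.map (fun z => z • (1 : 𝒜)) i j) x := by
  rw [Matrix.map_apply]
  exact (Commute.one_left x).smul_left _

end Chains

/-! ### Reflection equation for the model and quantum determinants -/

namespace Params

variable {N : ℕ} {P : Params N} {p : ℕ} [NeZero p]

theorem mono_comm_free (n m : Fin N) (h : n ≠ m) (x y : ℂ) (i j k l : Fin 2) :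
    Commute (P.lax (p := p) n.rev x i j) (P.lax m.rev y k l) :=
  P.lax_comm (fun e => h (Fin.rev_injective e)) x y i j k l

theorem mono_exchange (hP : P.Admissible p) {x y : ℂ} (hx : x ≠ 0) (hy : y ≠ 0) :
    Exchange (x / y * P.q - y / (x * P.q)) (x / y - y / x) (P.q - 1 / P.q)
      (P.mono (p := p) x) (P.mono y) := by
  have hs := s_ne hP
  refine Exchange.prod _ _ (fun n => ?_) fun n n' h => mono_comm_free n n' h _ _
  have := lax_exchange hP n.rev (div_ne_zero hx hs) (div_ne_zero hy hs)
  convert this using 1 <;> field_simp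

-- The equation is homogeneous in both K's, and κ₋ e^{τ₋} and κ₋ e^{-τ₋} may be arbitrary
-- independent numbers, so the normalization and the exponentials are removed before the entrywise
-- check.
set_option maxHeartbeats 1000000 in
theorem K_reflection (hP : P.Admissible p) {x y : ℂ} (hx : x ≠ 0) (hy : y ≠ 0) :
    Reflection (x / y * P.q - y / (x * P.q)) (x / y - y / x) (x * y - 1 / (x * y))
      (x * y / P.q - P.q / (x * y)) (P.q - 1 / P.q) (P.K x) (P.K y) := by
  have hs := s_ne hP
  have hz := hP.zeta_ne
  unfold K
  refine Reflection.smul ?_ _ _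
  generalize P.kappa * Complex.exp P.tau = κ
  generalize P.kappa * Complex.exp (-P.tau) = κ'
  unfold Reflection
  ext ⟨i, k⟩ ⟨j, l⟩
  fin_cases i <;> fin_cases k <;> fin_cases j <;> fin_cases l <;>
    simp [sixVertex, fstAux, sndAux, Matrix.mul_apply, Fintype.sum_prod_type, q] <;> field_simp <;>
    ring

theorem U_eq (x : ℂ) : P.U (p := p) x = (-1 : ℂ) ^ N •
    (P.mono x * (P.K x).map (fun z => z • (1 : Op p N)) * adj2 (P.mono x⁻¹)) := by
  rw [U, monoHat, mul_smul_comm]; rfl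

/-- Dressing K₋ with M(x) and the adjugate of M(x⁻¹): by crossing, the exchange weights at ratios
such as x⁻¹/y become precisely the second pair of weights, which depends on x y. -/
theorem U_reflection (hP : P.Admissible p) {x y : ℂ} (hx : x ≠ 0) (hy : y ≠ 0) :
    Reflection (x / y * P.q - y / (x * P.q)) (x / y - y / x) (x * y - 1 / (x * y))
      (x * y / P.q - P.q / (x * y)) (P.q - 1 / P.q) (P.U (p := p) x) (P.U y) := by
  have hq := q_ne hP
  rw [U_eq, U_eq]
  have h₁ := mono_exchange hP (p := p) (inv_ne_zero hy) (inv_ne_zero hx)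
  have h₂ := (mono_exchange hP (p := p) (inv_ne_zero hx) hy).adj2_fst
  have h₃ := (mono_exchange hP (p := p) (inv_ne_zero hy) hx).adj2_snd
  have e₁ : y⁻¹ / x⁻¹ = x / y := by field_simp
  have e₂ : x⁻¹ / (y⁻¹ * P.q) = y / (x * P.q) := by field_simp
  have e₃ : x⁻¹ / y⁻¹ = y / x := by field_simp
  have e₄ : -(x⁻¹ / y - y / x⁻¹) = x * y - 1 / (x * y) := by field_simp; ring
  have e₅ : -(x⁻¹ / y * P.q - y / (x⁻¹ * P.q)) = x * y / P.q - P.q / (x * y) := by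
    field_simp; ring
  have e₆ : -(y⁻¹ / x - x / y⁻¹) = x * y - 1 / (x * y) := by field_simp; ring
  have e₇ : -(y⁻¹ / x * P.q - x / (y⁻¹ * P.q)) = x * y / P.q - P.q / (x * y) := by
    field_simp; ring
  rw [e₁, e₂, e₃] at h₁
  rw [e₄, e₅] at h₂
  rw [e₆, e₇] at h₃
  have h₄ := h₁.adj2_adj2
  have h₅ := (K_reflection hP hx hy).map (𝒜 := Op p N)
  have h₆ := mono_exchange hP (p := p) hx hy
  exact (Reflection.dress h₆ h₄ h₂ h₃ h₅ (commute_map_smul_one _) (commute_map_smul_one _)).smul _ _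

/-- The quantum determinant of the Lax operator of site `n`. -/
def laxDet (P : Params N) (n : Fin N) (t : ℂ) : ℂ :=
  -(P.al n * P.b n * P.d n / (P.be n * P.q * t ^ 2)) *
    ((t ^ 2 - P.mu 1 n ^ 2) * (t ^ 2 - P.mu (-1) n ^ 2))

/-- One-site quantum determinant. Normal ordering kills the off-diagonal entries and makes the
diagonal ones independent of v; the defining equations of μ_{n,±} are what factorize the result. -/
theorem lax_mul_adj2 (hP : P.Admissible p) (n : Fin N) {t : ℂ} (ht : t ≠ 0) :
    P.lax (p := p) n t * adj2 (P.lax n (t / P.q)) = P.laxDet n t • 1 := by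
  have hs := s_ne hP
  have ha := hP.al_ne n
  have hb := hP.be_ne n
  have hb' := hP.b_ne n
  have hd := hP.d_ne n
  have e : (1 : Op p N) = P.fv n fun _ => 1 := by simp [fv]
  have e' (X : Op p N) : -X = (-1 : ℂ) • X := by simp
  ext i j : 1
  fin_cases i <;> fin_cases j <;>
    simp only [Fin.zero_eta, Fin.mk_one, Fin.isValue, adj2, Matrix.mul_apply, Fin.sum_univ_two,
      lax_eq, Matrix.of_apply, Matrix.cons_val', Matrix.cons_val_zero, Matrix.cons_val_one,
      Matrix.cons_val_fin_one, Matrix.smul_apply, Matrix.one_apply_eq, Matrix.one_apply_ne,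
      ne_eq, zero_ne_one, one_ne_zero, not_false_eq_true, smul_zero, e',
      mul_assoc, fv_mul_u_mul hP, fv_mul_uInv_mul hP, u_mul_uInv_mul, uInv_mul_u_mul, fv_mul,
      ← mul_smul_comm, ← mul_add, smul_fv, fv_add, e]
  · refine fv_congr hP n fun x hx => ?_
    simp only [q, gam, del, laxDet, hP.mu_plus, hP.mu_minus]; field_simp; ring
  · refine (u_mul_congr n (fv_congr hP n (g := fun _ => 0) fun x hx => ?_)).trans ?_
    · simp only [q]; field_simp; ring
    · simp [fv]
  · refine (uInv_mul_congr n (fv_congr hP n (g := fun _ => 0) fun x hx => ?_)).trans ?_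
    · simp only [q, gam, del]; field_simp; ring
    · simp [fv]
  · refine fv_congr hP n fun x hx => ?_
    simp only [q, gam, del, laxDet, hP.mu_plus, hP.mu_minus]; field_simp; ring

end Params

section

variable {𝒜 : Type*} [Ring 𝒜] [Algebra ℂ 𝒜]

theorem map_mul_map_eq_smul_one {K L : Matrix (Fin 2) (Fin 2) ℂ} {r : ℂ} (h : K * L = r • 1) :
    K.map (fun z => z • (1 : 𝒜)) * L.map (fun z => z • (1 : 𝒜)) = r • 1 := by
  have e : (K * L).map (fun z => z • (1 : 𝒜)) =
      K.map (fun z => z • (1 : 𝒜)) * L.map (fun z => z • (1 : 𝒜)) := by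
    ext i j
    simp only [Matrix.map_apply, Matrix.mul_apply, Finset.sum_smul, smul_mul_smul_comm, one_mul]
  rw [← e, h]
  ext i j
  simp only [Matrix.map_apply, Matrix.smul_apply, Matrix.one_apply]
  split_ifs <;> simp

theorem sandwich_mul_sandwich {A B C D K L : Matrix (Fin 2) (Fin 2) 𝒜} {r₁ r₂ r₃ σ : ℂ}
    (hσ : σ * σ = 1) (h₁ : B * C = r₁ • 1) (h₂ : K * L = r₂ • 1) (h₃ : A * D = r₃ • 1) :
    σ • (A * K * B) * σ • (C * L * D) = (r₁ * r₂ * r₃) • 1 := by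
  have : A * K * B * (C * L * D) = A * (K * ((B * C) * L)) * D := by simp only [mul_assoc]
  rw [smul_mul_smul_comm, hσ, one_smul, this, h₁, smul_mul_assoc, one_mul, mul_smul_comm, h₂,
    mul_smul_comm, mul_smul_comm, smul_mul_assoc, smul_mul_assoc, mul_one, h₃, smul_smul,
    smul_smul]

end

namespace Params

variable {N : ℕ} {P : Params N} {p : ℕ} [NeZero p]

theorem adj2_mul_lax (hP : P.Admissible p) (n : Fin N) {t : ℂ} (ht : t ≠ 0) :
    adj2 (P.lax (p := p) n t) * P.lax n (P.q * t) = P.laxDet n (P.q * t) • 1 := by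
  have hs := s_ne hP
  have ha := hP.al_ne n
  have hb := hP.be_ne n
  have hb' := hP.b_ne n
  have hd := hP.d_ne n
  have e : (1 : Op p N) = P.fv n fun _ => 1 := by simp [fv]
  have e' (X : Op p N) : -X = (-1 : ℂ) • X := by simp
  ext i j : 1
  fin_cases i <;> fin_cases j <;>
    simp only [Fin.zero_eta, Fin.mk_one, Fin.isValue, adj2, Matrix.mul_apply, Fin.sum_univ_two,
      lax_eq, Matrix.of_apply, Matrix.cons_val', Matrix.cons_val_zero, Matrix.cons_val_one,
      Matrix.cons_val_fin_one, Matrix.smul_apply, Matrix.one_apply_eq, Matrix.one_apply_ne,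
      ne_eq, zero_ne_one, one_ne_zero, not_false_eq_true, smul_zero, e', smul_mul_assoc,
      mul_assoc, fv_mul_u_mul hP, fv_mul_uInv_mul hP, u_mul_uInv_mul, uInv_mul_u_mul, fv_mul,
      ← mul_smul_comm, ← mul_add, smul_fv, fv_add, e]
  · refine fv_congr hP n fun x hx => ?_
    simp only [q, gam, del, laxDet, hP.mu_plus, hP.mu_minus]; field_simp; ring
  · refine (u_mul_congr n (fv_congr hP n (g := fun _ => 0) fun x hx => ?_)).trans ?_
    · simp only [q, gam, del]; field_simp; ring
    · simp [fv]
  · refine (uInv_mul_congr n (fv_congr hP n (g := fun _ => 0) fun x hx => ?_)).trans ?_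
    · simp only [q]; field_simp; ring
    · simp [fv]
  · refine fv_congr hP n fun x hx => ?_
    simp only [q, gam, del, laxDet, hP.mu_plus, hP.mu_minus]; field_simp; ring

theorem mono_mul_adj2 (hP : P.Admissible p) {x : ℂ} (hx : x ≠ 0) :
    P.mono (p := p) x * adj2 (P.mono (x / P.q)) = (∏ n : Fin N, P.laxDet n.rev (x / P.s)) • 1 := by
  refine prod_mul_adj2_prod _ _ _ (fun n => ?_) fun n m h => mono_comm_free n m h _ _
  have := lax_mul_adj2 hP n.rev (div_ne_zero hx (s_ne hP))
  rwa [div_right_comm] at this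

theorem adj2_mul_mono (hP : P.Admissible p) {x : ℂ} (hx : x ≠ 0) :
    adj2 (P.mono (p := p) x⁻¹) * P.mono (P.q / x) =
      (∏ n : Fin N, P.laxDet n.rev (P.s / x)) • 1 := by
  have hs := s_ne hP
  refine adj2_prod_mul_prod _ _ _ (fun n => ?_) fun n m h => mono_comm_free n m h _ _
  have := adj2_mul_lax hP n.rev (t := x⁻¹ / P.s) (div_ne_zero (inv_ne_zero hx) hs)
  have e₁ : P.q * (x⁻¹ / P.s) = P.q / x / P.s := by field_simp
  have e₂ : P.q * (x⁻¹ / P.s) = P.s / x := by simp only [q]; field_simp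
  rwa [← e₁, ← e₂]

/-- The determinant of `K₋(x)`. -/
def detK (P : Params N) (x : ℂ) : ℂ :=
  ((P.zeta ^ 2 + 1 / P.zeta ^ 2 - (x ^ 2 / P.q + P.q / x ^ 2)) -
    P.kappa ^ 2 * (x ^ 2 / P.q - P.q / x ^ 2) ^ 2) / (P.zeta - 1 / P.zeta) ^ 2

theorem K_mul_K (hP : P.Admissible p) {x : ℂ} (hx : x ≠ 0) :
    P.K x * P.K (P.q / x) = P.detK x • 1 := by
  have hs := s_ne hP
  have hz := hP.zeta_ne
  have hz' : P.zeta ^ 2 - 1 ≠ 0 := sub_ne_zero.mpr hP.zeta_sq_ne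
  have e : Complex.exp P.tau ≠ 0 := Complex.exp_ne_zero _
  ext i j
  fin_cases i <;> fin_cases j <;>
    simp [K, detK, Matrix.mul_apply, q, Complex.exp_neg] <;> field_simp <;> ring

/-- The parameters α₋, β₋ factorize the determinant. Squaring their two defining equations, the
difference and the sum of the squares yield the difference and the product of α₋² + α₋⁻² and β₋² +
β₋⁻². -/
theorem detK_eq (hP : P.Admissible p) {x : ℂ} (hx : x ≠ 0) :
    P.detK x = P.kappa ^ 2 * (P.alm ^ 2 + 1 / P.alm ^ 2 - (x ^ 2 / P.q + P.q / x ^ 2)) *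
      (P.bem ^ 2 + 1 / P.bem ^ 2 + (x ^ 2 / P.q + P.q / x ^ 2)) / (P.zeta - 1 / P.zeta) ^ 2 := by
  have hq := q_ne hP
  have ha := hP.alm_ne
  have hb := hP.bem_ne
  have hk := hP.kappa_ne
  have hz := hP.zeta_ne
  have h₁ := hP.alm_bem₁
  have h₂ := hP.alm_bem₂
  rw [eq_div_iff hk] at h₁ h₂
  have e₁ : ((P.alm - 1 / P.alm) * (P.bem + 1 / P.bem) * P.kappa) ^ 2 =
    (P.zeta - 1 / P.zeta) ^ 2 := by rw [h₁]
  have e₂ : ((P.alm + 1 / P.alm) * (P.bem - 1 / P.bem) * P.kappa) ^ 2 =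
    (P.zeta + 1 / P.zeta) ^ 2 := by rw [h₂]
  have f₁ : P.kappa ^ 2 * ((P.alm ^ 2 + 1 / P.alm ^ 2) - (P.bem ^ 2 + 1 / P.bem ^ 2)) = -1 := by
    have i₁ : (P.zeta + 1 / P.zeta) ^ 2 - (P.zeta - 1 / P.zeta) ^ 2 = 4 := by field_simp; ring
    have i₂ : ((P.alm + 1 / P.alm) * (P.bem - 1 / P.bem) * P.kappa) ^ 2 -
        ((P.alm - 1 / P.alm) * (P.bem + 1 / P.bem) * P.kappa) ^ 2 =
        -4 * (P.kappa ^ 2 * ((P.alm ^ 2 + 1 / P.alm ^ 2) - (P.bem ^ 2 + 1 / P.bem ^ 2))) := by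
      field_simp; ring
    linear_combination (-1 / 4 : ℂ) * (i₂.symm.trans (by rw [e₁, e₂, i₁]) :
      -4 * (P.kappa ^ 2 * ((P.alm ^ 2 + 1 / P.alm ^ 2) - (P.bem ^ 2 + 1 / P.bem ^ 2))) = 4)
  have f₂ : P.kappa ^ 2 * ((P.alm ^ 2 + 1 / P.alm ^ 2) * (P.bem ^ 2 + 1 / P.bem ^ 2)) =
      P.zeta ^ 2 + 1 / P.zeta ^ 2 + 4 * P.kappa ^ 2 := by
    have i₁ : (P.zeta + 1 / P.zeta) ^ 2 + (P.zeta - 1 / P.zeta) ^ 2 =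
      2 * (P.zeta ^ 2 + 1 / P.zeta ^ 2) := by field_simp; ring
    have i₂ : ((P.alm + 1 / P.alm) * (P.bem - 1 / P.bem) * P.kappa) ^ 2 +
        ((P.alm - 1 / P.alm) * (P.bem + 1 / P.bem) * P.kappa) ^ 2 =
        2 * (P.kappa ^ 2 * ((P.alm ^ 2 + 1 / P.alm ^ 2) * (P.bem ^ 2 + 1 / P.bem ^ 2))) -
          8 * P.kappa ^ 2 := by
      field_simp; ring
    rw [e₁, e₂, i₁] at i₂
    linear_combination (-1 / 2 : ℂ) * i₂
  have i₃ : (x ^ 2 / P.q - P.q / x ^ 2) ^ 2 = (x ^ 2 / P.q + P.q / x ^ 2) ^ 2 - 4 := by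
    field_simp; ring
  rw [detK, i₃]
  congr 1
  linear_combination (x ^ 2 / P.q + P.q / x ^ 2) * f₁ * (-1) - f₂

/-- The scalar `𝒰₋(x) 𝒰₋(q/x)`. -/
def refDet (P : Params N) (x : ℂ) : ℂ :=
  (∏ n : Fin N, P.laxDet n.rev (P.s / x)) * P.detK x * ∏ n : Fin N, P.laxDet n.rev (x / P.s)

/-- The product collapses from the middle: first the adjugate of M(1/x) against M(q/x), then K₋(x)
K₋(q/x), then M(x) against the adjugate of M(x/q); each is scalar. -/
theorem U_mul_U (hP : P.Admissible p) {x : ℂ} (hx : x ≠ 0) :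
    P.U (p := p) x * P.U (P.q / x) = P.refDet x • 1 := by
  have hq := q_ne hP
  have h₂ := mono_mul_adj2 (p := p) hP hx
  rw [← inv_div] at h₂
  rw [U_eq, U_eq]
  exact sandwich_mul_sandwich (by rw [← mul_pow]; simp) (adj2_mul_mono hP hx)
    (map_mul_map_eq_smul_one (K_mul_K hP hx)) h₂

theorem refDet_ne_zero (hP : P.Admissible p) {x : ℂ} (hx : x ≠ 0)
    (h₁ : ∀ n ε, x ^ 2 ≠ P.q * P.mu ε n ^ 2) (h₂ : ∀ n ε, P.q ≠ x ^ 2 * P.mu ε n ^ 2)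
    (h₃ : x ^ 2 ≠ P.q * P.alm ^ 2) (h₄ : P.q ≠ x ^ 2 * P.alm ^ 2)
    (h₅ : x ^ 2 ≠ -P.q * P.bem ^ 2) (h₆ : P.q ≠ -x ^ 2 * P.bem ^ 2) : P.refDet x ≠ 0 := by
  have hs := s_ne hP
  have hq := q_ne hP
  have hz := hP.zeta_ne
  have hz' : P.zeta ^ 2 - 1 ≠ 0 := sub_ne_zero.mpr hP.zeta_sq_ne
  have ha := hP.alm_ne
  have hb := hP.bem_ne
  have hk := hP.kappa_ne
  have hq' : P.q = P.s ^ 2 := rfl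
  refine mul_ne_zero (mul_ne_zero ?_ ?_) ?_
  · refine Finset.prod_ne_zero_iff.mpr fun n _ => ?_
    have aux (ε : ℤˣ) : (P.s / x) ^ 2 - P.mu ε n.rev ^ 2 ≠ 0 := by
      rw [div_pow, ← hq', sub_ne_zero, ne_eq, div_eq_iff (pow_ne_zero 2 hx), mul_comm]
      exact h₂ _ _
    exact mul_ne_zero (neg_ne_zero.mpr (div_ne_zero (mul_ne_zero (mul_ne_zero (hP.al_ne _)
      (hP.b_ne _)) (hP.d_ne _)) (mul_ne_zero (mul_ne_zero (hP.be_ne _) hq)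
      (pow_ne_zero 2 (div_ne_zero hs hx))))) (mul_ne_zero (aux _) (aux _))
  · rw [detK_eq hP hx]
    refine div_ne_zero (mul_ne_zero (mul_ne_zero (pow_ne_zero 2 hk) ?_) ?_) (pow_ne_zero 2 ?_)
    · have : P.alm ^ 2 + 1 / P.alm ^ 2 - (x ^ 2 / P.q + P.q / x ^ 2) =
        (x ^ 2 - P.q * P.alm ^ 2) * (P.q - x ^ 2 * P.alm ^ 2) / (x ^ 2 * P.q * P.alm ^ 2) := by
        field_simp; ring
      rw [this]
      exact div_ne_zero (mul_ne_zero (sub_ne_zero.mpr h₃) (sub_ne_zero.mpr h₄)) (by positivity)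
    · have : P.bem ^ 2 + 1 / P.bem ^ 2 + (x ^ 2 / P.q + P.q / x ^ 2) =
        (x ^ 2 - -P.q * P.bem ^ 2) * (P.q - -x ^ 2 * P.bem ^ 2) / (x ^ 2 * P.q * P.bem ^ 2) := by
        field_simp; ring
      rw [this]
      exact div_ne_zero (mul_ne_zero (sub_ne_zero.mpr h₅) (sub_ne_zero.mpr h₆)) (by positivity)
    · have : P.zeta - 1 / P.zeta = (P.zeta ^ 2 - 1) / P.zeta := by field_simp
      rw [this]
      exact div_ne_zero hz' hz
  · refine Finset.prod_ne_zero_iff.mpr fun n _ => ?_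
    have aux (ε : ℤˣ) : (x / P.s) ^ 2 - P.mu ε n.rev ^ 2 ≠ 0 := by
      rw [div_pow, ← hq', sub_ne_zero, ne_eq, div_eq_iff hq, mul_comm]
      exact h₁ _ _
    exact mul_ne_zero (neg_ne_zero.mpr (div_ne_zero (mul_ne_zero (mul_ne_zero (hP.al_ne _)
      (hP.b_ne _)) (hP.d_ne _)) (mul_ne_zero (mul_ne_zero (hP.be_ne _) hq)
      (pow_ne_zero 2 (div_ne_zero hx hs))))) (mul_ne_zero (aux _) (aux _))

/-! ### Gauged operators on annihilated states -/

/-- The gauge parameter entering the rows `(-1, g/x)` and columns `(x g/q, 1)`. -/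
def gpar (P : Params N) (B : ℂ) : ℂ := B * P.s / (P.ga * P.q)

theorem gaugeB_eq (hP : P.Admissible p) {x B : ℂ} :
    P.gaugeB (p := p) x B =
      (P.ga * P.q / (B - 1 / B)) • gaugeContract P.q (P.gpar B) x (P.U x) := by
  have hq := q_ne hP
  have hs := s_ne hP
  have hg := hP.ga_ne
  have e : P.q = P.s ^ 2 := rfl
  have e₀ : P.ga * P.q / (B - 1 / B) = 1 / (B - 1 / B) * (P.ga * P.q) := by ring
  rw [gaugeB, gaugeContract, e₀]
  generalize 1 / (B - 1 / B) = c
  simp only [gpar, e]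
  match_scalars <;> field_simp

/-- A bra, repeated in all rows. -/
def rowOp (φ : State p N) : Op p N := Matrix.of fun _ => φ

/-- A ket, repeated in all columns. -/
def colOp (ψ : State p N) : Op p N := Matrix.of fun h _ => ψ h

theorem rowOp_mul (φ : State p N) (X : Op p N) : rowOp φ * X = rowOp (φ ᵥ* X) := rfl

theorem mul_colOp (ψ : State p N) (X : Op p N) : X * colOp ψ = colOp (X *ᵥ ψ) := rfl

theorem rowOp_injective : Function.Injective (rowOp (p := p) (N := N)) := fun _ _ h =>
  congrFun h (fun _ => 0)

theorem colOp_injective : Function.Injective (colOp (p := p) (N := N)) := fun _ _ h =>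
  funext fun x => congrFun (congrFun h x) (fun _ => 0)

theorem rowOp_add (φ φ' : State p N) : rowOp φ + rowOp φ' = rowOp (φ + φ') := rfl

theorem colOp_sub (ψ ψ' : State p N) : colOp ψ - colOp ψ' = colOp (ψ - ψ') := rfl

theorem smul_rowOp (r : ℂ) (φ : State p N) : r • rowOp φ = rowOp (r • φ) := rfl

theorem smul_colOp (r : ℂ) (φ : State p N) : r • colOp φ = colOp (r • φ) := rfl

/-- The operator by which a bra annihilated by `r U(y) c` is shifted. -/
def braShift (P : Params N) (g y : ℂ) : Op p N := P.U y 0 0 - (g / y) • P.U y 1 0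

/-- The operator by which a ket annihilated by `r U(y) c` is shifted. -/
def ketShift (P : Params N) (g y : ℂ) : Op p N := (y * g / P.q) • P.U y 1 0 + P.U y 1 1

/-- The annihilation condition solved for the entry (0, 1): this is the form in which
`Reflection.bra_shift` uses it. -/
theorem bra_U_one (hP : P.Admissible p) {y g : ℂ} (hy : y ≠ 0) {φ : State p N}
    (h : φ ᵥ* gaugeContract P.q g y (P.U y) = 0) :
    φ ᵥ* P.U y 0 1 = (g / y) • (φ ᵥ* P.U y 1 1) - (g * y / P.q) • (φ ᵥ* P.braShift g y) := by
  have hq := q_ne hP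
  simp only [gaugeContract, braShift, Matrix.vecMul_add, Matrix.vecMul_sub, Matrix.vecMul_smul]
    at h ⊢
  linear_combination (norm := skip) (-1 : ℂ) • h
  match_scalars <;> field_simp <;> ring

theorem ket_U_zero (hP : P.Admissible p) {y g : ℂ} (hy : y ≠ 0) {ψ : State p N}
    (h : gaugeContract P.q g y (P.U y) *ᵥ ψ = 0) :
    P.U y 0 1 *ᵥ ψ = (g / y) • (P.ketShift g y *ᵥ ψ) - (y * g / P.q) • (P.U y 0 0 *ᵥ ψ) := by
  have hq := q_ne hP
  simp only [gaugeContract, ketShift, Matrix.add_mulVec, Matrix.sub_mulVec, Matrix.smul_mulVec]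
    at h ⊢
  linear_combination (norm := skip) (-1 : ℂ) • h
  match_scalars <;> field_simp <;> ring

/-- Annihilation eliminates the (0, 1) entry, and the argument B q² cancels the q² in the
denominator of 𝒜₋. What remains is proportional to the shift operator, the only combination with a
clean exchange relation. -/
theorem bra_gaugeA (hP : P.Admissible p) {y B : ℂ} (hy : y ≠ 0) (hB : B ^ 2 ≠ 1) (hB0 : B ≠ 0)
    {φ : State p N} (h : φ ᵥ* gaugeContract P.q (P.gpar B) y (P.U y) = 0) :
    φ ᵥ* P.gaugeA y (B * P.q ^ 2) = (y / P.s) • (φ ᵥ* P.braShift (P.gpar B) y) := by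
  have hq := q_ne hP
  have hs := s_ne hP
  have hg := hP.ga_ne
  have e : P.q = P.s ^ 2 := rfl
  have hB' : B ^ 2 - 1 ≠ 0 := sub_ne_zero.mpr hB
  have h₁ := bra_U_one hP hy h
  simp only [gaugeA, braShift, Matrix.vecMul_add, Matrix.vecMul_sub, Matrix.vecMul_smul] at h₁ ⊢
  have h₀ : (1 / (B * P.q ^ 2 / P.q ^ 2 - P.q ^ 2 / (B * P.q ^ 2))) = B / (B ^ 2 - 1) := by
    field_simp
  rw [h₁, h₀]
  simp only [gpar, e]
  match_scalars <;> field_simp <;> ring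

theorem ket_gaugeD (hP : P.Admissible p) {y B : ℂ} (hy : y ≠ 0) (hB : B ^ 2 ≠ 1) (hB0 : B ≠ 0)
    {ψ : State p N} (h : gaugeContract P.q (P.gpar B) y (P.U y) *ᵥ ψ = 0) :
    P.gaugeD y B *ᵥ ψ = (P.s / y) • (P.ketShift (P.gpar B) y *ᵥ ψ) := by
  have hq := q_ne hP
  have hs := s_ne hP
  have hg := hP.ga_ne
  have e : P.q = P.s ^ 2 := rfl
  have hB' : B ^ 2 - 1 ≠ 0 := sub_ne_zero.mpr hB
  have h₁ := ket_U_zero hP hy h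
  simp only [gaugeD, ketShift, Matrix.add_mulVec, Matrix.sub_mulVec, Matrix.smul_mulVec] at h₁ ⊢
  have h₀ : (1 / (B - 1 / B)) = B / (B ^ 2 - 1) := by field_simp
  rw [h₁, h₀]
  simp only [gpar, e]
  match_scalars <;> field_simp <;> ring

theorem bra_exchange (hP : P.Admissible p) {x y g : ℂ} (hx : x ≠ 0) (hy : y ≠ 0)
    {φ : State p N} (h : φ ᵥ* gaugeContract P.q g y (P.U y) = 0) :
    ((x / y * P.q - y / (x * P.q)) * (x * y / P.q - P.q / (x * y))) •
        ((φ ᵥ* gaugeContract P.q g x (P.U x)) ᵥ* P.braShift (g / P.q ^ 2) y) =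
      ((x * y - 1 / (x * y)) * (x / y - y / x)) •
        ((φ ᵥ* P.braShift g y) ᵥ* gaugeContract P.q g x (P.U x)) := by
  have hq := q_ne hP
  have h₁ := bra_U_one hP hy h
  -- The bra is viewed as an operator with equal rows, so that the identity proved in an abstract
  -- ring applies to it.
  refine rowOp_injective ?_
  have := Reflection.bra_shift (g := g) hq hx hy (U_reflection (p := p) hP hx hy) (Φ := rowOp φ)
    (Φ' := rowOp (φ ᵥ* P.braShift g y)) ?_ ?_
  · have e : g / (P.q ^ 2 * y) = g / P.q ^ 2 / y := (div_div _ _ _).symm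
    rwa [e, rowOp_mul, rowOp_mul, rowOp_mul] at this
  · rw [rowOp_mul, rowOp_mul, smul_rowOp, rowOp_add, braShift, Matrix.vecMul_sub,
      Matrix.vecMul_smul, add_sub_cancel]
  · rw [rowOp_mul, rowOp_mul, h₁]; rfl

theorem ket_exchange (hP : P.Admissible p) {x y g : ℂ} (hx : x ≠ 0) (hy : y ≠ 0)
    {ψ : State p N} (h : gaugeContract P.q g y (P.U y) *ᵥ ψ = 0) :
    ((x / y * P.q - y / (x * P.q)) * (x * y / P.q - P.q / (x * y))) •
        (P.ketShift (g * P.q ^ 2) y *ᵥ (gaugeContract P.q g x (P.U x) *ᵥ ψ)) =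
      ((x * y - 1 / (x * y)) * (x / y - y / x)) •
        (gaugeContract P.q g x (P.U x) *ᵥ (P.ketShift g y *ᵥ ψ)) := by
  have hq := q_ne hP
  have h₁ := ket_U_zero hP hy h
  refine colOp_injective ?_
  have := Reflection.ket_shift (g := g) hq hx hy (U_reflection (p := p) hP hx hy) (Ψ := colOp ψ)
    (Ψ' := colOp (P.ketShift g y *ᵥ ψ)) ?_ ?_
  · have e : y * g * P.q = y * (g * P.q ^ 2) / P.q := by field_simp
    rwa [e, mul_colOp, mul_colOp, mul_colOp] at this
  · rw [mul_colOp, mul_colOp, h₁]; rfl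
  · rw [mul_colOp, mul_colOp, smul_colOp, colOp_sub, ketShift, Matrix.add_mulVec,
      Matrix.smul_mulVec, add_sub_cancel_left]

/-- If the shifted bra vanished, the row φ (1, -g/y) would be killed by U(y); multiplying by U(q/y)
on the right would give refDet(y) φ = 0. -/
theorem bra_shift_ne_zero (hP : P.Admissible p) {y g : ℂ} (hy : y ≠ 0) (hd : P.refDet y ≠ 0)
    {φ : State p N} (h : φ ᵥ* gaugeContract P.q g y (P.U y) = 0) (hφ : φ ≠ 0) :
    φ ᵥ* P.braShift g y ≠ 0 := by
  intro h₀
  have h₁ := bra_U_one hP hy h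
  have e₀ := congrFun (congrFun (U_mul_U (p := p) hP hy) 0) 0
  have e₁ := congrFun (congrFun (U_mul_U (p := p) hP hy) 1) 0
  simp only [Matrix.mul_apply, Fin.sum_univ_two, Matrix.smul_apply, Matrix.one_apply_eq,
    Matrix.one_apply_ne (one_ne_zero : (1 : Fin 2) ≠ 0)] at e₀ e₁
  have f₀ := congrArg (φ ᵥ* ·) e₀
  have f₁ := congrArg (φ ᵥ* ·) e₁
  simp only [Matrix.vecMul_add, ← Matrix.vecMul_vecMul, Matrix.vecMul_smul, Matrix.vecMul_one,
    smul_zero, Matrix.vecMul_zero, h₁, h₀, sub_zero, Matrix.smul_vecMul] at f₀ f₁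
  simp only [braShift, Matrix.vecMul_sub, Matrix.vecMul_smul, sub_eq_zero] at h₀
  rw [h₀, Matrix.smul_vecMul, ← smul_add, f₁, smul_zero] at f₀
  exact (smul_ne_zero hd hφ) f₀.symm

/-- Here U(y) would kill the column (y g/q, 1)ᵗ ψ and is multiplied by U(q/y) on the left, which is
why the determinant is taken at q/y. -/
theorem ket_shift_ne_zero (hP : P.Admissible p) {y g : ℂ} (hy : y ≠ 0) (hd : P.refDet (P.q / y) ≠ 0)
    {ψ : State p N} (h : gaugeContract P.q g y (P.U y) *ᵥ ψ = 0) (hψ : ψ ≠ 0) :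
    P.ketShift g y *ᵥ ψ ≠ 0 := by
  intro h₀
  have hq := q_ne hP
  have h₁ := ket_U_zero hP hy h
  have hU := U_mul_U (p := p) hP (div_ne_zero hq hy)
  rw [div_div_cancel₀ hq] at hU
  have e₀ := congrFun (congrFun hU 1) 0
  have e₁ := congrFun (congrFun hU 1) 1
  simp only [Matrix.mul_apply, Fin.sum_univ_two, Matrix.smul_apply, Matrix.one_apply_eq,
    Matrix.one_apply_ne (one_ne_zero : (1 : Fin 2) ≠ 0)] at e₀ e₁
  have f₀ := congrArg (· *ᵥ ψ) e₀
  have f₁ := congrArg (· *ᵥ ψ) e₁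
  have h₂ : P.U y 1 1 *ᵥ ψ = -((y * g / P.q) • P.U y 1 0 *ᵥ ψ) := by
    simp only [ketShift, Matrix.add_mulVec, Matrix.smul_mulVec] at h₀
    exact eq_neg_of_add_eq_zero_right h₀
  simp only [Matrix.add_mulVec, ← Matrix.mulVec_mulVec, Matrix.smul_mulVec, Matrix.one_mulVec,
    smul_zero, Matrix.zero_mulVec, h₁, h₂, h₀, zero_sub, Matrix.mulVec_neg,
    Matrix.mulVec_smul] at f₀ f₁
  have f₂ : (y * g / P.q) • (P.U (P.q / y) 1 0 *ᵥ P.U y 0 0 *ᵥ ψ +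
      P.U (P.q / y) 1 1 *ᵥ P.U y 1 0 *ᵥ ψ) = -(P.refDet (P.q / y) • ψ) := by
    rw [← f₁, smul_add]; abel
  rw [f₀, smul_zero, zero_eq_neg] at f₂
  exact (smul_ne_zero hd hψ) f₂

/-! ### Continuity in the spectral parameter, and the pseudo-eigenvalue as a function of its zeros
-/

theorem tendsto_lax (n : Fin N) {t : ℂ} (ht : t ≠ 0) :
    Tendsto (fun x => P.lax (p := p) n x) (𝓝 t) (𝓝 (P.lax n t)) := by
  have h₁ : ContinuousAt (fun x : ℂ => x) t := continuousAt_id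
  have h (c : ℂ) : ContinuousAt (fun x : ℂ => c / x) t := continuousAt_const.div h₁ ht
  refine tendsto_pi_nhds.mpr fun i => tendsto_pi_nhds.mpr fun j => ?_
  fin_cases i <;> fin_cases j
  · exact ((h₁.mul_const _).smul continuousAt_const).sub ((h _).smul continuousAt_const)
  · exact tendsto_const_nhds
  · exact tendsto_const_nhds
  · exact ((h _).smul continuousAt_const).sub ((continuousAt_const.mul h₁).smul continuousAt_const)

theorem tendsto_mono (hP : P.Admissible p) {t : ℂ} (ht : t ≠ 0) :
    Tendsto (fun x => P.mono (p := p) x) (𝓝 t) (𝓝 (P.mono t)) := by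
  have hs := s_ne hP
  simp only [mono, List.ofFn_eq_map]
  refine tendsto_list_prod _ fun n _ => ?_
  exact (tendsto_lax n.rev (div_ne_zero ht hs)).comp (tendsto_id.div_const P.s)

theorem tendsto_K_entry (hP : P.Admissible p) {t : ℂ} (ht : t ≠ 0) (i j : Fin 2) :
    Tendsto (fun x => P.K x i j) (𝓝 t) (𝓝 (P.K t i j)) := by
  have hs := s_ne hP
  have hz := hP.zeta_ne
  have hq := q_ne hP
  have : ContinuousAt (fun x => P.K x i j) t := by
    fin_cases i <;> fin_cases j <;> simp [K] <;> fun_prop (disch := simp [*])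
  exact this

theorem tendsto_U (hP : P.Admissible p) {t : ℂ} (ht : t ≠ 0) :
    Tendsto (fun x => P.U (p := p) x) (𝓝 t) (𝓝 (P.U t)) := by
  have hm := tendsto_mono hP (p := p) (inv_ne_zero ht)
  have hm' := hm.comp (tendsto_inv₀ ht)
  have he (i j : Fin 2) : Tendsto (fun x => P.mono (p := p) x⁻¹ i j) (𝓝 t) (𝓝 (P.mono t⁻¹ i j)) :=
    tendsto_pi_nhds.mp (tendsto_pi_nhds.mp hm' i) j
  unfold U
  refine ((tendsto_mono hP ht).mul ?_).mul ?_
  · refine tendsto_pi_nhds.mpr fun i => tendsto_pi_nhds.mpr fun j => ?_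
    exact (tendsto_K_entry hP ht i j).smul tendsto_const_nhds
  · unfold monoHat
    refine tendsto_pi_nhds.mpr fun i => tendsto_pi_nhds.mpr fun j => ?_
    simp only [Matrix.smul_apply]
    refine Tendsto.const_smul ?_ _
    fin_cases i <;> fin_cases j
    · exact he 1 1
    · exact (he 0 1).neg
    · exact (he 1 0).neg
    · exact he 0 0

theorem tendsto_gaugeB (hP : P.Admissible p) {t : ℂ} (ht : t ≠ 0) (B : ℂ) :
    Tendsto (fun x => P.gaugeB (p := p) x B) (𝓝 t) (𝓝 (P.gaugeB t B)) := by
  have h₁ : ContinuousAt (fun x : ℂ => x) t := continuousAt_id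
  have h (c : ℂ) : ContinuousAt (fun x : ℂ => c / x) t := continuousAt_const.div h₁ ht
  have he (i j : Fin 2) : Tendsto (fun x => P.U (p := p) x i j) (𝓝 t) (𝓝 (P.U t i j)) :=
    tendsto_pi_nhds.mp (tendsto_pi_nhds.mp (tendsto_U hP ht) i) j
  unfold gaugeB
  refine Tendsto.const_smul (((Tendsto.sub ?_ ?_).add ?_).add ?_) _
  · exact (((h₁.mul_const _).div_const _).neg).smul (he 0 0)
  · exact (he 0 1).const_smul _
  · exact (he 1 0).const_smul _
  · exact (h _).smul (he 1 1)

variable (P) in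
/-- The Laurent polynomial `bm (x²/q - q/x²) ∏ₙ (x/zₙ - zₙ/x) (x zₙ - 1/(x zₙ))`. -/
def zeroForm (bm : ℂ) (z : Fin N → ℂ) (x : ℂ) : ℂ :=
  bm * (x ^ 2 / P.q - P.q / x ^ 2) * ∏ n, ((x / z n - z n / x) * (x * z n - 1 / (x * z n)))

theorem pseudoEig_eq (bm : ℂ) (b : Fin N → ℂ) (h : Lab p N) (x : ℂ) :
    P.pseudoEig p bm b h x = P.zeroForm bm (fun n => b n * P.q ^ (h n : ℕ)) x := by
  unfold pseudoEig zeroForm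
  congr 1
  refine Finset.prod_congr rfl fun n _ => ?_
  ring

theorem tendsto_zeroForm {t : ℂ} (ht : t ≠ 0) (bm : ℂ) {z : Fin N → ℂ} (hz : ∀ n, z n ≠ 0) :
    Tendsto (P.zeroForm bm z) (𝓝 t) (𝓝 (P.zeroForm bm z t)) := by
  have h₁ : ContinuousAt (fun x : ℂ => x) t := continuousAt_id
  have h : ContinuousAt (P.zeroForm bm z) t := by
    unfold zeroForm
    refine (continuousAt_const.mul (((h₁.pow 2).div_const _).sub (continuousAt_const.div (h₁.pow 2)
      (pow_ne_zero 2 ht)))).mul (tendsto_finsetProd _ fun n _ => ?_)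
    exact ((h₁.div_const _).sub (continuousAt_const.div h₁ ht)).mul ((h₁.mul_const _).sub
      (continuousAt_const.div (h₁.mul_const _) (mul_ne_zero ht (hz n))))
  exact h

/-- Inverting z exchanges the two factors of each pair up to two cancelling signs. Hence a ladder
may be run on the reciprocal zeros. -/
theorem zeroForm_inv (bm : ℂ) (z : Fin N → ℂ) (x : ℂ) :
    P.zeroForm bm (fun n => (z n)⁻¹) x = P.zeroForm bm z x := by
  unfold zeroForm
  congr 1
  refine Finset.prod_congr rfl fun n _ => ?_
  simp only [one_div, mul_inv, inv_inv, div_eq_mul_inv]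
  ring

/-- At y = 1/z_n the two exchange coefficients are exactly the n-th factors of the pseudo-eigenvalue
for the zeros q z_n and z_n, so both sides contain the same product. -/
theorem zeroForm_update (hq : P.q ≠ 0) (bm : ℂ) {z : Fin N → ℂ} (n : Fin N) (hz : z n ≠ 0) {x y : ℂ}
    (hx : x ≠ 0) (hy : y = (z n)⁻¹) :
    ((x / y * P.q - y / (x * P.q)) * (x * y / P.q - P.q / (x * y))) * P.zeroForm bm z x =
      ((x * y - 1 / (x * y)) * (x / y - y / x)) *
        P.zeroForm bm (Function.update z n (z n * P.q)) x := by
  have e : ∀ z' : Fin N → ℂ, ∏ m, ((x / z' m - z' m / x) * (x * z' m - 1 / (x * z' m))) =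
      ((x / z' n - z' n / x) * (x * z' n - 1 / (x * z' n))) *
        ∏ m ∈ Finset.univ.erase n, ((x / z' m - z' m / x) * (x * z' m - 1 / (x * z' m))) :=
    fun z' => (Finset.mul_prod_erase _ _ (Finset.mem_univ n)).symm
  have e' : ∏ m ∈ Finset.univ.erase n, ((x / Function.update z n (z n * P.q) m -
      Function.update z n (z n * P.q) m / x) * (x * Function.update z n (z n * P.q) m -
        1 / (x * Function.update z n (z n * P.q) m))) =
      ∏ m ∈ Finset.univ.erase n, ((x / z m - z m / x) * (x * z m - 1 / (x * z m))) :=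
    Finset.prod_congr rfl fun m hm => by rw [Function.update_of_ne (Finset.ne_of_mem_erase hm)]
  unfold zeroForm
  rw [e, e (Function.update z n (z n * P.q)), e', Function.update_self, hy]
  field_simp

theorem zeroForm_zero (bm : ℂ) (z : Fin N → ℂ) (n : Fin N) (hz : z n ≠ 0) :
    P.zeroForm bm z (z n)⁻¹ = 0 := by
  unfold zeroForm
  rw [Finset.prod_eq_zero (Finset.mem_univ n), mul_zero]
  rw [inv_mul_cancel₀ hz]
  simp

/-! ### Families of pseudo-eigenstates and the ladder step -/

/-- The points of a nondegenerate gauge orbit `β_{j+1} = β_j / q²`. -/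
structure GaugeOrbit (P : Params N) (β : ℤ → ℂ) : Prop where
  step : ∀ j, β (j + 1) = β j / P.q ^ 2
  ne_zero : ∀ j, β j ≠ 0
  sq_ne_one : ∀ j, β j ^ 2 ≠ 1

/-- Nonzero bras `φ_j` with `φ_j ℬ₋(x|β_j) = E(x) φ_{j+1}`. -/
structure BraChain (P : Params N) (β bm : ℤ → ℂ) (z : Fin N → ℂ) (φ : ℤ → State p N) : Prop where
  ne_zero : ∀ j, φ j ≠ 0
  eig : ∀ j x, x ≠ 0 → φ j ᵥ* P.gaugeB x (β j) = P.zeroForm (bm j) z x • φ (j + 1)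

/-- Nonzero kets `ψ_j` with `ℬ₋(x|β_j) ψ_j = E(x) ψ_{j-1}`. -/
structure KetChain (P : Params N) (β bm : ℤ → ℂ) (z : Fin N → ℂ) (ψ : ℤ → State p N) : Prop where
  ne_zero : ∀ j, ψ j ≠ 0
  eig : ∀ j x, x ≠ 0 → P.gaugeB x (β j) *ᵥ ψ j = P.zeroForm (bm j) z x • ψ (j - 1)

theorem GaugeOrbit.factor_ne_zero (hP : P.Admissible p) {β : ℤ → ℂ} (hβ : P.GaugeOrbit β) (j : ℤ) :
    P.ga * P.q / (β j - 1 / β j) ≠ 0 := by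
  have h := hβ.ne_zero j
  have : β j - 1 / β j = (β j ^ 2 - 1) / β j := by field_simp
  rw [this]
  exact div_ne_zero (mul_ne_zero hP.ga_ne (q_ne hP))
    (div_ne_zero (sub_ne_zero.mpr (hβ.sq_ne_one j)) h)

theorem eventually_generic {t y : ℂ} (hy : y ≠ 0) : ∀ᶠ x in 𝓝[≠] t,
    x ≠ 0 ∧ (x * y - 1 / (x * y)) * (x / y - y / x) ≠ 0 := by
  have h (c : ℂ) : ∀ᶠ x in 𝓝[≠] t, x ≠ c := by
    by_cases hc : t = c
    · subst hc; exact eventually_mem_nhdsWithin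
    · exact eventually_ne_nhdsWithin hc
  filter_upwards [h 0, h y, h (-y), h y⁻¹, h (-y⁻¹)] with x h₀ h₁ h₂ h₃ h₄
  refine ⟨h₀, ?_⟩
  have e : (x * y - 1 / (x * y)) * (x / y - y / x) =
      (x - y⁻¹) * (x - -y⁻¹) * ((x - y) * (x - -y)) / x ^ 2 := by
    field_simp; ring
  rw [e]
  refine div_ne_zero (mul_ne_zero (mul_ne_zero ?_ ?_) (mul_ne_zero ?_ ?_)) (pow_ne_zero 2 h₀) <;>
    rwa [sub_ne_zero]

theorem eq_of_eventually_eq {E : Type*} [TopologicalSpace E] [T2Space E] {f g : ℂ → E} {t : ℂ}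
    (hf : Tendsto f (𝓝 t) (𝓝 (f t))) (hg : Tendsto g (𝓝 t) (𝓝 (g t)))
    (h : ∀ᶠ x in 𝓝[≠] t, f x = g x) : f t = g t :=
  tendsto_nhds_unique_of_eventuallyEq (hf.mono_left nhdsWithin_le_nhds)
    (hg.mono_left nhdsWithin_le_nhds) h

/-- The ladder step. At y = 1/z_n every φ_j is annihilated by ℬ₋(y|β_j), so 𝒜₋ acts as the shift,
and comparing the exchange relation with `zeroForm_update` moves the zero z_n to q z_n. The
prefactor is untouched. -/
theorem BraChain.shift (hP : P.Admissible p) {β bm : ℤ → ℂ} (hβ : P.GaugeOrbit β)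
    {z : Fin N → ℂ} {φ : ℤ → State p N} (h : P.BraChain β bm z φ) (hz : ∀ n, z n ≠ 0) (n : Fin N)
    {c : ℂ} (hc : c ≠ 0) (hd : P.refDet (z n)⁻¹ ≠ 0) :
    P.BraChain β bm (Function.update z n (z n * P.q))
      fun j => φ j ᵥ* (c • P.gaugeA (z n)⁻¹ (β j * P.q ^ 2)) := by
  have hq := q_ne hP
  have hs := s_ne hP
  have hy : (z n)⁻¹ ≠ 0 := inv_ne_zero (hz n)
  have hz' (m : Fin N) : Function.update z n (z n * P.q) m ≠ 0 := by
    by_cases hm : m = n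
    · subst hm; simp [hz, hq]
    · simp [hm, hz]
  have hB (j : ℤ) (x : ℂ) (hx : x ≠ 0) :
      (P.ga * P.q / (β j - 1 / β j)) • (φ j ᵥ* gaugeContract P.q (P.gpar (β j)) x (P.U x)) =
        P.zeroForm (bm j) z x • φ (j + 1) := by
    rw [← h.eig j x hx, gaugeB_eq hP, Matrix.vecMul_smul]
  have h₀ (j : ℤ) : φ j ᵥ* gaugeContract P.q (P.gpar (β j)) (z n)⁻¹ (P.U (z n)⁻¹) = 0 := by
    have := hB j _ hy
    rw [zeroForm_zero _ _ _ (hz n), zero_smul] at this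
    exact (smul_eq_zero.mp this).resolve_left (hβ.factor_ne_zero hP j)
  have hA (j : ℤ) : φ j ᵥ* (c • P.gaugeA (z n)⁻¹ (β j * P.q ^ 2)) =
      (c * ((z n)⁻¹ / P.s)) • (φ j ᵥ* P.braShift (P.gpar (β j)) (z n)⁻¹) := by
    rw [Matrix.vecMul_smul, bra_gaugeA hP hy (hβ.sq_ne_one j) (hβ.ne_zero j) (h₀ j), smul_smul]
  simp only [hA]
  refine ⟨fun j => smul_ne_zero (mul_ne_zero hc (div_ne_zero hy hs))
    (bra_shift_ne_zero hP hy hd (h₀ j) (h.ne_zero j)), fun j t ht => ?_⟩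
  rw [Matrix.smul_vecMul, smul_comm]
  congr 1
  refine eq_of_eventually_eq
    (f := fun x => (φ j ᵥ* P.braShift (P.gpar (β j)) (z n)⁻¹) ᵥ* P.gaugeB x (β j))
    (g := fun x => P.zeroForm (bm j) (Function.update z n (z n * P.q)) x •
      (φ (j + 1) ᵥ* P.braShift (P.gpar (β (j + 1))) (z n)⁻¹)) ?_ ?_ ?_
  · exact ((continuous_const.matrix_vecMul continuous_id).tendsto _).comp (tendsto_gaugeB hP ht _)
  · exact (tendsto_zeroForm ht _ hz').smul tendsto_const_nhds
  -- The exchange coefficient has to be cancelled, which is possible except at finitely many x;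
  -- continuity covers those.
  · filter_upwards [eventually_generic hy] with x ⟨hx, hne⟩
    have hk (χ : State p N) : (P.ga * P.q / (β j - 1 / β j)) •
        (χ ᵥ* gaugeContract P.q (P.gpar (β j)) x (P.U x)) = χ ᵥ* P.gaugeB x (β j) := by
      rw [gaugeB_eq hP, Matrix.vecMul_smul]
    have hex := bra_exchange hP hx hy (h₀ j)
    -- The factor q⁻² acquired by g in the exchange relation is the step from β_j to β_{j+1}, so the
    -- shift on the other side is the one built from φ_{j+1}.
    have hg : P.gpar (β j) / P.q ^ 2 = P.gpar (β (j + 1)) := by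
      rw [gpar, gpar, hβ.step]; ring
    have hex' := congrArg ((P.ga * P.q / (β j - 1 / β j)) • ·) hex
    rw [smul_comm, ← Matrix.smul_vecMul, hB j x hx, hg, smul_comm _ ((x * (z n)⁻¹ - _) * _),
      hk, Matrix.smul_vecMul, smul_smul,
      zeroForm_update hq _ n (hz n) hx rfl, mul_smul] at hex'
    exact (smul_right_injective _ hne hex').symm

/-- The same step for kets: g is now multiplied by q², which is the step from β_j to β_{j-1},
matching the lowering of j by ℬ₋. -/
theorem KetChain.shift (hP : P.Admissible p) {β bm : ℤ → ℂ} (hβ : P.GaugeOrbit β)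
    {z : Fin N → ℂ} {ψ : ℤ → State p N} (h : P.KetChain β bm z ψ) (hz : ∀ n, z n ≠ 0) (n : Fin N)
    {c : ℂ} (hc : c ≠ 0) (hd : P.refDet (P.q / (z n)⁻¹) ≠ 0) :
    P.KetChain β bm (Function.update z n (z n * P.q))
      fun j => (c • P.gaugeD (z n)⁻¹ (β j)) *ᵥ ψ j := by
  have hq := q_ne hP
  have hs := s_ne hP
  have hy : (z n)⁻¹ ≠ 0 := inv_ne_zero (hz n)
  have hz' (m : Fin N) : Function.update z n (z n * P.q) m ≠ 0 := by
    by_cases hm : m = n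
    · subst hm; simp [hz, hq]
    · simp [hm, hz]
  have hB (j : ℤ) (x : ℂ) (hx : x ≠ 0) :
      (P.ga * P.q / (β j - 1 / β j)) • (gaugeContract P.q (P.gpar (β j)) x (P.U x) *ᵥ ψ j) =
        P.zeroForm (bm j) z x • ψ (j - 1) := by
    rw [← h.eig j x hx, gaugeB_eq hP, Matrix.smul_mulVec]
  have h₀ (j : ℤ) : gaugeContract P.q (P.gpar (β j)) (z n)⁻¹ (P.U (z n)⁻¹) *ᵥ ψ j = 0 := by
    have := hB j _ hy
    rw [zeroForm_zero _ _ _ (hz n), zero_smul] at this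
    exact (smul_eq_zero.mp this).resolve_left (hβ.factor_ne_zero hP j)
  have hA (j : ℤ) : (c • P.gaugeD (z n)⁻¹ (β j)) *ᵥ ψ j =
      (c * (P.s / (z n)⁻¹)) • (P.ketShift (P.gpar (β j)) (z n)⁻¹ *ᵥ ψ j) := by
    rw [Matrix.smul_mulVec, ket_gaugeD hP hy (hβ.sq_ne_one j) (hβ.ne_zero j) (h₀ j), smul_smul]
  simp only [hA]
  refine ⟨fun j => smul_ne_zero (mul_ne_zero hc (div_ne_zero hs hy))
    (ket_shift_ne_zero hP hy hd (h₀ j) (h.ne_zero j)), fun j t ht => ?_⟩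
  rw [Matrix.mulVec_smul, smul_comm]
  congr 1
  refine eq_of_eventually_eq
    (f := fun x => P.gaugeB x (β j) *ᵥ (P.ketShift (P.gpar (β j)) (z n)⁻¹ *ᵥ ψ j))
    (g := fun x => P.zeroForm (bm j) (Function.update z n (z n * P.q)) x •
      (P.ketShift (P.gpar (β (j - 1))) (z n)⁻¹ *ᵥ ψ (j - 1))) ?_ ?_ ?_
  · exact ((continuous_id.matrix_mulVec continuous_const).tendsto _).comp (tendsto_gaugeB hP ht _)
  · exact (tendsto_zeroForm ht _ hz').smul tendsto_const_nhds
  · filter_upwards [eventually_generic hy] with x ⟨hx, hne⟩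
    have hk (χ : State p N) : (P.ga * P.q / (β j - 1 / β j)) •
        (gaugeContract P.q (P.gpar (β j)) x (P.U x) *ᵥ χ) = P.gaugeB x (β j) *ᵥ χ := by
      rw [gaugeB_eq hP, Matrix.smul_mulVec]
    have hex := ket_exchange hP hx hy (h₀ j)
    have hg : P.gpar (β j) * P.q ^ 2 = P.gpar (β (j - 1)) := by
      have := hβ.step (j - 1)
      rw [sub_add_cancel] at this
      rw [gpar, gpar, this]; field_simp
    have hex' := congrArg ((P.ga * P.q / (β j - 1 / β j)) • ·) hex
    rw [smul_comm, ← Matrix.mulVec_smul, hB j x hx, hg, smul_comm _ ((x * (z n)⁻¹ - _) * _),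
      hk, Matrix.mulVec_smul, smul_smul,
      zeroForm_update hq _ n (hz n) hx rfl, mul_smul] at hex'
    exact (smul_right_injective _ hne hex').symm

end Params
-- Linear independence and iterated ladders
/-- Vectors `v j h` on which operators `T x j` act diagonally, up to shifting `j`, are linearly
independent as soon as the eigenvalue functions separate the labels. -/
theorem linearIndependent_of_pseudoEigen {ι V : Type*} [DecidableEq ι] [AddCommGroup V] [Module ℂ V]
    (v : ℤ → ι → V) (T : ℂ → ℤ → V →ₗ[ℂ] V) (σ : ℤ → ℤ) (E : ℤ → ι → ℂ → ℂ)
    (hv : ∀ j h, v j h ≠ 0)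
    (hT : ∀ j h x, x ≠ 0 → T x j (v j h) = E j h x • v (σ j) h)
    (hE : ∀ j h h', h ≠ h' → ∃ x, x ≠ 0 ∧ E j h x = 0 ∧ E j h' x ≠ 0) (j : ℤ) :
    LinearIndependent ℂ (v j) := by
  rw [linearIndependent_iff']
  intro s
  induction s using Finset.induction generalizing j with
  | empty => simp
  | insert a s ha ih =>
    intro c hc
    have h₁ : ∀ i ∈ s, c i = 0 := by
      intro i hi
      -- The operator at a zero of the eigenvalue of a, but not of i, deletes a from the relation
      -- and sends the remaining vectors to index σ j. This is why the induction runs over all j at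
      -- once.
      obtain ⟨x, hx, h₀, h₁⟩ := hE j a i (fun e => ha (e ▸ hi))
      have := congrArg (T x j) hc
      rw [map_sum, map_zero, Finset.sum_insert ha, map_smul, hT _ _ _ hx, h₀, zero_smul, smul_zero,
        zero_add] at this
      have hz := ih (σ j) (fun i => c i * E j i x) (by
        rw [← this]
        refine Finset.sum_congr rfl fun k _ => ?_
        rw [map_smul, hT _ _ _ hx, smul_smul]) i hi
      exact (mul_eq_zero.mp hz).resolve_right h₁
    rw [Finset.sum_insert ha, Finset.sum_eq_zero fun i hi => by rw [h₁ i hi, zero_smul],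
      add_zero] at hc
    have h₂ := (smul_eq_zero.mp hc).resolve_right (hv j a)
    intro i hi
    rcases Finset.mem_insert.mp hi with rfl | hi
    · exact h₂
    · exact h₁ i hi

namespace Params

variable {N : ℕ} {P : Params N} {p : ℕ} [NeZero p]

/-- After i steps the zero of site n is z_n q^i, so the next operator must be taken at q^{-i}/z_n:
these are the arguments in the definition of the states. -/
theorem BraChain.site (hP : P.Admissible p) {β bm : ℤ → ℂ} (hβ : P.GaugeOrbit β)
    {z : Fin N → ℂ} {φ : ℤ → State p N} (h : P.BraChain β bm z φ) (hz : ∀ n, z n ≠ 0) (n : Fin N)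
    (κ : ℕ → ℂ) (m : ℕ) (hκ : ∀ i < m, κ i ≠ 0)
    (hd : ∀ i < m, P.refDet ((P.q ^ i)⁻¹ / z n) ≠ 0) :
    P.BraChain β bm (Function.update z n (z n * P.q ^ m)) fun j =>
      φ j ᵥ* ((List.range m).map fun i =>
        κ i • P.gaugeA ((P.q ^ i)⁻¹ / z n) (β j * P.q ^ 2)).prod := by
  have hq := q_ne hP
  induction m with
  | zero => simpa using h
  | succ m ih =>
    have h' := ih (fun i hi => hκ i (by omega)) (fun i hi => hd i (by omega))
    have hz' (k : Fin N) : Function.update z n (z n * P.q ^ m) k ≠ 0 := by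
      by_cases hk : k = n
      · subst hk; simp [hz, hq]
      · simp [hk, hz]
    have e : (Function.update z n (z n * P.q ^ m) n)⁻¹ = (P.q ^ m)⁻¹ / z n := by
      rw [Function.update_self, mul_inv, mul_comm, div_eq_mul_inv]
    have := h'.shift hP hβ hz' n (hκ m (by omega)) (by rw [e]; exact hd m (by omega))
    rw [e] at this
    simpa [List.range_succ, mul_assoc, pow_succ] using this

theorem KetChain.site (hP : P.Admissible p) {β bm : ℤ → ℂ} (hβ : P.GaugeOrbit β)
    {z : Fin N → ℂ} {ψ : ℤ → State p N} (h : P.KetChain β bm z ψ) (hz : ∀ n, z n ≠ 0) (n : Fin N)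
    (κ : ℕ → ℂ) (m : ℕ) (hκ : ∀ i < m, κ i ≠ 0)
    (hd : ∀ i < m, P.refDet (P.q / ((P.q ^ i)⁻¹ / z n)) ≠ 0) :
    P.KetChain β bm (Function.update z n (z n * P.q ^ m)) fun j =>
      ((List.range m).reverse.map fun i =>
        κ i • P.gaugeD ((P.q ^ i)⁻¹ / z n) (β j)).prod *ᵥ ψ j := by
  have hq := q_ne hP
  induction m with
  | zero => simpa using h
  | succ m ih =>
    have h' := ih (fun i hi => hκ i (by omega)) (fun i hi => hd i (by omega))
    have hz' (k : Fin N) : Function.update z n (z n * P.q ^ m) k ≠ 0 := by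
      by_cases hk : k = n
      · subst hk; simp [hz, hq]
      · simp [hk, hz]
    have e : (Function.update z n (z n * P.q ^ m) n)⁻¹ = (P.q ^ m)⁻¹ / z n := by
      rw [Function.update_self, mul_inv, mul_comm, div_eq_mul_inv]
    have := h'.shift hP hβ hz' n (hκ m (by omega)) (by rw [e]; exact hd m (by omega))
    rw [e] at this
    simpa [List.range_succ, mul_assoc, pow_succ] using this

/-- On bras the head of the list acts first, so the induction has to allow an arbitrary starting
family; only the zeros of sites still to be treated are required to have their initial values. -/
theorem BraChain.list (hP : P.Admissible p) {β bm : ℤ → ℂ} (hβ : P.GaugeOrbit β) {c : Fin N → ℂ}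
    (hc : ∀ n, c n ≠ 0) (κ : Fin N → ℕ → ℂ) (m : Fin N → ℕ) (hκ : ∀ n, ∀ i < m n, κ n i ≠ 0)
    (hd : ∀ n, ∀ i < m n, P.refDet ((P.q ^ i)⁻¹ / c n) ≠ 0) (l : List (Fin N)) (hl : l.Nodup)
    {z : Fin N → ℂ} {φ : ℤ → State p N} (h : P.BraChain β bm z φ) (hz : ∀ n, z n ≠ 0)
    (hzc : ∀ n ∈ l, z n = c n) :
    P.BraChain β bm (fun n => if n ∈ l then c n * P.q ^ m n else z n) fun j =>
      φ j ᵥ* (l.map fun n => ((List.range (m n)).map fun i =>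
        κ n i • P.gaugeA ((P.q ^ i)⁻¹ / c n) (β j * P.q ^ 2)).prod).prod := by
  have hq := q_ne hP
  induction l generalizing z φ with
  | nil => simpa using h
  | cons a l ih =>
    rw [List.nodup_cons] at hl
    have ha := hzc a List.mem_cons_self
    have h₁ := h.site hP hβ hz a (κ a) (m a) (hκ a) (by rw [ha]; exact hd a)
    rw [ha] at h₁
    have h₂ := ih hl.2 h₁ (fun k => by
      by_cases hk : k = a
      · subst hk; simp [hc, hq]
      · simp [hk, hz]) (fun n hn => by
      rw [Function.update_of_ne (fun e : n = a => hl.1 (e ▸ hn))]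
      exact hzc n (List.mem_cons_of_mem _ hn))
    convert h₂ using 1
    · funext n
      by_cases hn : n = a
      · subst hn; simp [hl.1]
      · simp [hn]
    · funext j
      rw [List.map_cons, List.prod_cons, ← Matrix.vecMul_vecMul]

/-- On kets the head acts last: the tail is applied to the fixed initial family, and the head site
is added afterwards. -/
theorem KetChain.list (hP : P.Admissible p) {β bm : ℤ → ℂ} (hβ : P.GaugeOrbit β) {c : Fin N → ℂ}
    (hc : ∀ n, c n ≠ 0) (κ : Fin N → ℕ → ℂ) (m : Fin N → ℕ) (hκ : ∀ n, ∀ i < m n, κ n i ≠ 0)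
    (hd : ∀ n, ∀ i < m n, P.refDet (P.q / ((P.q ^ i)⁻¹ / c n)) ≠ 0) (l : List (Fin N))
    (hl : l.Nodup) {ψ : ℤ → State p N} (h : P.KetChain β bm c ψ) :
    P.KetChain β bm (fun n => if n ∈ l then c n * P.q ^ m n else c n) fun j =>
      (l.map fun n => ((List.range (m n)).reverse.map fun i =>
        κ n i • P.gaugeD ((P.q ^ i)⁻¹ / c n) (β j)).prod).prod *ᵥ ψ j := by
  have hq := q_ne hP
  induction l with
  | nil => simpa using h
  | cons a l ih =>
    rw [List.nodup_cons] at hl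
    have h₁ := (ih hl.2).site hP hβ (fun k => by
      split_ifs
      · exact mul_ne_zero (hc k) (pow_ne_zero _ hq)
      · exact hc k) a (κ a) (m a) (hκ a) (by simpa [hl.1] using hd a)
    rw [if_neg hl.1] at h₁
    convert h₁ using 1
    · funext n
      by_cases hn : n = a
      · subst hn; simp
      · simp [hn]
    · funext j
      rw [List.map_cons, List.prod_cons, ← Matrix.mulVec_mulVec]

theorem BraChain.smul {β bm : ℤ → ℂ} {z : Fin N → ℂ} {φ : ℤ → State p N}
    (h : P.BraChain β bm z φ) {r : ℂ} (hr : r ≠ 0) : P.BraChain β bm z fun j => r • φ j :=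
  ⟨fun j => smul_ne_zero hr (h.ne_zero j), fun j x hx => by
    rw [Matrix.smul_vecMul, h.eig j x hx, smul_comm]⟩

theorem KetChain.smul {β bm : ℤ → ℂ} {z : Fin N → ℂ} {ψ : ℤ → State p N}
    (h : P.KetChain β bm z ψ) {r : ℂ} (hr : r ≠ 0) : P.KetChain β bm z fun j => r • ψ j :=
  ⟨fun j => smul_ne_zero hr (h.ne_zero j), fun j x hx => by
    rw [Matrix.mulVec_smul, h.eig j x hx, smul_comm]⟩

theorem KetChain.inv {β bm : ℤ → ℂ} {z : Fin N → ℂ} {ψ : ℤ → State p N}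
    (h : P.KetChain β bm z ψ) : P.KetChain β bm (fun n => (z n)⁻¹) ψ :=
  ⟨h.ne_zero, fun j x hx => by rw [h.eig j x hx, zeroForm_inv]⟩

theorem leftState_chain (hP : P.Admissible p) {β bm : ℤ → ℂ} (hβ : P.GaugeOrbit β) {b : Fin N → ℂ}
    (hb : ∀ n, b n ≠ 0) (hsf : ∀ n, ∀ i : ℕ, i + 1 < p → P.sfA ((P.q ^ i)⁻¹ / b n) ≠ 0)
    (hd : ∀ n, ∀ i : ℕ, i + 1 < p → P.refDet ((P.q ^ i)⁻¹ / b n) ≠ 0) {Ω : ℤ → State p N}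
    (h : P.BraChain β bm b Ω) {nrm : ℂ} (hn : nrm ≠ 0) (l : Lab p N) :
    P.BraChain β bm (fun n => b n * P.q ^ (l n : ℕ)) fun j =>
      P.leftState nrm (Ω j) b (β j) l := by
  have hlt (n : Fin N) (i : ℕ) (hi : i < l n) : i + 1 < p := by have := (l n).2; omega
  have := (BraChain.list hP hβ hb (fun n i => (P.sfA ((P.q ^ i)⁻¹ / b n))⁻¹) (fun n => (l n : ℕ))
    (fun n i hi => inv_ne_zero (hsf n i (hlt n i hi))) (fun n i hi => hd n i (hlt n i hi))
    (List.finRange N) (List.nodup_finRange N) h hb fun _ _ => rfl).smul (inv_ne_zero hn)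
  simpa [leftState, List.ofFn_eq_map] using this

theorem rightState_chain (hP : P.Admissible p) {β bm : ℤ → ℂ} (hβ : P.GaugeOrbit β)
    {b : Fin N → ℂ} (hb : ∀ n, b n ≠ 0)
    (hsf : ∀ n, ∀ i : ℕ, i + 1 < p → P.sfD ((P.q ^ i)⁻¹ / b n) ≠ 0)
    (hd : ∀ n, ∀ i : ℕ, i + 1 < p → P.refDet (P.q / ((P.q ^ i)⁻¹ / b n)) ≠ 0) {Ω : ℤ → State p N}
    (h : P.KetChain β bm b Ω) {nrm : ℂ} (hn : nrm ≠ 0) (l : Lab p N) :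
    P.KetChain β bm (fun n => b n * P.q ^ (l n : ℕ)) fun j =>
      P.rightState nrm (Ω j) b (β j) l := by
  have hlt (n : Fin N) (i : ℕ) (hi : i < l n) : i + 1 < p := by have := (l n).2; omega
  have := (KetChain.list hP hβ hb (fun n i => (P.sfD ((P.q ^ i)⁻¹ / b n))⁻¹) (fun n => (l n : ℕ))
    (fun n i hi => inv_ne_zero (hsf n i (hlt n i hi))) (fun n i hi => hd n i (hlt n i hi))
    (List.finRange N) (List.nodup_finRange N) h).smul (inv_ne_zero hn)
  simpa [rightState, List.ofFn_eq_map] using this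

/-- The zeros b/q are replaced by their reciprocals q/b, the ladder is climbed p - 1 times to q^p/b
= 1/b, and reciprocals are taken again. The operators met on the way sit at b/q, b/q², …, as in the
definition of the state. -/
theorem rightOmega_chain (hP : P.Admissible p) {β bm : ℤ → ℂ} (hβ : P.GaugeOrbit β)
    {b : Fin N → ℂ} (hb : ∀ n, b n ≠ 0)
    (hd : ∀ n, ∀ i : ℕ, i + 1 < p → P.refDet (P.q ^ (i + 2) / b n) ≠ 0) {Ω : ℤ → State p N}
    (h : P.KetChain β bm (fun n => b n / P.q) Ω) :
    P.KetChain β bm b fun j => P.rightOmega (Ω j) b (β j) := by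
  have hq := q_ne hP
  have e (n : Fin N) (i : ℕ) : (P.q ^ i)⁻¹ / (b n / P.q)⁻¹ = b n / P.q ^ (i + 1) := by
    have := hb n
    field_simp
    ring
  have e' (n : Fin N) (i : ℕ) : P.q / (b n / P.q ^ (i + 1)) = P.q ^ (i + 2) / b n := by
    have := hb n
    field_simp
    ring
  have := (KetChain.list hP hβ (c := fun n => (b n / P.q)⁻¹)
    (fun n => inv_ne_zero (div_ne_zero (hb n) hq)) (fun n i => 1) (fun n => p - 1)
    (fun n i hi => one_ne_zero) (fun n i hi => by rw [e, e']; exact hd n i (by omega))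
    (List.finRange N) (List.nodup_finRange N) h.inv).inv
  simp only [List.mem_finRange, if_true, e, one_smul] at this
  convert this using 1
  · funext n
    have hp : P.q ^ (p - 1) * P.q = 1 := by
      rw [← pow_succ, Nat.sub_add_cancel (NeZero.one_le), hP.q_prim.pow_eq_one]
    have := hb n
    have e₁ : ((b n / P.q)⁻¹ * P.q ^ (p - 1))⁻¹ = b n / (P.q ^ (p - 1) * P.q) := by field_simp
    rw [e₁, hp, div_one]
  · funext j
    rw [rightOmega, List.ofFn_eq_map]

end Params
-- Tensor product reference states and their local properties
-- For odd p the exponents 2i + 1 run through all residues modulo p, so this is the product of xζ +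
-- y over all p-th roots of unity ζ.
theorem prod_odd_powers {p : ℕ} [NeZero p] (hp : Odd p) {q : ℂ} (hq : IsPrimitiveRoot q p)
    (x y : ℂ) : ∏ i ∈ Finset.range p, (x * q ^ (2 * i + 1) + y) = x ^ p + y ^ p := by
  rw [add_comm (x ^ p), hq.pow_add_pow_eq_prod_add_mul y x hp]
  have hcop : Nat.Coprime p 2 := hp.coprime_two_right
  have hinj : Set.InjOn (fun i => q ^ (2 * i + 1)) (Finset.range p : Set ℕ) := by
    intro i hi j hj h
    simp only [Finset.coe_range, Set.mem_Iio] at hi hj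
    have h₁ : q ^ (2 * i + 1) = q ^ (2 * j + 1) := h
    rw [hq.isOfFinOrder (NeZero.ne p) |>.pow_eq_pow_iff_modEq] at h₁
    rw [← hq.eq_orderOf] at h₁
    have h₂ := Nat.ModEq.cancel_left_of_coprime (c := 2) hcop (Nat.ModEq.add_right_cancel' 1 h₁)
    exact Nat.ModEq.eq_of_lt_of_lt h₂ hi hj
  have hmem : Set.MapsTo (fun i => q ^ (2 * i + 1)) (Finset.range p)
      (Polynomial.nthRootsFinset p (1 : ℂ)) := by
    intro i _
    rw [Finset.mem_coe, Polynomial.mem_nthRootsFinset (NeZero.pos p), ← pow_mul, mul_comm, pow_mul,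
      hq.pow_eq_one, one_pow]
  refine Finset.prod_nbij (fun i => q ^ (2 * i + 1)) (fun i hi => hmem hi) hinj ?_ fun i _ => ?_
  · exact Finset.surjOn_of_injOn_of_card_le _ hmem hinj (by simp [hq.card_nthRootsFinset])
  · ring

namespace Params

variable {N : ℕ} {P : Params N} {p : ℕ} [NeZero p]

/-- Up to nonzero factors these numbers are the factors of aₙ^p + bₙ^p; the denominators are treated
likewise through cₙ^p + dₙ^p. -/
theorem num_ne_zero (hp : Odd p) (hP : P.Admissible p) (n : Fin N) (i : Fin p) :
    P.a n * (P.s * P.q ^ (i : ℕ)) + P.b n * (P.s * P.q ^ (i : ℕ))⁻¹ ≠ 0 := by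
  have hs := s_ne hP
  have hq := q_ne hP
  have h := hP.ab_ne n
  rw [← prod_odd_powers hp hP.q_prim, Finset.prod_ne_zero_iff] at h
  have h₁ := h i (Finset.mem_range.mpr i.2)
  have e : P.a n * (P.s * P.q ^ (i : ℕ)) + P.b n * (P.s * P.q ^ (i : ℕ))⁻¹ =
      (P.a n * P.q ^ (2 * (i : ℕ) + 1) + P.b n) / (P.s * P.q ^ (i : ℕ)) := by
    field_simp
    rw [show P.s ^ 2 = P.q from rfl]; ring
  rw [e]
  exact div_ne_zero h₁ (mul_ne_zero hs (pow_ne_zero _ hq))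

theorem den_ne_zero (hp : Odd p) (hP : P.Admissible p) (n : Fin N) (i : Fin p) :
    P.c n * (P.s * P.q ^ (i : ℕ)) + P.d n * (P.s * P.q ^ (i : ℕ))⁻¹ ≠ 0 := by
  have hs := s_ne hP
  have hq := q_ne hP
  have h := hP.cd_ne n
  rw [← prod_odd_powers hp hP.q_prim, Finset.prod_ne_zero_iff] at h
  have h₁ := h i (Finset.mem_range.mpr i.2)
  have e : P.c n * (P.s * P.q ^ (i : ℕ)) + P.d n * (P.s * P.q ^ (i : ℕ))⁻¹ =
      (P.c n * P.q ^ (2 * (i : ℕ) + 1) + P.d n) / (P.s * P.q ^ (i : ℕ)) := by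
    field_simp
    rw [show P.s ^ 2 = P.q from rfl]; ring
  rw [e]
  exact div_ne_zero h₁ (mul_ne_zero hs (pow_ne_zero _ hq))

theorem rho_ne_zero (hP : P.Admissible p) (n : Fin N) : P.rho n ≠ 0 := by
  intro h
  have := hP.rho_pow n
  rw [h, zero_pow (NeZero.ne p)] at this
  exact div_ne_zero (hP.cd_ne n) (hP.ab_ne n) this.symm

theorem ratio_succ (hP : P.Admissible p) (n : Fin N) (i : ℕ) : P.ratio n (i + 1) =
    (P.a n * (P.s * P.q ^ i) + P.b n * (P.s * P.q ^ i)⁻¹) /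
      (P.c n * (P.s * P.q ^ i) + P.d n * (P.s * P.q ^ i)⁻¹) := by
  have hs := s_ne hP
  have e₁ : P.s ^ (2 * ((i + 1 : ℕ) : ℤ) - 1) = P.s * P.q ^ i := by
    rw [q, ← pow_mul, ← pow_succ', ← zpow_natCast]
    congr 1; push_cast; ring
  have e₂ : P.s ^ (1 - 2 * ((i + 1 : ℕ) : ℤ)) = (P.s * P.q ^ i)⁻¹ := by
    rw [← e₁, ← _root_.zpow_neg]
    congr 1; ring
  rw [ratio, e₁, e₂]

theorem ratio_eq (hP : P.Admissible p) (n : Fin N) (i : ℕ) : P.ratio n (i + 1) =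
    (P.a n * P.q ^ (2 * i + 1) + P.b n) / (P.c n * P.q ^ (2 * i + 1) + P.d n) := by
  have hs := s_ne hP
  have hq := q_ne hP
  have hu : P.s * P.q ^ i ≠ 0 := mul_ne_zero hs (pow_ne_zero _ hq)
  have e : P.q ^ (2 * i + 1) = (P.s * P.q ^ i) ^ 2 := by rw [mul_pow, show P.s ^ 2 = P.q from rfl]; ring
  rw [ratio_succ hP, e]
  generalize P.s * P.q ^ i = u at *
  rw [← mul_div_mul_right _ _ hu]
  congr 1 <;> field_simp

/-- This is what the p-th root ρ is for: it makes the coordinates of the local state periodic modulo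
p. -/
theorem prod_ratio (hp : Odd p) (hP : P.Admissible p) (n : Fin N) :
    ∏ r ∈ Finset.Icc 1 p, P.ratio n r * P.rho n = 1 := by
  have e (m : ℕ) : ∏ r ∈ Finset.Icc 1 m, P.ratio n r * P.rho n =
      ∏ i ∈ Finset.range m, P.ratio n (i + 1) * P.rho n := by
    induction m with
    | zero => simp
    | succ m ih => rw [Finset.prod_Icc_succ_top (by omega), Finset.prod_range_succ, ih]
  rw [e]
  simp only [ratio_eq hP]
  rw [Finset.prod_mul_distrib, Finset.prod_div_distrib, prod_odd_powers hp hP.q_prim,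
    prod_odd_powers hp hP.q_prim, Finset.prod_const, Finset.card_range, hP.rho_pow]
  have := hP.ab_ne n
  have := hP.cd_ne n
  field_simp

variable (P) in
/-- The ratio of consecutive coordinates of the local left reference states. -/
def localStep (ε : ℤˣ) (k : ℤ) (n : Fin N) (x : ℂ) : ℂ :=
  P.q ^ (k + 1) * if ε = 1 then
    (P.a n * (P.s * x) + P.b n * (P.s * x)⁻¹) / (P.c n * (P.s * x) + P.d n * (P.s * x)⁻¹) * P.rho n
  else 1

theorem leftLocal_succ (hP : P.Admissible p) (ε : ℤˣ) (k : ℤ) (n : Fin N) (i : ℕ) :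
    P.leftLocal ε k n (i + 1) = P.leftLocal ε k n i * P.localStep ε k n (P.q ^ i) := by
  have hq := q_ne hP
  have e : P.q ^ (((i + 1 : ℕ) : ℤ) * (k + 1)) = P.q ^ ((i : ℤ) * (k + 1)) * P.q ^ (k + 1) := by
    rw [← zpow_add₀ hq]; congr 1; push_cast; ring
  unfold leftLocal localStep
  rw [e]
  split_ifs
  · rw [Finset.prod_Icc_succ_top (by omega), ratio_succ hP]; ring
  · ring

theorem leftLocal_period (hp : Odd p) (hP : P.Admissible p) (ε : ℤˣ) (k : ℤ) (n : Fin N) :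
    P.leftLocal ε k n p = 1 := by
  unfold leftLocal
  rw [_root_.zpow_mul, zpow_natCast, hP.q_prim.pow_eq_one, _root_.one_zpow, one_mul, prod_ratio hp hP]
  simp

/-- The recursion also holds across the wrap-around from p - 1 to 0, by periodicity; hence the
cyclic shift u acts on the state like a function of v. -/
theorem leftLocal_add_one (hp : Odd p) (hP : P.Admissible p) (ε : ℤˣ) (k : ℤ) (n : Fin N)
    (i : Fin p) : P.leftLocal ε k n ((i + 1 : Fin p) : ℕ) =
      P.leftLocal ε k n i * P.localStep ε k n (P.q ^ (i : ℕ)) := by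
  rw [← leftLocal_succ hP]
  by_cases h : (i : ℕ) + 1 < p
  · congr 1
    rw [Fin.val_add, Fin.val_one', Nat.add_mod_mod, Nat.mod_eq_of_lt h]
  · have h' : (i : ℕ) + 1 = p := by have := i.2; omega
    have e : ((i + 1 : Fin p) : ℕ) = 0 := by
      rw [Fin.val_add, Fin.val_one', Nat.add_mod_mod, h', Nat.mod_self]
    rw [e, h', leftLocal_period hp hP]
    simp [leftLocal]

theorem localStep_ne_zero (hp : Odd p) (hP : P.Admissible p) (ε : ℤˣ) (k : ℤ) (n : Fin N)
    (i : Fin p) : P.localStep ε k n (P.q ^ (i : ℕ)) ≠ 0 := by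
  have hq := q_ne hP
  unfold localStep
  refine mul_ne_zero (zpow_ne_zero _ hq) ?_
  split_ifs
  · exact mul_ne_zero (div_ne_zero (num_ne_zero hp hP n i) (den_ne_zero hp hP n i))
      (rho_ne_zero hP n)
  · exact one_ne_zero

theorem leftLocal_ne_zero (hp : Odd p) (hP : P.Admissible p) (ε : ℤˣ) (k : ℤ) (n : Fin N)
    (i : Fin p) : P.leftLocal ε k n i ≠ 0 := by
  obtain ⟨i, hi⟩ := i
  induction i with
  | zero => simp [leftLocal]
  | succ i ih =>
    simp only at ih ⊢
    rw [leftLocal_succ hP]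
    exact mul_ne_zero (ih (by omega)) (localStep_ne_zero hp hP ε k n ⟨i, by omega⟩)

theorem leftRef_ne_zero (hp : Odd p) (hP : P.Admissible p) (ε : Fin N → ℤˣ) (k : Fin N → ℤ)
    (h : Lab p N) : P.leftRef p ε k h ≠ 0 :=
  Finset.prod_ne_zero_iff.mpr fun n _ => leftLocal_ne_zero hp hP _ _ n (h n)

theorem leftRef_raise (hp : Odd p) (hP : P.Admissible p) (ε : Fin N → ℤˣ) (k : Fin N → ℤ)
    (n : Fin N) (h : Lab p N) : P.leftRef p ε k (raise p n h) =
      P.leftRef p ε k h * P.localStep (ε n) (k n) n (P.q ^ (h n : ℕ)) := by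
  unfold leftRef
  rw [← Finset.mul_prod_erase _ _ (Finset.mem_univ n), ← Finset.mul_prod_erase Finset.univ
    (fun m => P.leftLocal (ε m) (k m) m (h m)) (Finset.mem_univ n)]
  rw [Finset.prod_congr rfl fun m hm => by rw [raise_apply_of_ne p (Finset.ne_of_mem_erase hm)]]
  have : raise p n h n = h n + 1 := by simp [raise]
  rw [this, leftLocal_add_one hp hP]
  ring

theorem leftRef_update (hP : P.Admissible p) (ε : Fin N → ℤˣ) (k : Fin N → ℤ)
    (n : Fin N) (h : Lab p N) : P.leftRef p ε (Function.update k n (k n + 1)) h =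
      P.leftRef p ε k h * P.q ^ (h n : ℕ) := by
  have hq := q_ne hP
  unfold leftRef
  rw [← Finset.mul_prod_erase _ _ (Finset.mem_univ n), ← Finset.mul_prod_erase Finset.univ
    (fun m => P.leftLocal (ε m) (k m) m (h m)) (Finset.mem_univ n)]
  rw [Finset.prod_congr rfl fun m hm => by rw [Function.update_of_ne (Finset.ne_of_mem_erase hm)],
    Function.update_self]
  have e : P.q ^ (((h n : ℕ) : ℤ) * (k n + 1 + 1)) =
      P.q ^ (((h n : ℕ) : ℤ) * (k n + 1)) * P.q ^ (h n : ℕ) := by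
    rw [← zpow_natCast, ← zpow_add₀ hq]; congr 1; ring
  unfold leftLocal
  rw [e]
  ring

/-- Right coordinates are inverses of left ones, with k offset by one because the two local
definitions use the exponents k + 1 and -k. Properties of the kets thus follow from those of the
bras. -/
theorem rightRef_eq (ε : Fin N → ℤˣ) (k : Fin N → ℤ) (h : Lab p N) :
    P.rightRef p ε (fun n => k n + 1) h = (P.leftRef p ε k h)⁻¹ := by
  unfold rightRef leftRef
  rw [← Finset.prod_inv_distrib]
  refine Finset.prod_congr rfl fun n _ => ?_
  unfold rightLocal leftLocal
  rw [mul_inv, _root_.zpow_neg]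
  congr 1
  split_ifs
  · rw [← Finset.prod_inv_distrib]
    exact Finset.prod_congr rfl fun r _ => by rw [mul_inv]
  · simp

theorem vecMul_fv (n : Fin N) (f : ℂ → ℂ) (φ : State p N) (h : Lab p N) :
    (φ ᵥ* P.fv n f) h = φ h * f (P.q ^ (h n : ℕ)) := by
  rw [fv, Matrix.vecMul_diagonal]

theorem fv_mulVec (n : Fin N) (f : ℂ → ℂ) (ψ : State p N) (h : Lab p N) :
    (P.fv n f *ᵥ ψ) h = f (P.q ^ (h n : ℕ)) * ψ h := by
  rw [fv, Matrix.mulVec_diagonal]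

theorem vecMul_u (n : Fin N) (φ : State p N) (h : Lab p N) :
    (φ ᵥ* (u n : Op p N)) h = φ ((raise p n).symm h) := by
  simp [Matrix.vecMul, dotProduct, u_apply, ← Equiv.symm_apply_eq]

theorem vecMul_uInv (n : Fin N) (φ : State p N) (h : Lab p N) :
    (φ ᵥ* (uInv n : Op p N)) h = φ (raise p n h) := by
  simp [Matrix.vecMul, dotProduct, uInv, u_apply]

theorem u_mulVec (n : Fin N) (ψ : State p N) (h : Lab p N) :
    ((u n : Op p N) *ᵥ ψ) h = ψ (raise p n h) := by
  simp [Matrix.mulVec, dotProduct, u_apply]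

theorem uInv_mulVec (n : Fin N) (ψ : State p N) (h : Lab p N) :
    ((uInv n : Op p N) *ᵥ ψ) h = ψ ((raise p n).symm h) := by
  simp [Matrix.mulVec, dotProduct, uInv, u_apply, ← Equiv.symm_apply_eq]

theorem pow_val_raise (hP : P.Admissible p) (n : Fin N) (h : Lab p N) :
    P.q ^ (raise p n h n : ℕ) = P.q ^ (h n : ℕ) * P.q := by
  rw [← pow_val_add_one hP.q_prim.pow_eq_one]
  simp [raise]

theorem pow_val_raise_symm (hP : P.Admissible p) (n : Fin N) (h : Lab p N) :
    P.q ^ ((raise p n).symm h n : ℕ) = P.q ^ (h n : ℕ) / P.q := by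
  rw [eq_div_iff (q_ne hP), ← pow_val_raise hP, Equiv.apply_symm_apply]

theorem leftRef_eq_raise_symm (hp : Odd p) (hP : P.Admissible p) (ε : Fin N → ℤˣ) (k : Fin N → ℤ)
    (n : Fin N) (h : Lab p N) : P.leftRef p ε k ((raise p n).symm h) =
      P.leftRef p ε k h * (P.localStep (ε n) (k n) n (P.q ^ (h n : ℕ) / P.q))⁻¹ := by
  have h₁ := leftRef_raise hp hP ε k n ((raise p n).symm h)
  rw [Equiv.apply_symm_apply] at h₁
  rw [h₁, mul_assoc, ← pow_val_raise_symm hP, mul_inv_cancel₀ (localStep_ne_zero hp hP _ _ _ _),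
    mul_one]

/-- Multiplication by the ratio of consecutive coordinates exchanges the two off-diagonal Lax
coefficients at `ε = 1`, and keeps them at `ε = -1`. -/
theorem localStep_mul (hp : Odd p) (hP : P.Admissible p) (ε : ℤˣ) (k : ℤ) (n : Fin N) (i : Fin p) :
    P.localStep ε k n (P.q ^ (i : ℕ)) *
      (P.s * P.c n * P.q ^ (i : ℕ) + P.d n / P.s * (P.q ^ (i : ℕ))⁻¹) =
    P.q ^ (k + 1) * if ε = 1 then
      P.rho n * (P.s * P.a n * P.q ^ (i : ℕ) + P.b n / P.s * (P.q ^ (i : ℕ))⁻¹) else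
      (P.s * P.c n * P.q ^ (i : ℕ) + P.d n / P.s * (P.q ^ (i : ℕ))⁻¹) := by
  have hd := den_ne_zero hp hP n i
  have e : P.s * P.c n * P.q ^ (i : ℕ) + P.d n / P.s * (P.q ^ (i : ℕ))⁻¹ =
    P.c n * (P.s * P.q ^ (i : ℕ)) + P.d n * (P.s * P.q ^ (i : ℕ))⁻¹ := by
    rw [mul_inv]; ring
  have e' : P.s * P.a n * P.q ^ (i : ℕ) + P.b n / P.s * (P.q ^ (i : ℕ))⁻¹ =
    P.a n * (P.s * P.q ^ (i : ℕ)) + P.b n * (P.s * P.q ^ (i : ℕ))⁻¹ := by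
    rw [mul_inv]; ring
  rw [localStep, e, e']
  split_ifs
  · rw [mul_assoc]; congr 1
    rw [mul_right_comm, div_mul_cancel₀ _ hd, mul_comm]
  · ring

theorem inv_localStep_mul (hp : Odd p) (hP : P.Admissible p) (ε : ℤˣ) (k : ℤ) (n : Fin N)
    (i : Fin p) : (P.localStep ε k n (P.q ^ (i : ℕ)))⁻¹ *
      (P.s * P.a n * P.q ^ (i : ℕ) + P.b n / P.s * (P.q ^ (i : ℕ))⁻¹) =
    (P.q ^ (k + 1))⁻¹ * if ε = 1 then
      (P.rho n)⁻¹ * (P.s * P.c n * P.q ^ (i : ℕ) + P.d n / P.s * (P.q ^ (i : ℕ))⁻¹) else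
      (P.s * P.a n * P.q ^ (i : ℕ) + P.b n / P.s * (P.q ^ (i : ℕ))⁻¹) := by
  have hk : P.q ^ (k + 1) ≠ 0 := zpow_ne_zero _ (q_ne hP)
  have hr := rho_ne_zero hP n
  have h := localStep_mul hp hP ε k n i
  have h₀ := localStep_ne_zero hp hP ε k n i
  rw [inv_mul_eq_iff_eq_mul₀ h₀, mul_left_comm]
  split_ifs with hε
  · rw [if_pos hε] at h
    rw [mul_left_comm _ (P.rho n)⁻¹, h]
    field_simp
  · rw [if_neg hε] at h
    have h1 : P.localStep ε k n (P.q ^ (i : ℕ)) = P.q ^ (k + 1) := by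
      rw [localStep, if_neg hε, mul_one]
    rw [h1]; field_simp

variable (P) in
/-- The scalar produced by a Lax operator acting on a local reference state. -/
def laxScalar (μ : ℂ) (n : Fin N) (t : ℂ) : ℂ := P.al n * (t - μ ^ 2 / t)

theorem z_ne_zero (hP : P.Admissible p) (ε : ℤˣ) (k : ℤ) (n : Fin N) : P.z ε k n ≠ 0 := by
  have h₁ : P.q ^ k ≠ 0 := zpow_ne_zero _ (q_ne hP)
  have h₂ := s_ne hP
  have h₃ := rho_ne_zero hP n
  have h₄ := hP.a_ne n
  have h₅ := hP.c_ne n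
  have h₆ := hP.al_ne n
  unfold z
  split_ifs <;> simp [*]

theorem w_ne_zero (hP : P.Admissible p) (ε : ℤˣ) (k : ℤ) (n : Fin N) : P.w ε k n ≠ 0 := by
  have h₁ : P.q ^ k ≠ 0 := zpow_ne_zero _ (q_ne hP)
  have h₂ := s_ne hP
  have h₃ := rho_ne_zero hP n
  have h₄ := hP.b_ne n
  have h₅ := hP.d_ne n
  have h₆ := hP.be_ne n
  unfold w
  split_ifs <;> simp [*]

theorem z_add (hP : P.Admissible p) (ε : ℤˣ) (k m : ℤ) (n : Fin N) :
    P.z ε (k + m) n = P.q ^ m * P.z ε k n := by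
  rw [z, z, zpow_add₀ (q_ne hP)]; ring

theorem w_add (hP : P.Admissible p) (ε : ℤˣ) (k m : ℤ) (n : Fin N) :
    P.w ε (k + m) n = P.w ε k n / P.q ^ m := by
  rw [w, w, neg_add, zpow_add₀ (q_ne hP), _root_.zpow_neg _ m]; ring

theorem units_eq_neg_one {ε : ℤˣ} (h : ε ≠ 1) : ε = -1 := (Int.units_eq_one_or ε).resolve_left h

variable (P) in
theorem mu_sq_mul (hP : P.Admissible p) (ε : ℤˣ) (n : Fin N) :
    P.al n * P.mu ε n ^ 2 = -P.q * P.be n *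
      if ε = 1 then P.a n / P.b n else P.c n / P.d n := by
  have h₁ := hP.al_ne n
  have h₂ := hP.b_ne n
  have h₃ := hP.d_ne n
  split_ifs with h
  · subst h; rw [hP.mu_plus]; field_simp
  · rw [units_eq_neg_one h, hP.mu_minus]; field_simp

/-- Local intertwining. On the reference bra u and u⁻¹ become functions of v, which the ratio of
coordinates matches to the diagonal Lax entries; w is chosen so that one power of v cancels. The
other power, q^h, raises k by one, and the two columns again form a gauge row, with parameter 1/z.
-/
theorem leftRef_lax (hp : Odd p) (hP : P.Admissible p) (ε : Fin N → ℤˣ) (k : Fin N → ℤ)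
    (n : Fin N) {t : ℂ} (ht : t ≠ 0) (j : Fin 2) :
    P.leftRef p ε k ᵥ* (-P.lax n t 0 j + (P.w (ε n) (k n) n / (P.q * t)) • P.lax n t 1 j) =
      (P.laxScalar (P.mu (ε n) n) n t * ![-1, 1 / P.z (ε n) (k n) n / (P.q * t)] j) •
        P.leftRef p ε (Function.update k n (k n + 1)) := by
  have hq := q_ne hP
  have hs := s_ne hP
  have hk : P.q ^ k n ≠ 0 := zpow_ne_zero _ hq
  have hr := rho_ne_zero hP n
  have ha := hP.a_ne n
  have hb := hP.b_ne n
  have hc := hP.c_ne n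
  have hd := hP.d_ne n
  have hal := hP.al_ne n
  have hbe := hP.be_ne n
  have hmu := P.mu_sq_mul hP (ε n) n
  have hk' : P.q ^ (k n + 1) = P.q ^ k n * P.q := zpow_add_one₀ hq _
  ext h
  have hx : P.q ^ (h n : ℕ) ≠ 0 := pow_ne_zero _ hq
  rw [Pi.smul_apply, leftRef_update hP, Matrix.vecMul_add, Matrix.vecMul_neg, Matrix.vecMul_smul,
    Pi.add_apply, Pi.neg_apply, Pi.smul_apply, smul_eq_mul, smul_eq_mul, lax_eq]
  have hS : P.laxScalar (P.mu (ε n) n) n t =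
      P.al n * t - P.al n * P.mu (ε n) n ^ 2 / t := by rw [laxScalar]; ring
  rw [hS, hmu]
  fin_cases j
  · have h₁ := localStep_mul hp hP (ε n) (k n) n (h n)
    simp only [Fin.zero_eta, of_apply, cons_val', cons_val_zero, cons_val_one, cons_val_fin_one]
    rw [vecMul_fv, ← Matrix.vecMul_vecMul, vecMul_fv, vecMul_uInv, leftRef_raise hp hP,
      mul_assoc (P.leftRef p ε k h), h₁, hk']
    unfold w
    rw [_root_.zpow_neg]
    split_ifs <;> field_simp <;> simp only [q] <;> ring
  · have h₁ := inv_localStep_mul hp hP (ε n) (k n) n ((raise p n).symm h n)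
    rw [pow_val_raise_symm hP] at h₁
    simp only [Fin.mk_one, of_apply, cons_val', cons_val_zero, cons_val_one, cons_val_fin_one]
    have e : P.a n / P.s * P.q ^ (h n : ℕ) + P.s * P.b n * (P.q ^ (h n : ℕ))⁻¹ =
        P.s * P.a n * (P.q ^ (h n : ℕ) / P.q) + P.b n / P.s * (P.q ^ (h n : ℕ) / P.q)⁻¹ := by
      simp only [q]; field_simp
    rw [← Matrix.vecMul_vecMul, vecMul_fv, vecMul_u, leftRef_eq_raise_symm hp hP, e, mul_assoc, h₁,
      hk', vecMul_fv]
    unfold w z gam del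
    rw [_root_.zpow_neg]
    split_ifs <;> simp only [q] at * <;> field_simp <;> ring

theorem rightRef_apply (ε : Fin N → ℤˣ) (k : Fin N → ℤ) (h : Lab p N) :
    P.rightRef p ε k h = (P.leftRef p ε (fun n => k n - 1) h)⁻¹ := by
  rw [← rightRef_eq]; simp

/-- Ket version: k is lowered, and the reversed order of v and u accounts for μ/q instead of μ and
for the extra q² in the outgoing row. -/
theorem rightRef_lax (hp : Odd p) (hP : P.Admissible p) (ε : Fin N → ℤˣ) (k : Fin N → ℤ)
    (n : Fin N) {t : ℂ} (ht : t ≠ 0) (j : Fin 2) :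
    (-P.lax n t 0 j + (P.w (ε n) (k n) n / (P.q * t)) • P.lax n t 1 j) *ᵥ P.rightRef p ε k =
      (P.laxScalar (P.mu (ε n) n / P.q) n t *
        ![-1, P.q ^ 2 / P.z (ε n) (k n) n / (P.q * t)] j) •
        P.rightRef p ε (Function.update k n (k n - 1)) := by
  have hq := q_ne hP
  have hs := s_ne hP
  have hk : P.q ^ k n ≠ 0 := zpow_ne_zero _ hq
  have hr := rho_ne_zero hP n
  have ha := hP.a_ne n
  have hb := hP.b_ne n
  have hc := hP.c_ne n
  have hd := hP.d_ne n
  have hal := hP.al_ne n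
  have hbe := hP.be_ne n
  have hmu := P.mu_sq_mul hP (ε n) n
  have hcomm (f l ψ : ℂ) : f * (ψ * l) = ψ * (l * f) := by ring
  ext h
  have hx : P.q ^ (h n : ℕ) ≠ 0 := pow_ne_zero _ hq
  have hup : P.rightRef p ε (Function.update k n (k n - 1)) h =
      P.rightRef p ε k h * P.q ^ (h n : ℕ) := by
    have h₁ := leftRef_update hP ε (fun m => Function.update k n (k n - 1) m - 1) n h
    have e : Function.update (fun m => Function.update k n (k n - 1) m - 1) n
        (Function.update k n (k n - 1) n - 1 + 1) = fun m => k m - 1 := by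
      ext m
      by_cases hm : m = n
      · subst hm; simp
      · simp [hm]
    rw [e] at h₁
    rw [rightRef_apply, rightRef_apply, h₁]
    field_simp
  rw [Pi.smul_apply, hup, Matrix.add_mulVec, Matrix.neg_mulVec, Matrix.smul_mulVec,
    Pi.add_apply, Pi.neg_apply, Pi.smul_apply, smul_eq_mul, smul_eq_mul, lax_eq]
  have hS : P.laxScalar (P.mu (ε n) n / P.q) n t =
      P.al n * t - P.al n * P.mu (ε n) n ^ 2 / (P.q ^ 2 * t) := by
    rw [laxScalar]; field_simp
  rw [hS, hmu]
  fin_cases j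
  · have h₁ := localStep_mul hp hP (ε n) (k n - 1) n ((raise p n).symm h n)
    simp only [Fin.zero_eta, of_apply, cons_val', cons_val_zero, cons_val_one, cons_val_fin_one]
    have h₂ : P.rightRef p ε k ((raise p n).symm h) = P.rightRef p ε k h *
        P.localStep (ε n) (k n - 1) n (P.q ^ ((raise p n).symm h n : ℕ)) := by
      rw [rightRef_apply, leftRef_eq_raise_symm hp hP, mul_inv, inv_inv, ← rightRef_apply,
        pow_val_raise_symm hP]
    rw [fv_mulVec, ← Matrix.mulVec_mulVec, uInv_mulVec, fv_mulVec, h₂,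
      hcomm _ (P.localStep _ _ _ _) _, h₁, sub_add_cancel, pow_val_raise_symm hP]
    unfold w
    rw [_root_.zpow_neg]
    split_ifs <;> simp only [q] at * <;> field_simp <;> ring
  · have h₁ := inv_localStep_mul hp hP (ε n) (k n - 1) n (h n)
    simp only [Fin.mk_one, of_apply, cons_val', cons_val_zero, cons_val_one, cons_val_fin_one]
    have h₂ : P.rightRef p ε k (raise p n h) = P.rightRef p ε k h *
        (P.localStep (ε n) (k n - 1) n (P.q ^ (h n : ℕ)))⁻¹ := by
      rw [rightRef_apply, leftRef_raise hp hP, mul_inv, ← rightRef_apply]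
    have e : P.a n / P.s * P.q ^ (raise p n h n : ℕ) +
        P.s * P.b n * (P.q ^ (raise p n h n : ℕ))⁻¹ =
        P.s * P.a n * P.q ^ (h n : ℕ) + P.b n / P.s * (P.q ^ (h n : ℕ))⁻¹ := by
      rw [pow_val_raise hP]
      simp only [q] at *; field_simp
    rw [← Matrix.mulVec_mulVec, u_mulVec, fv_mulVec, h₂, e,
      hcomm _ (P.localStep _ _ _ _)⁻¹ _, h₁, sub_add_cancel, fv_mulVec]
    unfold w z gam del
    rw [_root_.zpow_neg]
    split_ifs <;> simp only [q] at * <;> field_simp <;> ring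

/-! ### Transfer of gauge rows through the monodromy matrix -/

/-- Transfer of a row through a product of matrices of operators acting on bras. -/
theorem vecMul_transfer {m : ℕ} (F : Fin m → Matrix (Fin 2) (Fin 2) (Op p N)) (φ : ℕ → State p N)
    (r : ℕ → Fin 2 → ℂ) (S : Fin m → ℂ)
    (h : ∀ (i : Fin m) (j : Fin 2), φ i ᵥ* (r i 0 • F i 0 j + r i 1 • F i 1 j) =
      (S i * r (i + 1) j) • φ (i + 1)) (j : Fin 2) :
    φ 0 ᵥ* (r 0 0 • (List.ofFn F).prod 0 j + r 0 1 • (List.ofFn F).prod 1 j) =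
      ((∏ i, S i) * r m j) • φ m := by
  induction m generalizing φ r with
  | zero =>
    fin_cases j <;> simp [Matrix.vecMul_smul]
  | succ m ih =>
    have h' := ih (fun i => F i.succ) (fun i => φ (i + 1)) (fun i => r (i + 1))
      (fun i => S i.succ) (fun i j => by simpa using h i.succ j)
    have h₀ := h 0
    rw [List.ofFn_succ, List.prod_cons]
    generalize (List.ofFn fun i : Fin m => F i.succ).prod = R at h' ⊢
    simp only [Matrix.mul_apply (M := F 0), Fin.sum_univ_two]
    have e : r 0 0 • (F 0 0 0 * R 0 j + F 0 0 1 * R 1 j) +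
        r 0 1 • (F 0 1 0 * R 0 j + F 0 1 1 * R 1 j) =
        (r 0 0 • F 0 0 0 + r 0 1 • F 0 1 0) * R 0 j +
          (r 0 0 • F 0 0 1 + r 0 1 • F 0 1 1) * R 1 j := by
      simp only [add_mul, smul_add, smul_mul_assoc]; abel
    rw [e, Matrix.vecMul_add, ← Matrix.vecMul_vecMul, ← Matrix.vecMul_vecMul]
    have h₁ := h₀ 0
    have h₂ := h₀ 1
    simp only [Fin.val_zero, zero_add] at h₁ h₂
    rw [h₁, h₂, Fin.prod_univ_succ, mul_assoc (S 0), mul_smul (S 0) (_ * r (m + 1) j)]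
    simp only [zero_add] at h'
    rw [← h', Matrix.vecMul_add, Matrix.vecMul_smul, Matrix.vecMul_smul, Matrix.smul_vecMul,
      Matrix.smul_vecMul, smul_add, smul_smul, smul_smul]

/-- Transfer of a row through a product of commuting matrices of operators acting on kets. -/
theorem mulVec_transfer {m : ℕ} (F : Fin m → Matrix (Fin 2) (Fin 2) (Op p N)) (ψ : ℕ → State p N)
    (hF : ∀ i j, i ≠ j → ∀ a b c d, Commute (F i a b) (F j c d))
    (r : ℕ → Fin 2 → ℂ) (S : Fin m → ℂ)
    (h : ∀ (i : Fin m) (j : Fin 2), (r i 0 • F i 0 j + r i 1 • F i 1 j) *ᵥ ψ i =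
      (S i * r (i + 1) j) • ψ (i + 1)) (j : Fin 2) :
    (r 0 0 • (List.ofFn F).prod 0 j + r 0 1 • (List.ofFn F).prod 1 j) *ᵥ ψ 0 =
      ((∏ i, S i) * r m j) • ψ m := by
  induction m generalizing ψ r with
  | zero =>
    fin_cases j <;> simp [Matrix.smul_mulVec]
  | succ m ih =>
    have h' := ih (fun i => F i.succ) (fun i => ψ (i + 1))
      (fun i j hij => hF _ _ fun e => hij (Fin.succ_injective _ e)) (fun i => r (i + 1))
      (fun i => S i.succ) (fun i j => by simpa using h i.succ j)
    have h₀ := h 0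
    have hc (a b c d : Fin 2) :
        Commute (F 0 a b) ((List.ofFn fun i : Fin m => F i.succ).prod c d) := by
      exact commute_prod_entries _ (fun i c d => hF 0 i.succ (Fin.succ_ne_zero i).symm a b c d) c d
    rw [List.ofFn_succ, List.prod_cons]
    generalize (List.ofFn fun i : Fin m => F i.succ).prod = R at h' hc ⊢
    simp only [Matrix.mul_apply (M := F 0), Fin.sum_univ_two]
    -- The row enters the auxiliary product at the first factor, whereas a ket meets the last one
    -- first; commutation between sites lets the first factor act first.
    have e : r 0 0 • (F 0 0 0 * R 0 j + F 0 0 1 * R 1 j) +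
        r 0 1 • (F 0 1 0 * R 0 j + F 0 1 1 * R 1 j) =
        R 0 j * (r 0 0 • F 0 0 0 + r 0 1 • F 0 1 0) +
          R 1 j * (r 0 0 • F 0 0 1 + r 0 1 • F 0 1 1) := by
      simp only [(hc _ _ _ _).eq, mul_add, smul_add, mul_smul_comm]; abel
    rw [e, Matrix.add_mulVec, ← Matrix.mulVec_mulVec, ← Matrix.mulVec_mulVec]
    have h₁ := h₀ 0
    have h₂ := h₀ 1
    simp only [Fin.val_zero, zero_add] at h₁ h₂
    rw [h₁, h₂, Fin.prod_univ_succ, mul_assoc (S 0), mul_smul (S 0) (_ * r (m + 1) j)]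
    simp only [zero_add] at h'
    rw [← h', Matrix.add_mulVec, Matrix.smul_mulVec, Matrix.smul_mulVec, Matrix.mulVec_smul,
      Matrix.mulVec_smul, smul_add, smul_smul, smul_smul]

theorem prod_rev {M : Type*} [CommMonoid M] (f : Fin N → M) : ∏ i, f (Fin.rev i) = ∏ i, f i :=
  Equiv.prod_comp Fin.revPerm f

/-- M = L_N ⋯ L_1 is traversed from site N down, so W is indexed by position and site n stands at
position `n.rev`; k has been raised exactly at the sites already passed. The gauge row at x fits
because q · (x q^{-1/2}) = q^{1/2} x. -/
theorem leftRef_mono (hp : Odd p) (hP : P.Admissible p) (ε : Fin N → ℤˣ) (k : Fin N → ℤ)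
    {W : ℕ → ℂ} (hw : ∀ n : Fin N, W n.rev = P.w (ε n) (k n) n)
    (hz : ∀ n : Fin N, W (n.rev + 1) = 1 / P.z (ε n) (k n) n) {x : ℂ} (hx : x ≠ 0) (j : Fin 2) :
    P.leftRef p ε k ᵥ* ((-1 : ℂ) • P.mono x 0 j + (W 0 / (P.s * x)) • P.mono x 1 j) =
      ((∏ n, P.laxScalar (P.mu (ε n) n) n (x / P.s)) * ![-1, W N / (P.s * x)] j) •
        P.leftRef p ε fun n => k n + 1 := by
  have hs := s_ne hP
  have key := vecMul_transfer (fun n : Fin N => P.lax (p := p) n.rev (x / P.s))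
    (fun i => P.leftRef p ε fun n => if (n.rev : ℕ) < i then k n + 1 else k n)
    (fun i => ![-1, W i / (P.s * x)])
    (fun n => P.laxScalar (P.mu (ε n.rev) n.rev) n.rev (x / P.s)) (fun i j => ?_) j
  · rw [prod_rev fun n => P.laxScalar (P.mu (ε n) n) n (x / P.s)] at key
    simp only [Fin.is_lt, if_true] at key
    simpa [mono] using key
  · have h := leftRef_lax hp hP ε (fun n => if (n.rev : ℕ) < i then k n + 1 else k n) i.rev
      (div_ne_zero hx hs) j
    have e : Function.update (fun n : Fin N => if (n.rev : ℕ) < i then k n + 1 else k n) i.rev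
        ((if (i.rev.rev : ℕ) < i then k i.rev + 1 else k i.rev) + 1) =
        fun n => if (n.rev : ℕ) < i + 1 then k n + 1 else k n := by
      ext n
      by_cases hn : n = i.rev
      · subst hn; simp
      · have : (n.rev : ℕ) ≠ i := fun h => hn (by rw [← Fin.ext h, Fin.rev_rev])
        rw [Function.update_of_ne hn]
        have : (n.rev : ℕ) < i + 1 ↔ (n.rev : ℕ) < i := by omega
        exact (if_congr this rfl rfl).symm
    have et : P.q * (x / P.s) = P.s * x := by simp only [q]; field_simp
    have hw' := hw i.rev
    have hz' := hz i.rev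
    rw [Fin.rev_rev] at hw' hz'
    rw [e, et] at h
    simp only [Fin.rev_rev, lt_irrefl, if_false] at h
    rw [← hw', ← hz', ← neg_one_smul ℂ (P.lax i.rev (x / P.s) 0 j)] at h
    exact h

theorem rightRef_mono (hp : Odd p) (hP : P.Admissible p) (ε : Fin N → ℤˣ) (k : Fin N → ℤ)
    {W : ℕ → ℂ} (hw : ∀ n : Fin N, W n.rev = P.w (ε n) (k n) n)
    (hz : ∀ n : Fin N, W (n.rev + 1) = P.q ^ 2 / P.z (ε n) (k n) n) {x : ℂ} (hx : x ≠ 0)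
    (j : Fin 2) :
    ((-1 : ℂ) • P.mono x 0 j + (W 0 / (P.s * x)) • P.mono x 1 j) *ᵥ P.rightRef p ε k =
      ((∏ n, P.laxScalar (P.mu (ε n) n / P.q) n (x / P.s)) * ![-1, W N / (P.s * x)] j) •
        P.rightRef p ε fun n => k n - 1 := by
  have hs := s_ne hP
  have key := mulVec_transfer (fun n : Fin N => P.lax (p := p) n.rev (x / P.s))
    (fun i => P.rightRef p ε fun n => if (n.rev : ℕ) < i then k n - 1 else k n)
    (fun i j hij a b c d => P.lax_comm (fun e => hij (Fin.rev_injective e)) _ _ a b c d)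
    (fun i => ![-1, W i / (P.s * x)])
    (fun n => P.laxScalar (P.mu (ε n.rev) n.rev / P.q) n.rev (x / P.s)) (fun i j => ?_) j
  · rw [prod_rev fun n => P.laxScalar (P.mu (ε n) n / P.q) n (x / P.s)] at key
    simp only [Fin.is_lt, if_true] at key
    simpa [mono] using key
  · have h := rightRef_lax hp hP ε (fun n => if (n.rev : ℕ) < i then k n - 1 else k n) i.rev
      (div_ne_zero hx hs) j
    have e : Function.update (fun n : Fin N => if (n.rev : ℕ) < i then k n - 1 else k n) i.rev
        ((if (i.rev.rev : ℕ) < i then k i.rev - 1 else k i.rev) - 1) =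
        fun n => if (n.rev : ℕ) < i + 1 then k n - 1 else k n := by
      ext n
      by_cases hn : n = i.rev
      · subst hn; simp
      · have : (n.rev : ℕ) ≠ i := fun h => hn (by rw [← Fin.ext h, Fin.rev_rev])
        rw [Function.update_of_ne hn]
        have : (n.rev : ℕ) < i + 1 ↔ (n.rev : ℕ) < i := by omega
        exact (if_congr this rfl rfl).symm
    have et : P.q * (x / P.s) = P.s * x := by simp only [q]; field_simp
    have hw' := hw i.rev
    have hz' := hz i.rev
    rw [Fin.rev_rev] at hw' hz'
    rw [e, et] at h
    simp only [Fin.rev_rev, lt_irrefl, if_false] at h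
    rw [← hw', ← hz', ← neg_one_smul ℂ (P.lax i.rev (x / P.s) 0 j)] at h
    exact h

end Params

/-! ### Action of the contracted boundary monodromy on the reference states -/

section Contract

variable {𝒜 : Type*} [Ring 𝒜] [Algebra ℂ 𝒜]

/-- Applying an adjugate to the column (x g/q, 1) amounts to contracting the original matrix with
the row (-1, x g/q), up to order and sign. Both passes, through M(x) and through M̂(x), are
therefore row transfers. -/
theorem gaugeContract_dress (q g : ℂ) {x : ℂ} (hx : x ≠ 0) (A B : Matrix (Fin 2) (Fin 2) 𝒜)
    (K : Matrix (Fin 2) (Fin 2) ℂ) :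
    gaugeContract q g x (A * K.map (fun z => z • (1 : 𝒜)) * adj2 B) =
      K 0 0 • (((-1 : ℂ) • A 0 0 + (g / x) • A 1 0) * ((-1 : ℂ) • B 0 1 + (x * g / q) • B 1 1))
      - K 0 1 • (((-1 : ℂ) • A 0 0 + (g / x) • A 1 0) * ((-1 : ℂ) • B 0 0 + (x * g / q) • B 1 0))
      + K 1 0 • (((-1 : ℂ) • A 0 1 + (g / x) • A 1 1) * ((-1 : ℂ) • B 0 1 + (x * g / q) • B 1 1))
      - K 1 1 • (((-1 : ℂ) • A 0 1 + (g / x) • A 1 1) *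
        ((-1 : ℂ) • B 0 0 + (x * g / q) • B 1 0)) := by
  simp only [gaugeContract, Matrix.mul_apply, Fin.sum_univ_two, adj2, Matrix.map_apply,
    Matrix.of_apply, Matrix.cons_val', Matrix.cons_val_zero, Matrix.cons_val_one,
    Matrix.cons_val_fin_one, mul_smul_comm, smul_mul_assoc, mul_one, mul_add, add_mul, mul_neg]
  match_scalars <;> field_simp

end Contract

namespace Params

variable {N : ℕ} {P : Params N} {p : ℕ} [NeZero p]

theorem vecMul_gaugeContract {A B : Matrix (Fin 2) (Fin 2) (Op p N)} {K : Matrix (Fin 2) (Fin 2) ℂ}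
    {φ φ' φ'' : State p N} {q g x S S' V V' : ℂ} (hx : x ≠ 0)
    (hA : ∀ j, φ ᵥ* ((-1 : ℂ) • A 0 j + (g / x) • A 1 j) = (S * ![-1, V] j) • φ')
    (hB : ∀ j, φ' ᵥ* ((-1 : ℂ) • B 0 j + (x * g / q) • B 1 j) = (S' * ![-1, V'] j) • φ'') :
    φ ᵥ* gaugeContract q g x (A * K.map (fun z => z • (1 : Op p N)) * adj2 B) =
      (S * S' * (-(K 0 0 * V') - K 0 1 + V * V' * K 1 0 + V * K 1 1)) • φ'' := by
  rw [gaugeContract_dress q g hx]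
  rw [Matrix.vecMul_sub, Matrix.vecMul_add, Matrix.vecMul_sub]
  simp only [Matrix.vecMul_smul φ (K _ _), ← Matrix.vecMul_vecMul φ, hA, Matrix.smul_vecMul, hB, smul_smul, ← add_smul, ← sub_smul]
  congr 1
  simp only [Matrix.cons_val_zero, Matrix.cons_val_one]
  ring

theorem gaugeContract_mulVec {A B : Matrix (Fin 2) (Fin 2) (Op p N)} {K : Matrix (Fin 2) (Fin 2) ℂ}
    {ψ ψ' ψ'' : State p N} {q g x S S' V V' : ℂ} (hx : x ≠ 0)
    (hB : ∀ j, ((-1 : ℂ) • B 0 j + (x * g / q) • B 1 j) *ᵥ ψ = (S' * ![-1, V'] j) • ψ')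
    (hA : ∀ j, ((-1 : ℂ) • A 0 j + (g / x) • A 1 j) *ᵥ ψ' = (S * ![-1, V] j) • ψ'') :
    gaugeContract q g x (A * K.map (fun z => z • (1 : Op p N)) * adj2 B) *ᵥ ψ =
      (S * S' * (-(K 0 0 * V') - K 0 1 + V * V' * K 1 0 + V * K 1 1)) • ψ'' := by
  rw [gaugeContract_dress q g hx]
  simp only [Matrix.add_mulVec, Matrix.sub_mulVec, Matrix.smul_mulVec (K _ _),
    ← Matrix.mulVec_mulVec ψ, hB, Matrix.mulVec_smul, hA, smul_smul, ← add_smul, ← sub_smul]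
  congr 1
  simp only [Matrix.cons_val_zero, Matrix.cons_val_one]
  ring

variable (P) in
/-- The boundary factor of the pseudo-eigenvalues. -/
def boundaryFactor (y : ℂ) : ℂ :=
  (y * Complex.exp P.tau * P.kappa + P.zeta - P.kappa / (y * Complex.exp P.tau)) /
    (P.zeta - 1 / P.zeta)

/-- K₋ is met by the two transferred rows, whose final parameters involve the same y. All
x-dependence factors out, and the remaining factor is a quadratic in y e^{τ₋} divided by a monomial.
-/
theorem K_contract (hP : P.Admissible p) {x y : ℂ} (hx : x ≠ 0) (hy : y ≠ 0) :
    -(P.K x 0 0 * (x / (y * P.s))) - P.K x 0 1 + P.s / (y * x) * (x / (y * P.s)) * P.K x 1 0 +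
      P.s / (y * x) * P.K x 1 1 =
    -(P.boundaryFactor y / y) * (x ^ 2 / P.q - P.q / x ^ 2) := by
  have hs := s_ne hP
  have hz := hP.zeta_ne
  have he := Complex.exp_ne_zero P.tau
  simp only [K, boundaryFactor, Complex.exp_neg, Matrix.smul_apply, Matrix.of_apply,
    Matrix.cons_val', Matrix.cons_val_zero, Matrix.cons_val_one, Matrix.cons_val_fin_one, smul_eq_mul,
    div_eq_mul_inv _ (P.zeta - 1 / P.zeta), q]
  generalize (P.zeta - 1 / P.zeta)⁻¹ = c
  generalize Complex.exp P.tau = e at *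
  field_simp
  ring

/-- The scalars from M(x) and M(1/x) at one site form a pair of factors with zeros (μ q^{1/2})^{±1};
the sign at each site is absorbed by the (-1)^N of M̂. -/
theorem prod_laxScalar (hP : P.Admissible p) {μ : Fin N → ℂ} (hμ : ∀ n, μ n ≠ 0) {x : ℂ}
    (hx : x ≠ 0) :
    (-1) ^ N * ((∏ n, P.laxScalar (μ n) n (x / P.s)) * ∏ n, P.laxScalar (μ n) n (x⁻¹ / P.s)) =
      (∏ n, (P.al n * μ n) ^ 2) *
        ∏ n, ((x / (μ n * P.s) - μ n * P.s / x) * (x * (μ n * P.s) - 1 / (x * (μ n * P.s)))) := by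
  have hs := s_ne hP
  rw [← Finset.prod_mul_distrib, ← Finset.prod_mul_distrib]
  have : (-1 : ℂ) ^ N = ∏ n : Fin N, (-1 : ℂ) := by simp
  rw [this, ← Finset.prod_mul_distrib]
  refine Finset.prod_congr rfl fun n _ => ?_
  have := hμ n
  unfold laxScalar
  field_simp
  ring

/-- Two passes: M(x) raises every k by one, which divides all w's by q, and this is the row
parameter W/q needed for M(1/x). Hence k + 2 in the outgoing state. -/
theorem leftRef_gaugeContract (hp : Odd p) (hP : P.Admissible p) (ε : Fin N → ℤˣ) (k : Fin N → ℤ)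
    {W : ℕ → ℂ} (hw : ∀ n : Fin N, W n.rev = P.w (ε n) (k n) n)
    (hz : ∀ n : Fin N, W (n.rev + 1) = 1 / P.z (ε n) (k n) n) (hμ : ∀ n, P.mu (ε n) n ≠ 0)
    {x y : ℂ} (hx : x ≠ 0) (hy : y ≠ 0) (hWy : W N = P.q / y) :
    P.leftRef p ε k ᵥ* gaugeContract P.q (W 0 / P.s) x (P.U x) =
      P.zeroForm (-(P.boundaryFactor y / y) * ∏ n, (P.al n * P.mu (ε n) n) ^ 2)
        (fun n => P.mu (ε n) n * P.s) x • P.leftRef p ε fun n => k n + 2 := by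
  have hs := s_ne hP
  have hq := q_ne hP
  have hx' := inv_ne_zero hx
  have h₁ := leftRef_mono hp hP ε k hw hz hx
  have h₂ := leftRef_mono hp hP ε (fun n => k n + 1) (W := fun i => W i / P.q)
    (fun n => by rw [w_add hP, hw, zpow_one])
    (fun n => by rw [z_add hP, hz, zpow_one]; field_simp) hx'
  rw [show W 0 / (P.s * x) = W 0 / P.s / x by field_simp] at h₁
  rw [show W 0 / P.q / (P.s * x⁻¹) = x * (W 0 / P.s) / P.q by field_simp] at h₂
  have key := vecMul_gaugeContract (K := P.K x) hx h₁ h₂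
  have e (U : Matrix (Fin 2) (Fin 2) (Op p N)) (c : ℂ) : gaugeContract P.q (W 0 / P.s) x (c • U) =
      c • gaugeContract P.q (W 0 / P.s) x U := by
    simp only [gaugeContract, Matrix.smul_apply]; module
  rw [U_eq, e, Matrix.vecMul_smul, key, smul_smul]
  have e₁ : W N / (P.s * x) = P.s / (y * x) := by rw [hWy]; simp only [q]; field_simp
  have e₂ : W N / P.q / (P.s * x⁻¹) = x / (y * P.s) := by rw [hWy]; field_simp
  rw [e₁, e₂, K_contract hP hx hy, ← mul_assoc, prod_laxScalar hP hμ hx]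
  simp only [add_assoc, one_add_one_eq_two, zeroForm]
  congr 1
  ring

/-- For kets M̂ acts first, with parameters W, and M second, with parameters q W. -/
theorem rightRef_gaugeContract (hp : Odd p) (hP : P.Admissible p) (ε : Fin N → ℤˣ) (k : Fin N → ℤ)
    {W : ℕ → ℂ} (hw : ∀ n : Fin N, W n.rev = P.w (ε n) (k n) n)
    (hz : ∀ n : Fin N, W (n.rev + 1) = P.q ^ 2 / P.z (ε n) (k n) n) (hμ : ∀ n, P.mu (ε n) n ≠ 0)
    {x y : ℂ} (hx : x ≠ 0) (hy : y ≠ 0) (hWy : W N = 1 / y) :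
    gaugeContract P.q (P.q * W 0 / P.s) x (P.U x) *ᵥ P.rightRef p ε k =
      P.zeroForm (-(P.boundaryFactor y / y) * ∏ n, (P.al n * (P.mu (ε n) n / P.q)) ^ 2)
        (fun n => P.mu (ε n) n / P.q * P.s) x • P.rightRef p ε fun n => k n - 2 := by
  have hs := s_ne hP
  have hq := q_ne hP
  have hx' := inv_ne_zero hx
  have h₁ := rightRef_mono hp hP ε k hw hz hx'
  have h₂ := rightRef_mono hp hP ε (fun n => k n - 1) (W := fun i => P.q * W i)
    (fun n => by rw [sub_eq_add_neg, w_add hP, hw, _root_.zpow_neg, zpow_one]; field_simp)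
    (fun n => by rw [sub_eq_add_neg, z_add hP, hz, _root_.zpow_neg, zpow_one]; field_simp) hx
  rw [show W 0 / (P.s * x⁻¹) = x * (P.q * W 0 / P.s) / P.q by field_simp] at h₁
  rw [show P.q * W 0 / (P.s * x) = P.q * W 0 / P.s / x by field_simp] at h₂
  have key := gaugeContract_mulVec (K := P.K x) hx h₁ h₂
  have e (U : Matrix (Fin 2) (Fin 2) (Op p N)) (c : ℂ) :
      gaugeContract P.q (P.q * W 0 / P.s) x (c • U) =
        c • gaugeContract P.q (P.q * W 0 / P.s) x U := by
    simp only [gaugeContract, Matrix.smul_apply]; module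
  rw [U_eq, e, Matrix.smul_mulVec, key, smul_smul]
  have e₁ : P.q * W N / (P.s * x) = P.s / (y * x) := by rw [hWy]; simp only [q]; field_simp
  have e₂ : W N / (P.s * x⁻¹) = x / (y * P.s) := by rw [hWy]; field_simp
  rw [e₁, e₂, K_contract hP hx hy, ← mul_assoc,
    prod_laxScalar hP (fun n => div_ne_zero (hμ n) hq) hx]
  simp only [sub_sub, one_add_one_eq_two, zeroForm]
  congr 1
  ring

end Params
-- Gluing the sites: the reference states as pseudo-eigenstates
-- The relation between neighbouring sites says that the row leaving site n + 1 is the one needed to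
-- enter site n, so a single sequence of parameters serves all sites. Bras use c = 1, kets c = q².
theorem exists_transfer_parameters {N : ℕ} {z w : Fin (N + 1) → ℂ} {c : ℂ} (hw₀ : ∀ n, w n ≠ 0)
    (hz₀ : ∀ n, z n ≠ 0) (h : ∀ i : Fin N, z i.succ = c / w i.castSucc) :
    ∃ W : ℕ → ℂ, W 0 = w (Fin.last N) ∧ W (N + 1) = c / z 0 ∧
      (∀ n : Fin (N + 1), W n.rev = w n) ∧ ∀ n : Fin (N + 1), W (n.rev + 1) = c / z n := by
  let W : ℕ → ℂ := fun i => if h : i < N + 1 then w (Fin.rev ⟨i, h⟩) else c / z 0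
  have h₁ (n : Fin (N + 1)) : W n.rev = w n := by
    have : ((n.rev : Fin (N + 1)) : ℕ) < N + 1 := n.rev.is_lt
    simp only [W, dif_pos this, Fin.eta, Fin.rev_rev]
  have h₂ : W (N + 1) = c / z 0 := by simp [W]
  refine ⟨W, by simpa using h₁ (Fin.last N), h₂, h₁, fun n => ?_⟩
  induction n using Fin.cases with
  | zero => simpa using h₂
  | succ i =>
    have e : ((i.succ.rev : Fin (N + 1)) : ℕ) + 1 = (i.castSucc.rev : Fin (N + 1)) := by
      simp only [Fin.val_rev, Fin.val_succ, Fin.val_castSucc]; omega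
    have hw := hw₀ i.castSucc
    have hz := hz₀ i.succ
    rw [e, h₁, eq_div_iff hz, h, mul_div_cancel₀ _ hw]

/-- The product telescopes to its end values; this evaluates the product of γ²/μ² in the prefactor.
-/
theorem prod_mul_of_chain {N : ℕ} {z w : Fin (N + 1) → ℂ} {c : ℂ} (hw₀ : ∀ n, w n ≠ 0)
    (h : ∀ i : Fin N, z i.succ = c / w i.castSucc) :
    ∏ n, z n * w n = c ^ N * (z 0 * w (Fin.last N)) := by
  have e : c ^ N = ∏ i : Fin N, z i.succ * w i.castSucc := by
    rw [← Fin.prod_const]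
    exact Finset.prod_congr rfl fun i _ => by rw [h, div_mul_cancel₀ _ (hw₀ _)]
  rw [Finset.prod_mul_distrib, Fin.prod_univ_succ z, Fin.prod_univ_castSucc w, e,
    Finset.prod_mul_distrib]
  ring

namespace Params

section

variable {N : ℕ} {P : Params N} {p : ℕ} [NeZero p]

theorem mu_ne_zero (hP : P.Admissible p) (ε : ℤˣ) (n : Fin N) : P.mu ε n ≠ 0 := by
  intro h
  have h₀ := P.mu_sq_mul hP ε n
  have h₁ := q_ne hP
  have h₂ := hP.be_ne n
  rw [h, zero_pow two_ne_zero, mul_zero] at h₀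
  refine mul_ne_zero (mul_ne_zero (neg_ne_zero.mpr h₁) h₂) ?_ h₀.symm
  split_ifs
  · exact div_ne_zero (hP.a_ne n) (hP.b_ne n)
  · exact div_ne_zero (hP.c_ne n) (hP.d_ne n)

theorem gam_mul (hP : P.Admissible p) (ε : ℤˣ) (k : ℤ) (n : Fin N) :
    P.gam n * (P.z ε k n * P.w ε k n) = -(P.al n * P.mu ε n ^ 2) := by
  have hk : P.q ^ k ≠ 0 := zpow_ne_zero _ (q_ne hP)
  have hr := rho_ne_zero hP n
  have ha := hP.a_ne n
  have hb := hP.b_ne n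
  have hc := hP.c_ne n
  have hd := hP.d_ne n
  have hal := hP.al_ne n
  rw [P.mu_sq_mul hP]
  unfold gam z w
  rw [_root_.zpow_neg]
  split_ifs <;> simp only [q] at * <;> field_simp

/-- The factors 1 - (B/q)² cancel, which needs B² ≠ q², and so do the two signs. By γ z w = -α μ²
the bulk product is expressed through z w, in which k drops out. -/
theorem prefactor_eq (hP : P.Admissible p) (ε : Fin N → ℤˣ) (k : Fin N → ℤ) {B : ℂ} (y : ℂ)
    (hB : B ≠ 0) (hB₂ : B ^ 2 ≠ P.q ^ 2) : P.prefactor ε B y =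
      y * B ^ 3 / (P.q * P.ga * (1 - B ^ 2)) * P.boundaryFactor y *
        ((∏ n, (P.al n * P.mu (ε n) n) ^ 2) / (∏ n, P.z (ε n) (k n) n * P.w (ε n) (k n) n) ^ 2) := by
  have hq := q_ne hP
  have hg := hP.ga_ne
  have e : ∏ n, P.gam n ^ 2 / P.mu (ε n) n ^ 2 = (∏ n, (P.al n * P.mu (ε n) n) ^ 2) /
      (∏ n, P.z (ε n) (k n) n * P.w (ε n) (k n) n) ^ 2 := by
    rw [← Finset.prod_pow, ← Finset.prod_div_distrib]
    refine Finset.prod_congr rfl fun n _ => ?_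
    have h := gam_mul hP (ε n) (k n) n
    have hm := mu_ne_zero hP (ε n) n
    have hz := z_ne_zero hP (ε n) (k n) n
    have hw := w_ne_zero hP (ε n) (k n) n
    rw [div_eq_div_iff (pow_ne_zero 2 hm) (pow_ne_zero 2 (mul_ne_zero hz hw)), ← mul_pow, h]
    ring
  have h₁ : 1 - (B / P.q) ^ 2 ≠ 0 := by
    rw [div_pow, sub_ne_zero, ne_eq, eq_div_iff (pow_ne_zero 2 hq), one_mul]
    exact fun h => hB₂ h.symm
  have hs : ((-1 : ℂ) ^ N) * (-1) ^ N = 1 := by rw [← mul_pow]; simp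
  rw [prefactor, e, ← boundaryFactor, f]
  generalize (∏ n, (P.al n * P.mu (ε n) n) ^ 2) /
      (∏ n, P.z (ε n) (k n) n * P.w (ε n) (k n) n) ^ 2 = G
  have e₂ : (-1) ^ N * (y * (1 - (B / P.q) ^ 2) / (P.ga * (B / P.q))) *
      (B ^ 4 / P.q ^ 2 / ((1 - B ^ 2) * (1 - (B / P.q) ^ 2))) * (-1) ^ N =
      y * B ^ 3 / (P.q * P.ga * (1 - B ^ 2)) * ((-1) ^ N * (-1) ^ N) := by
    generalize 1 - (B / P.q) ^ 2 = r at *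
    by_cases ht : 1 - B ^ 2 = 0
    · simp [ht]
    · generalize 1 - B ^ 2 = t at *
      field_simp
  rw [e₂, hs]
  ring

theorem zeroForm_mul (r c : ℂ) (z : Fin N → ℂ) (x : ℂ) :
    r * P.zeroForm c z x = P.zeroForm (r * c) z x := by
  unfold zeroForm; ring

end

variable {N : ℕ} {P : Params (N + 1)} {p : ℕ} [NeZero p]

/-- Starting family for the bras: β = α w_N identifies the parameter of the row entering site N with
the gauge parameter of β_j, and raising k by 2 is the step j → j + 1. -/
theorem leftRef_chain (hp : Odd p) (hP : P.Admissible p) (ε : Fin (N + 1) → ℤˣ)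
    (k : Fin (N + 1) → ℤ) {β : ℂ} {βj bm : ℤ → ℂ} (hβj : ∀ j, βj j = β * P.q ^ (-2 * j))
    (hβ : P.GaugeOrbit βj) (hβ₂ : ∀ j, βj j ^ 2 ≠ P.q ^ 2)
    (h₀ : β = P.ga * P.w (ε (Fin.last N)) (k (Fin.last N)) (Fin.last N))
    (h : ∀ i : Fin N, P.z (ε i.succ) (k i.succ) i.succ =
      1 / P.w (ε i.castSucc) (k i.castSucc) i.castSucc)
    (hbm : ∀ j, bm j = P.prefactor ε (βj j) (P.z (ε 0) (k 0 + 2 * j + 1) 0)) :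
    P.BraChain βj bm (fun n => P.mu (ε n) n * P.s) fun j => P.leftRef p ε fun n => k n + 2 * j := by
  have hq := q_ne hP
  have hs := s_ne hP
  have hg := hP.ga_ne
  refine ⟨fun j e => leftRef_ne_zero hp hP ε _ (fun _ => 0) (congrFun e _), fun j x hx => ?_⟩
  have hqj : P.q ^ (2 * j) ≠ 0 := zpow_ne_zero _ hq
  -- Shifting all k by 2j multiplies z and divides w by the same power of q, so the gluing relation
  -- persists for every j.
  have h' (i : Fin N) : P.z (ε i.succ) (k i.succ + 2 * j) i.succ =
      1 / P.w (ε i.castSucc) (k i.castSucc + 2 * j) i.castSucc := by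
    have := w_ne_zero hP (ε i.castSucc) (k i.castSucc) i.castSucc
    rw [z_add hP, w_add hP, h]; field_simp
  obtain ⟨W, hW₀, hWN, hw, hz⟩ := exists_transfer_parameters
    (z := fun n => P.z (ε n) (k n + 2 * j) n) (w := fun n => P.w (ε n) (k n + 2 * j) n)
    (fun n => w_ne_zero hP _ _ n) (fun n => z_ne_zero hP _ _ n) h'
  have hprod := prod_mul_of_chain (z := fun n => P.z (ε n) (k n + 2 * j) n)
    (w := fun n => P.w (ε n) (k n + 2 * j) n) (fun n => w_ne_zero hP _ _ n) h'
  have hy := z_ne_zero hP (ε 0) (k 0 + 2 * j + 1) 0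
  have hzy : P.z (ε 0) (k 0 + 2 * j) 0 = P.z (ε 0) (k 0 + 2 * j + 1) 0 / P.q := by
    rw [z_add hP _ (k 0 + 2 * j), zpow_one]; field_simp
  have hwB : P.w (ε (Fin.last N)) (k (Fin.last N) + 2 * j) (Fin.last N) = βj j / P.ga := by
    rw [w_add hP, hβj, h₀, neg_mul, _root_.zpow_neg]; field_simp
  have hB := hβ.ne_zero j
  have hB₁ : 1 - βj j ^ 2 ≠ 0 := sub_ne_zero.mpr (hβ.sq_ne_one j).symm
  have key := leftRef_gaugeContract hp hP ε (fun n => k n + 2 * j) hw hz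
    (fun n => mu_ne_zero hP _ n) hx hy (by rw [hWN, hzy]; simp)
  have hW : W 0 / P.s = P.gpar (βj j) := by
    rw [hW₀, hwB, gpar]; simp only [q]; field_simp
  rw [gaugeB_eq hP, ← hW, Matrix.vecMul_smul, key, smul_smul, zeroForm_mul, hbm,
    prefactor_eq hP ε (fun n => k n + 2 * j) _ hB (hβ₂ j), hprod, hzy, hwB]
  have ek : (fun n => k n + 2 * j + 2) = fun n => k n + 2 * (j + 1) := by ext n; ring
  rw [ek]
  congr 2
  generalize P.z (ε 0) (k 0 + 2 * j + 1) 0 = y at *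
  generalize ∏ n, (P.al n * P.mu (ε n) n) ^ 2 = M
  rw [show βj j - 1 / βj j = -(1 - βj j ^ 2) / βj j by field_simp; ring]
  generalize 1 - βj j ^ 2 = t at *
  field_simp
  simp

/-- Starting family for the kets. The normalization (β_j/q)^{N+1} grows by q^{2(N+1)} from j to j -
1, which balances the powers of q coming from c = q² and from μ/q. -/
theorem rightRef_chain (hp : Odd p) (hP : P.Admissible p) (ε : Fin (N + 1) → ℤˣ)
    (k : Fin (N + 1) → ℤ) {β : ℂ} {βj bm : ℤ → ℂ} (hβj : ∀ j, βj j = β * P.q ^ (-2 * j))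
    (hβ : P.GaugeOrbit βj) (hβ₂ : ∀ j, βj j ^ 2 ≠ P.q ^ 2)
    (h₀ : β = P.ga * P.w (ε (Fin.last N)) (k (Fin.last N)) (Fin.last N))
    (h : ∀ i : Fin N, P.z (ε i.succ) (k i.succ - 2) i.succ =
      1 / P.w (ε i.castSucc) (k i.castSucc) i.castSucc)
    (hbm : ∀ j, bm j = P.prefactor ε (βj j) (P.z (ε 0) (k 0 + 2 * j - 1) 0)) :
    P.KetChain βj bm (fun n => P.mu (ε n) n * P.s / P.q)
      fun j => (βj j / P.q) ^ (N + 1) • P.rightRef p ε fun n => k n + 2 * j + 1 := by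
  have hq := q_ne hP
  have hs := s_ne hP
  have hg := hP.ga_ne
  refine ⟨fun j => smul_ne_zero (pow_ne_zero _ (div_ne_zero (hβ.ne_zero j) hq)) fun e => ?_,
    fun j x hx => ?_⟩
  · have := congrFun e (fun _ => 0)
    rw [rightRef_apply, Pi.zero_apply, inv_eq_zero] at this
    exact leftRef_ne_zero hp hP ε _ _ this
  have hqj : P.q ^ (2 * j) ≠ 0 := zpow_ne_zero _ hq
  have h' (i : Fin N) : P.z (ε i.succ) (k i.succ + 2 * j + 1) i.succ =
      P.q ^ 2 / P.w (ε i.castSucc) (k i.castSucc + 2 * j + 1) i.castSucc := by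
    have := w_ne_zero hP (ε i.castSucc) (k i.castSucc) i.castSucc
    -- The offset -2 in the hypothesis on z becomes the factor c = q² required by the ket transfer.
    have e : k i.succ + 2 * j + 1 = k i.succ - 2 + (2 * j + 1 + (2 : ℕ)) := by push_cast; ring
    have e' : P.q ^ (2 * j + 1 + ((2 : ℕ) : ℤ)) = P.q ^ (2 * j + 1) * P.q ^ 2 := by
      rw [zpow_add₀ hq, zpow_natCast]
    have hqj' : P.q ^ (2 * j + 1) ≠ 0 := zpow_ne_zero _ hq
    rw [e, z_add hP, e', h, add_assoc, w_add hP]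
    field_simp
  obtain ⟨W, hW₀, hWN, hw, hz⟩ := exists_transfer_parameters
    (z := fun n => P.z (ε n) (k n + 2 * j + 1) n) (w := fun n => P.w (ε n) (k n + 2 * j + 1) n)
    (fun n => w_ne_zero hP _ _ n) (fun n => z_ne_zero hP _ _ n) h'
  have hprod := prod_mul_of_chain (z := fun n => P.z (ε n) (k n + 2 * j + 1) n)
    (w := fun n => P.w (ε n) (k n + 2 * j + 1) n) (fun n => w_ne_zero hP _ _ n) h'
  have hy := z_ne_zero hP (ε 0) (k 0 + 2 * j - 1) 0
  have hzy : P.z (ε 0) (k 0 + 2 * j + 1) 0 = P.q ^ 2 * P.z (ε 0) (k 0 + 2 * j - 1) 0 := by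
    rw [← zpow_natCast, ← z_add hP]; congr 1; push_cast; ring
  have hwB : P.w (ε (Fin.last N)) (k (Fin.last N) + 2 * j + 1) (Fin.last N) =
      βj j / (P.ga * P.q) := by
    rw [add_assoc, w_add hP, hβj, h₀, neg_mul, _root_.zpow_neg, zpow_add_one₀ hq]; field_simp
  have hB := hβ.ne_zero j
  have hB₁ : 1 - βj j ^ 2 ≠ 0 := sub_ne_zero.mpr (hβ.sq_ne_one j).symm
  have key := rightRef_gaugeContract hp hP ε (fun n => k n + 2 * j + 1) hw hz
    (fun n => mu_ne_zero hP _ n) hx hy (by rw [hWN, hzy]; field_simp)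
  have hW : P.q * W 0 / P.s = P.gpar (βj j) := by
    rw [hW₀, hwB, gpar]; simp only [q]; field_simp
  have hBj : βj (j - 1) = βj j * P.q ^ 2 := by
    have := hβ.step (j - 1)
    rw [sub_add_cancel] at this
    rw [this]; field_simp
  have ez : (fun n => P.mu (ε n) n / P.q * P.s) = fun n => P.mu (ε n) n * P.s / P.q := by
    ext n; ring
  have ek : (fun n => k n + 2 * j + 1 - 2) = fun n => k n + 2 * (j - 1) + 1 := by ext n; ring
  have eM : ∏ n, (P.al n * (P.mu (ε n) n / P.q)) ^ 2 =
      (∏ n, (P.al n * P.mu (ε n) n) ^ 2) / (P.q ^ (N + 1)) ^ 2 := by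
    rw [← pow_mul, mul_comm _ 2, pow_mul, ← Fin.prod_const, ← Finset.prod_div_distrib]
    exact Finset.prod_congr rfl fun n _ => by ring
  rw [gaugeB_eq hP, ← hW, Matrix.mulVec_smul, Matrix.smul_mulVec, key, ez, ek, smul_smul, smul_smul,
    smul_smul, mul_assoc, zeroForm_mul, mul_comm _ ((βj (j - 1) / P.q) ^ (N + 1)), zeroForm_mul,
    zeroForm_mul, hbm, prefactor_eq hP ε (fun n => k n + 2 * j + 1) _ hB (hβ₂ j), hprod, hzy, hwB, eM,
    hBj]
  congr 2
  generalize P.z (ε 0) (k 0 + 2 * j - 1) 0 = y at *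
  generalize ∏ n, (P.al n * P.mu (ε n) n) ^ 2 = M
  rw [show βj j - 1 / βj j = -(1 - βj j ^ 2) / βj j by field_simp; ring]
  generalize 1 - βj j ^ 2 = t at *
  simp only [div_pow, mul_pow, pow_succ (_ : ℂ) N]
  rw [pow_right_comm P.q 2 N]
  have hQ : P.q ^ N ≠ 0 := pow_ne_zero _ hq
  generalize P.q ^ N = Q at *
  generalize βj j ^ N = R
  field_simp

end Params

/-! ### Genericity: nonvanishing denominators, determinants and prefactors -/

namespace Params

variable {N : ℕ} {P : Params N} {p : ℕ} [NeZero p]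

/-- The points at which the reflection determinant does not vanish. -/
structure Regular (P : Params N) (x : ℂ) : Prop where
  ne_zero : x ≠ 0
  mu₁ : ∀ n ε, x ^ 2 ≠ P.q * P.mu ε n ^ 2
  mu₂ : ∀ n ε, P.q ≠ x ^ 2 * P.mu ε n ^ 2
  alm₁ : x ^ 2 ≠ P.q * P.alm ^ 2
  alm₂ : P.q ≠ x ^ 2 * P.alm ^ 2
  bem₁ : x ^ 2 ≠ -P.q * P.bem ^ 2
  bem₂ : P.q ≠ -x ^ 2 * P.bem ^ 2

theorem Regular.refDet_ne_zero (hP : P.Admissible p) {x : ℂ} (h : P.Regular x) : P.refDet x ≠ 0 :=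
  Params.refDet_ne_zero hP h.ne_zero h.mu₁ h.mu₂ h.alm₁ h.alm₂ h.bem₁ h.bem₂

/-- The conditions come in pairs exchanged by x ↦ q/x. -/
theorem Regular.reflect (hP : P.Admissible p) {x : ℂ} (h : P.Regular x) : P.Regular (P.q / x) := by
  have hq := q_ne hP
  have hx := h.ne_zero
  have e₁ {c : ℂ} (hc : P.q ≠ x ^ 2 * c) : (P.q / x) ^ 2 ≠ P.q * c := by
    intro e
    field_simp at e
    exact hc (by linear_combination e)
  have e₂ {c : ℂ} (hc : x ^ 2 ≠ P.q * c) : P.q ≠ (P.q / x) ^ 2 * c := by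
    intro e
    field_simp at e
    exact hc (by linear_combination e)
  exact ⟨div_ne_zero hq hx, fun n ε => e₁ (h.mu₂ n ε), fun n ε => e₂ (h.mu₁ n ε), e₁ h.alm₂,
    e₂ h.alm₁,
    by simpa using e₁ (c := -P.bem ^ 2) (by simpa using h.bem₂),
    by simpa using e₂ (c := -P.bem ^ 2) (by simpa using h.bem₁)⟩

/-- The zeros of 𝖠₋ are among those of the reflection determinant: the two factors of g₋ correspond
to `alm₂` and `bem₂`, a(x) to `mu₁` for μ_+, and d(x) to `mu₂` for μ_-. -/
theorem Regular.sfA_ne_zero (hP : P.Admissible p) {x : ℂ} (h : P.Regular x) : P.sfA x ≠ 0 := by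
  have hq := q_ne hP
  have hs := s_ne hP
  have hx := h.ne_zero
  have ha := hP.alm_ne
  have hb := hP.bem_ne
  have hz : P.zeta - 1 / P.zeta ≠ 0 := by
    have : P.zeta - 1 / P.zeta = (P.zeta ^ 2 - 1) / P.zeta := by have := hP.zeta_ne; field_simp
    rw [this]
    exact div_ne_zero (sub_ne_zero.mpr hP.zeta_sq_ne) hP.zeta_ne
  refine mul_ne_zero (mul_ne_zero (div_ne_zero (mul_ne_zero ?_ ?_) ?_) (mul_ne_zero hP.a0_ne
    (Finset.prod_ne_zero_iff.mpr fun n _ => ?_))) (mul_ne_zero (div_ne_zero (by simp) hP.a0_ne)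
    (Finset.prod_ne_zero_iff.mpr fun n _ => ?_))
  · intro e
    refine h.alm₂ ?_
    field_simp at e
    simp only [q]
    linear_combination -e
  · intro e
    refine h.bem₂ ?_
    field_simp at e
    simp only [q]
    linear_combination e
  · rw [hP.alm_bem₁]
    exact div_ne_zero hz hP.kappa_ne
  · intro e
    refine h.mu₁ n 1 ?_
    have h₁ := hP.a_ne n
    have h₂ := hP.b_ne n
    have h₃ := hP.al_ne n
    rw [hP.mu_plus]
    simp only [q] at *
    field_simp at e ⊢
    linear_combination e
  · intro e
    refine h.mu₂ n (-1) ?_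
    have h₁ := hP.c_ne n
    have h₂ := hP.d_ne n
    have h₃ := hP.al_ne n
    have h₄ := hP.a_ne n
    have h₅ := hP.be_ne n
    rw [hP.mu_minus]
    simp only [q] at *
    field_simp at e ⊢
    refine mul_left_cancel₀ (mul_ne_zero h₄ hs) ?_
    linear_combination e

theorem sfD_ne_zero (hP : P.Admissible p) {x : ℂ} (h : P.Regular (P.q / x)) (h₁ : x ^ 4 ≠ 1)
    (h₂ : x ^ 4 ≠ P.q ^ 4) : P.sfD x ≠ 0 := by
  have hq := q_ne hP
  have hx : x ≠ 0 := fun e => h.ne_zero (by simp [e])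
  refine mul_ne_zero (div_ne_zero ?_ ?_) (h.sfA_ne_zero hP)
  · intro e
    field_simp at e
    exact h₁ (by linear_combination e)
  · intro e
    field_simp at e
    exact h₂ (by linear_combination e)

-- Vanishing is a quadratic equation for y e^{τ₋}, whose roots are excluded by the hypothesis on
-- p-th powers; these depend neither on the shift of k in z nor on the factor q in its denominator.
variable (P) in
theorem boundaryFactor_ne_zero (hP : P.Admissible p) {y z : ℂ} (hy : y ≠ 0) (hyz : y ^ p = z ^ p)
    (hz : ∀ r : ℂ, r ^ 2 = P.zeta ^ 2 + 4 * P.kappa ^ 2 →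
      z ^ p ≠ (-P.zeta + r) ^ p / (2 * P.q * Complex.exp P.tau * P.kappa) ^ p) :
    P.boundaryFactor y ≠ 0 := by
  have hk := hP.kappa_ne
  have hq := q_ne hP
  have he := Complex.exp_ne_zero P.tau
  have hz₀ := hP.zeta_ne
  refine div_ne_zero (fun e => ?_) ?_
  · generalize Complex.exp P.tau = t at *
    have e' : P.kappa * (y * t) ^ 2 + P.zeta * (y * t) - P.kappa = 0 := by
      field_simp at e
      linear_combination e
    -- If κ Y² + ζ Y - κ = 0 with Y = y e^{τ₋}, then 2κY + ζ is a square root of the discriminant ζ²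
    -- + 4κ².
    refine hz (2 * P.kappa * (y * t) + P.zeta) (by linear_combination 4 * P.kappa * e') ?_
    rw [← hyz, ← div_pow]
    have : (-P.zeta + (2 * P.kappa * (y * t) + P.zeta)) / (2 * P.q * t * P.kappa) = y / P.q := by
      field_simp; ring
    rw [this, div_pow, hP.q_prim.pow_eq_one, div_one]
  · have : P.zeta - 1 / P.zeta = (P.zeta ^ 2 - 1) / P.zeta := by field_simp
    rw [this]
    exact div_ne_zero (sub_ne_zero.mpr hP.zeta_sq_ne) hz₀

theorem prefactor_ne_zero (hP : P.Admissible p) (ε : Fin N → ℤˣ) {B y : ℂ} (hB : B ≠ 0)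
    (hB₁ : B ^ 2 ≠ 1) (hB₂ : B ^ 2 ≠ P.q ^ 2) (hy : y ≠ 0) (hbd : P.boundaryFactor y ≠ 0) :
    P.prefactor ε B y ≠ 0 := by
  rw [prefactor_eq hP ε 0 y hB hB₂]
  refine mul_ne_zero (mul_ne_zero (div_ne_zero (mul_ne_zero hy (pow_ne_zero 3 hB)) (mul_ne_zero
    (mul_ne_zero (q_ne hP) hP.ga_ne) (sub_ne_zero.mpr hB₁.symm))) hbd) (div_ne_zero
    (Finset.prod_ne_zero_iff.mpr fun n _ => pow_ne_zero 2 (mul_ne_zero (hP.al_ne n)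
      (mu_ne_zero hP _ n))) (pow_ne_zero 2 (Finset.prod_ne_zero_iff.mpr fun n _ =>
        mul_ne_zero (z_ne_zero hP _ _ n) (w_ne_zero hP _ _ n))))

/-- The genericity conditions on the `μ`'s. -/
structure Generic (P : Params N) (p : ℕ) (ε : Fin N → ℤˣ) : Prop where
  one : ∀ n, P.mu (ε n) n ^ (2 * p) ≠ 1 ∧ P.mu (ε n) n ^ (2 * p) ≠ -1
  alm : ∀ n, ∀ e : ℤˣ, P.mu (ε n) n ^ (2 * p) ≠ (P.alm ^ (2 * p)) ^ (e : ℤ)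
  bem : ∀ n, ∀ e : ℤˣ, P.mu (ε n) n ^ (2 * p) ≠ -(P.bem ^ (2 * p)) ^ (e : ℤ)
  opposite : ∀ n m, ∀ e : ℤˣ, P.mu 1 n ^ (2 * p) ≠ (P.mu (-1) m ^ (2 * p)) ^ (e : ℤ)
  distinct : ∀ n m, n ≠ m → ∀ e : ℤˣ,
    P.mu (ε n) n ^ (2 * p) ≠ (P.mu (ε n) m ^ (2 * p)) ^ (e : ℤ)

section Generic

variable {ε : Fin N → ℤˣ}

/-- Opposite signs are excluded by `opposite`, different sites of equal sign by `distinct`; for the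
same site and sign the product is a square, and `one` excludes both of its roots ±1. -/
theorem Generic.mul_ne_one (hP : P.Admissible p) (hG : P.Generic p ε) (n m : Fin N) (ε' : ℤˣ) :
    P.mu (ε n) n ^ (2 * p) * P.mu ε' m ^ (2 * p) ≠ 1 := by
  intro h
  have hm : P.mu ε' m ^ (2 * p) ≠ 0 := pow_ne_zero _ (mu_ne_zero hP _ _)
  have h₁ : P.mu (ε n) n ^ (2 * p) = (P.mu ε' m ^ (2 * p)) ^ ((-1 : ℤˣ) : ℤ) := by
    simpa using eq_inv_of_mul_eq_one_left h
  have h₂ : P.mu ε' m ^ (2 * p) = (P.mu (ε n) n ^ (2 * p)) ^ ((-1 : ℤˣ) : ℤ) := by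
    simpa using eq_inv_of_mul_eq_one_right h
  by_cases hε : ε' = ε n
  · subst hε
    by_cases hnm : n = m
    · subst hnm
      rcases mul_self_eq_one_iff.mp h with h | h
      · exact (hG.one n).1 h
      · exact (hG.one n).2 h
    · exact hG.distinct n m hnm _ h₁
  · rcases Int.units_eq_one_or (ε n) with h₃ | h₃ <;> rw [h₃] at h₁ h₂ hε
    · rw [units_eq_neg_one hε] at h₁
      exact hG.opposite _ _ _ h₁
    · rw [(Int.units_eq_one_or ε').resolve_right hε] at h₂
      exact hG.opposite _ _ _ h₂

theorem Generic.eq_of_eq (hG : P.Generic p ε) {n m : Fin N} {ε' : ℤˣ}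
    (h : P.mu (ε n) n ^ (2 * p) = P.mu ε' m ^ (2 * p)) : n = m ∧ ε' = ε n := by
  by_cases hε : ε' = ε n
  · subst hε
    refine ⟨?_, rfl⟩
    by_contra hnm
    exact hG.distinct n m hnm 1 (by simpa using h)
  · exfalso
    rcases Int.units_eq_one_or (ε n) with h₃ | h₃ <;> rw [h₃] at h hε
    · rw [units_eq_neg_one hε] at h
      exact hG.opposite _ _ 1 (by simpa using h)
    · rw [(Int.units_eq_one_or ε').resolve_right hε] at h
      exact hG.opposite _ _ 1 (by simpa using h.symm)

theorem s_pow (hP : P.Admissible p) : P.s ^ (2 * p) = 1 := by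
  rw [pow_mul]; exact hP.q_prim.pow_eq_one

theorem q_zpow_pow (hP : P.Admissible p) (e : ℤ) (m : ℕ) : (P.q ^ e) ^ (m * p) = 1 := by
  rw [← zpow_natCast, ← _root_.zpow_mul, mul_comm, Nat.cast_mul, mul_assoc, mul_comm, mul_assoc,
    _root_.zpow_mul, zpow_natCast, hP.q_prim.pow_eq_one, _root_.one_zpow]

theorem q_pow_pow (hP : P.Admissible p) (e : ℕ) (m : ℕ) : (P.q ^ e) ^ (m * p) = 1 := by
  rw [← zpow_natCast P.q e, q_zpow_pow hP]

/-- Taking p-th powers removes all powers of q, and genericity then excludes every bad case but the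
point's own zero, q = x² μ_n². That case means q^{2(e-1)} = 1, so p divides e - 1 because p is odd.
-/
theorem Generic.regular (hp : Odd p) (hP : P.Admissible p) (hG : P.Generic p ε) (n : Fin N) {e : ℤ}
    (he : ¬ (p : ℤ) ∣ e - 1) : P.Regular (P.q ^ e / (P.mu (ε n) n * P.s)) := by
  have hq := q_ne hP
  have hs := s_ne hP
  have hM := mu_ne_zero hP (ε n) n
  have hqe : P.q ^ e ≠ 0 := zpow_ne_zero _ hq
  set x := P.q ^ e / (P.mu (ε n) n * P.s) with hx
  have hxM : P.mu (ε n) n ^ (2 * p) * x ^ (2 * p) = 1 := by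
    rw [hx, div_pow, q_zpow_pow hP, mul_pow, s_pow hP, mul_one,
      mul_one_div_cancel (pow_ne_zero _ hM)]
  have hqp := hP.q_prim.pow_eq_one
  have e₁ {c : ℂ} (h : x ^ 2 = P.q * c) : P.mu (ε n) n ^ (2 * p) * c ^ p = 1 := by
    rw [← hxM, pow_mul x, h, mul_pow, hqp, one_mul]
  have e₂ {c : ℂ} (h : P.q = x ^ 2 * c) : P.mu (ε n) n ^ (2 * p) = c ^ p := by
    have h₁ : 1 = x ^ (2 * p) * c ^ p := by rw [← hqp, pow_mul, ← mul_pow, ← h]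
    calc P.mu (ε n) n ^ (2 * p) = P.mu (ε n) n ^ (2 * p) * x ^ (2 * p) * c ^ p := by
          rw [mul_assoc, ← h₁, mul_one]
      _ = c ^ p := by rw [hxM, one_mul]
  have inv {a c : ℂ} (h : a * c = 1) : a = c ^ ((-1 : ℤˣ) : ℤ) := by
    simpa using eq_inv_of_mul_eq_one_left h
  refine ⟨div_ne_zero hqe (mul_ne_zero hM hs), fun m ε' h => ?_, fun m ε' h => ?_, fun h => ?_,
    fun h => ?_, fun h => ?_, fun h => ?_⟩
  · have := e₁ h
    rw [← pow_mul] at this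
    exact hG.mul_ne_one hP n m ε' this
  · have := e₂ h
    rw [← pow_mul] at this
    obtain ⟨rfl, rfl⟩ := hG.eq_of_eq this
    have h₁ : P.q ^ (2 * (e - 1)) = 1 := by
      have : x ^ 2 * P.mu (ε n) n ^ 2 = P.q ^ (2 * (e - 1)) * P.q := by
        have e₀ : (2 : ℤ) * (e - 1) = (e - 1) * (2 : ℕ) := by push_cast; ring
        rw [hx, e₀, _root_.zpow_mul, zpow_natCast, zpow_sub_one₀ hq]
        simp only [q]
        field_simp
      rw [this] at h
      exact (mul_eq_right₀ hq).mp h.symm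
    rw [hP.q_prim.zpow_eq_one_iff_dvd] at h₁
    exact he (Int.dvd_of_dvd_mul_right_of_gcd_one h₁ (by
      have := hp.coprime_two_right
      simpa [Int.gcd] using this))
  · have := e₁ h
    rw [← pow_mul] at this
    exact hG.alm n _ (inv this)
  · have := e₂ h
    rw [← pow_mul] at this
    exact hG.alm n 1 (by simpa using this)
  · have := e₁ (c := -P.bem ^ 2) (by rw [h]; ring)
    rw [hp.neg_pow, ← pow_mul, mul_neg, ← neg_mul] at this
    exact hG.bem n _ (by rw [← inv this, neg_neg])
  · have := e₂ (c := -P.bem ^ 2) (by linear_combination h)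
    rw [hp.neg_pow, ← pow_mul] at this
    exact hG.bem n 1 (by simpa using this)

theorem Generic.zero_pow (hP : P.Admissible p) (n : Fin N) :
    (P.mu (ε n) n * P.s) ^ (2 * p) = P.mu (ε n) n ^ (2 * p) := by
  rw [mul_pow, s_pow hP, mul_one]

theorem Generic.pow_four_ne_one (hP : P.Admissible p) (hG : P.Generic p ε) (n : Fin N) (i : ℕ) :
    (((P.q ^ i)⁻¹ / (P.mu (ε n) n * P.s)) ^ 4) ^ p ≠ 1 := by
  intro h
  rw [← pow_mul, div_pow, inv_pow, q_pow_pow hP, inv_one, one_div] at h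
  replace h := inv_injective (h.trans inv_one.symm)
  rw [show 4 * p = 2 * p + 2 * p by ring, pow_add, Generic.zero_pow hP] at h
  exact hG.mul_ne_one hP n n (ε n) h

theorem Generic.sfD_ne_zero (hP : P.Admissible p) (hG : P.Generic p ε) (n : Fin N)
    {i : ℕ} (h : P.Regular (P.q / ((P.q ^ i)⁻¹ / (P.mu (ε n) n * P.s)))) :
    P.sfD ((P.q ^ i)⁻¹ / (P.mu (ε n) n * P.s)) ≠ 0 := by
  have h₄ := hG.pow_four_ne_one hP n i
  refine Params.sfD_ne_zero hP h (fun e => h₄ (by rw [e, one_pow])) fun e => h₄ ?_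
  have := q_pow_pow hP 4 1
  rw [one_mul] at this
  rw [e, this]

/-- The point is a zero for the label h at site n. In 2p-th powers it differs from the zeros of
other sites and from the reciprocal ones; at site n itself q^{2 h_n} ≠ q^{2 h'_n} because p is odd.
-/
theorem Generic.zeroForm_ne_zero (hp : Odd p) (hP : P.Admissible p) (hG : P.Generic p ε) {bm : ℂ}
    (hbm : bm ≠ 0) {h h' : Lab p N} {n : Fin N} (hn : h n ≠ h' n) :
    P.zeroForm bm (fun n => P.mu (ε n) n * P.s * P.q ^ (h' n : ℕ))
      (P.mu (ε n) n * P.s * P.q ^ (h n : ℕ))⁻¹ ≠ 0 := by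
  have hq := q_ne hP
  have hs := s_ne hP
  have hM (n : Fin N) := mu_ne_zero hP (ε n) n
  have hqh (m : ℕ) : P.q ^ m ≠ 0 := pow_ne_zero _ hq
  have hz (m : Fin N) (i : ℕ) : P.mu (ε m) m * P.s * P.q ^ i ≠ 0 :=
    mul_ne_zero (mul_ne_zero (hM m) hs) (hqh i)
  have hzp (m : Fin N) (i : ℕ) : (P.mu (ε m) m * P.s * P.q ^ i) ^ (2 * p) =
      P.mu (ε m) m ^ (2 * p) := by
    rw [mul_pow, q_pow_pow hP, mul_one, Generic.zero_pow hP]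
  have hx : (P.mu (ε n) n * P.s * P.q ^ (h n : ℕ))⁻¹ ≠ 0 := inv_ne_zero (hz _ _)
  refine mul_ne_zero (mul_ne_zero hbm fun e => ?_) (Finset.prod_ne_zero_iff.mpr fun m _ =>
    mul_ne_zero (fun e => ?_) fun e => ?_) <;> beta_reduce at e
  · generalize hy : P.mu (ε n) n * P.s * P.q ^ (h n : ℕ) = y at e hx
    have hy₀ : y ≠ 0 := fun h₀ => hx (by simp [h₀])
    field_simp at e
    have h₁ : P.q ^ 2 * y ^ 4 = 1 := by linear_combination -e
    have h₂ : (P.q ^ 2 * y ^ 4) ^ p = 1 := by rw [h₁, one_pow]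
    rw [mul_pow, ← pow_mul, mul_comm 2 p, pow_mul, hP.q_prim.pow_eq_one, one_pow, one_mul, ← pow_mul,
      show 4 * p = 2 * p + 2 * p by ring, pow_add, ← hy, hzp] at h₂
    exact hG.mul_ne_one hP n n (ε n) h₂
  · have h₁ := hzp n (h n)
    have h₂ := hzp m (h' m)
    have hz₁ := hz n (h n)
    have hz₂ := hz m (h' m)
    generalize P.mu (ε n) n * P.s * P.q ^ (h n : ℕ) = y at *
    generalize P.mu (ε m) m * P.s * P.q ^ (h' m : ℕ) = y' at *
    field_simp at e
    have h₃ : (y ^ 2 * y' ^ 2) ^ p = 1 := by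
      rw [show y ^ 2 * y' ^ 2 = 1 by linear_combination -e, one_pow]
    rw [mul_pow, ← pow_mul, ← pow_mul, h₁, h₂] at h₃
    exact hG.mul_ne_one hP n m (ε m) h₃
  · have h₁ := hzp n (h n)
    have h₂ := hzp m (h' m)
    have hz₁ := hz n (h n)
    have hz₂ := hz m (h' m)
    have h₃ : (P.mu (ε n) n * P.s * P.q ^ (h n : ℕ)) ^ 2 =
        (P.mu (ε m) m * P.s * P.q ^ (h' m : ℕ)) ^ 2 := by
      generalize P.mu (ε n) n * P.s * P.q ^ (h n : ℕ) = y at *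
      generalize P.mu (ε m) m * P.s * P.q ^ (h' m : ℕ) = y' at *
      field_simp at e
      linear_combination -e
    have h₄ := congrArg (· ^ p) h₃
    simp only [← pow_mul, h₁, h₂] at h₄
    obtain ⟨rfl, -⟩ := hG.eq_of_eq h₄
    rw [mul_pow, mul_pow _ (P.q ^ _), mul_right_inj' (pow_ne_zero 2 (mul_ne_zero (hM n) hs)),
      ← pow_mul, ← pow_mul, (hP.q_prim.isOfFinOrder (NeZero.ne p)).pow_eq_pow_iff_modEq,
      ← hP.q_prim.eq_orderOf] at h₃
    exact hn (Fin.ext (Nat.ModEq.eq_of_lt_of_lt (Nat.ModEq.cancel_right_of_coprime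
      hp.coprime_two_right h₃) (h n).2 (h' n).2))

end Generic

end Params
-- Bases, and assembly of the theorem
theorem linearIndependent_and_span_eq_top {p N : ℕ} {v : Lab p N → State p N}
    (h : LinearIndependent ℂ v) :
    LinearIndependent ℂ v ∧ Submodule.span ℂ (Set.range v) = ⊤ :=
  ⟨h, h.span_eq_top_of_card_eq_finrank' (Module.finrank_fintype_fun_eq_card ℂ).symm⟩

namespace Params

variable {N : ℕ} {P : Params N} {p : ℕ} [NeZero p] {ε : Fin N → ℤˣ}

theorem gaugeOrbit_of_pow_ne_one (hP : P.Admissible p) {β : ℂ} {βj : ℤ → ℂ}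
    (hβj : ∀ j, βj j = β * P.q ^ (-2 * j)) (h₀ : β ≠ 0) (hβ : β ^ (2 * p) ≠ 1) :
    P.GaugeOrbit βj ∧ ∀ j, βj j ^ 2 ≠ P.q ^ 2 := by
  have hq := q_ne hP
  have hpow (j : ℤ) : (βj j ^ 2) ^ p ≠ 1 := by
    rw [← pow_mul, hβj, mul_pow, q_zpow_pow hP, mul_one]
    exact hβ
  refine ⟨⟨fun j => ?_, fun j => ?_, fun j h => hpow j (by rw [h, one_pow])⟩, fun j h => hpow j ?_⟩
  · have : P.q ^ (-2 * (j + 1)) = P.q ^ (-2 * j) / P.q ^ 2 := by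
      rw [← zpow_natCast, ← zpow_sub₀ hq]; congr 1; push_cast; ring
    rw [hβj, hβj, this, mul_div_assoc]
  · rw [hβj]
    exact mul_ne_zero h₀ (zpow_ne_zero _ hq)
  · rw [h, ← pow_mul]
    simpa using q_pow_pow hP 1 2

theorem Generic.eigenvalue_separates (hp : Odd p) (hP : P.Admissible p) (hG : P.Generic p ε)
    {bm : ℂ} (hbm : bm ≠ 0) {h h' : Lab p N} (hne : h ≠ h') : ∃ x, x ≠ 0 ∧
      P.pseudoEig p bm (fun n => P.mu (ε n) n * P.s) h x = 0 ∧
      P.pseudoEig p bm (fun n => P.mu (ε n) n * P.s) h' x ≠ 0 := by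
  obtain ⟨n, hn⟩ := Function.ne_iff.mp hne
  have hz : P.mu (ε n) n * P.s * P.q ^ (h n : ℕ) ≠ 0 :=
    mul_ne_zero (mul_ne_zero (mu_ne_zero hP _ n) (s_ne hP)) (pow_ne_zero _ (q_ne hP))
  refine ⟨(P.mu (ε n) n * P.s * P.q ^ (h n : ℕ))⁻¹, inv_ne_zero hz, ?_, ?_⟩ <;> rw [pseudoEig_eq]
  · exact zeroForm_zero bm (fun n => P.mu (ε n) n * P.s * P.q ^ (h n : ℕ)) n hz
  · exact hG.zeroForm_ne_zero hp hP hbm hn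

theorem Generic.eigenvalue_injective (hp : Odd p) (hP : P.Admissible p) (hG : P.Generic p ε)
    {bm : ℂ} (hbm : bm ≠ 0) (h h' : Lab p N)
    (he : ∀ x : ℂ, x ≠ 0 → P.pseudoEig p bm (fun n => P.mu (ε n) n * P.s) h x =
      P.pseudoEig p bm (fun n => P.mu (ε n) n * P.s) h' x) : h = h' := by
  by_contra hne
  obtain ⟨x, hx, h₀, h₁⟩ := hG.eigenvalue_separates hp hP hbm hne
  exact h₁ (by rw [← he x hx, h₀])

theorem Generic.zeros_simple (hP : P.Admissible p) (hG : P.Generic p ε) :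
    (∀ n, (P.mu (ε n) n * P.s) ^ (2 * p) ≠ 1 ∧ (P.mu (ε n) n * P.s) ^ (2 * p) ≠ -1) ∧
    ∀ n m, n ≠ m → (P.mu (ε n) n * P.s) ^ p ≠ (P.mu (ε m) m * P.s) ^ p := by
  refine ⟨fun n => by rw [Generic.zero_pow hP]; exact hG.one n, fun n m hnm h => hnm ?_⟩
  have h₁ := congrArg (· ^ 2) h
  simp only [← pow_mul, mul_comm p 2, Generic.zero_pow hP] at h₁
  exact (hG.eq_of_eq h₁).1

theorem Generic.bra_basis (hp : Odd p) (hP : P.Admissible p) (hG : P.Generic p ε) {βj bm : ℤ → ℂ}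
    (hbm : ∀ j, bm j ≠ 0) {bra : ℤ → Lab p N → State p N}
    (h : ∀ l : Lab p N, P.BraChain βj bm (fun n => P.mu (ε n) n * P.s * P.q ^ (l n : ℕ))
      fun j => bra j l) (j : ℤ) :
    LinearIndependent ℂ (bra j) ∧ Submodule.span ℂ (Set.range (bra j)) = ⊤ :=
  linearIndependent_and_span_eq_top <| linearIndependent_of_pseudoEigen bra
    (fun x j => Matrix.vecMulLinear (P.gaugeB x (βj j))) (fun j => j + 1)
    (fun j l x => P.pseudoEig p (bm j) (fun n => P.mu (ε n) n * P.s) l x)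
    (fun j l => (h l).ne_zero j)
    (fun j l x hx => by rw [pseudoEig_eq]; exact (h l).eig j x hx)
    (fun j _ _ hne => hG.eigenvalue_separates hp hP (hbm j) hne) j

theorem Generic.ket_basis (hp : Odd p) (hP : P.Admissible p) (hG : P.Generic p ε) {βj bm : ℤ → ℂ}
    (hbm : ∀ j, bm j ≠ 0) {ket : ℤ → Lab p N → State p N}
    (h : ∀ l : Lab p N, P.KetChain βj bm (fun n => P.mu (ε n) n * P.s * P.q ^ (l n : ℕ))
      fun j => ket j l) (j : ℤ) :
    LinearIndependent ℂ (ket j) ∧ Submodule.span ℂ (Set.range (ket j)) = ⊤ :=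
  linearIndependent_and_span_eq_top <| linearIndependent_of_pseudoEigen ket
    (fun x j => Matrix.mulVecLin (P.gaugeB x (βj j))) (fun j => j - 1)
    (fun j l x => P.pseudoEig p (bm j) (fun n => P.mu (ε n) n * P.s) l x)
    (fun j l => (h l).ne_zero j)
    (fun j l x hx => by rw [pseudoEig_eq]; exact (h l).eig j x hx)
    (fun j _ _ hne => hG.eigenvalue_separates hp hP (hbm j) hne) j

/-- The ladder of p - 1 steps uses exponents e = -i, so e - 1 stays strictly between -p and 0. In
`regular_upper`, e = i + 2 and e - 1 stays strictly between 0 and p. -/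
theorem Generic.regular_lower (hp : Odd p) (hP : P.Admissible p) (hG : P.Generic p ε) (n : Fin N)
    {i : ℕ} (hi : i + 1 < p) : P.Regular ((P.q ^ i)⁻¹ / (P.mu (ε n) n * P.s)) := by
  rw [← zpow_natCast, ← _root_.zpow_neg]
  refine hG.regular hp hP n fun h => ?_
  have h₁ : (p : ℤ) ∣ (i + 1 : ℕ) := by
    have e : ((i + 1 : ℕ) : ℤ) = -(-(i : ℤ) - 1) := by push_cast; ring
    rw [e, dvd_neg]; exact h
  exact absurd (Nat.le_of_dvd (Nat.succ_pos i) (Int.natCast_dvd_natCast.mp h₁)) (by omega)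

theorem Generic.regular_upper (hp : Odd p) (hP : P.Admissible p) (hG : P.Generic p ε) (n : Fin N)
    {i : ℕ} (hi : i + 1 < p) : P.Regular (P.q ^ (i + 2) / (P.mu (ε n) n * P.s)) := by
  rw [← zpow_natCast]
  refine hG.regular hp hP n fun h => ?_
  have h₁ : (p : ℤ) ∣ (i + 1 : ℕ) := by
    have e : ((i + 1 : ℕ) : ℤ) = ((i + 2 : ℕ) : ℤ) - 1 := by push_cast; ring
    rw [e]; exact h
  exact absurd (Nat.le_of_dvd (Nat.succ_pos i) (Int.natCast_dvd_natCast.mp h₁)) (by omega)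

theorem z_pow (hP : P.Admissible p) (ε : ℤˣ) (k m : ℤ) (n : Fin N) :
    P.z ε (k + m) n ^ p = P.z ε k n ^ p := by
  have := q_zpow_pow hP m 1
  rw [one_mul] at this
  rw [z_add hP, mul_pow, this, one_mul]

end Params
end CyclicReflection
end

open CyclicReflection in
theorem mainTheorem9 (p N : ℕ) [NeZero p] (hp : Odd p)
    (P : Params (N + 1)) (hP : P.Admissible p)
    (ε : Fin (N + 1) → ℤˣ) (k : Fin (N + 1) → ℤ) (β : ℂ)
    -- the gauge transformation is regular at every `β q^{-2j}`
    (hβ : β ^ (2 * p) ≠ 1)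
    -- inequality on `z₁`; `r` runs over the two square roots of `ζ₋² + 4 κ₋²`
    (hz : ∀ r : ℂ, r ^ 2 = P.zeta ^ 2 + 4 * P.kappa ^ 2 →
      P.z (ε 0) (k 0) 0 ^ p ≠
        (-P.zeta + r) ^ p / (2 * P.q * Complex.exp P.tau * P.kappa) ^ p)
    -- inequalities on the `μ`'s
    (hμ1 : ∀ n, P.mu (ε n) n ^ (2 * p) ≠ 1 ∧ P.mu (ε n) n ^ (2 * p) ≠ -1)
    (hμα : ∀ n, ∀ e : ℤˣ, P.mu (ε n) n ^ (2 * p) ≠ (P.alm ^ (2 * p)) ^ (e : ℤ))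
    (hμβ : ∀ n, ∀ e : ℤˣ, P.mu (ε n) n ^ (2 * p) ≠ -(P.bem ^ (2 * p)) ^ (e : ℤ))
    (hμpm : ∀ n m, ∀ e : ℤˣ, P.mu 1 n ^ (2 * p) ≠ (P.mu (-1) m ^ (2 * p)) ^ (e : ℤ))
    (hμμ : ∀ n m, n ≠ m → ∀ e : ℤˣ,
      P.mu (ε n) n ^ (2 * p) ≠ (P.mu (ε n) m ^ (2 * p)) ^ (e : ℤ))
    -- a common nonzero normalization
    (nrm : ℂ) (hnrm : nrm ≠ 0)
    -- the points `β_j = β q^{-2j}` and the zeros `μ_{n,ε_n} q^{1/2}`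
    (βj : ℤ → ℂ) (hβj : ∀ j, βj j = β * P.q ^ (-2 * j))
    (b : Fin (N + 1) → ℂ) (hb : ∀ n, b n = P.mu (ε n) n * P.s) :
    -- left part
    ((β = P.ga * P.w (ε (Fin.last N)) (k (Fin.last N)) (Fin.last N) ∧
        ∀ i : Fin N, P.z (ε i.succ) (k i.succ) i.succ =
          1 / P.w (ε i.castSucc) (k i.castSucc) i.castSucc) →
      ∀ (bm : ℤ → ℂ), (∀ j, bm j = P.prefactor ε (βj j) (P.z (ε 0) (k 0 + 2 * j + 1) 0)) →
      ∀ (bra : ℤ → Lab p (N + 1) → State p (N + 1)),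
        (∀ j, bra j = P.leftState nrm (P.leftRef p ε fun n => k n + 2 * j) b (βj j)) →
        -- the states are well defined
        (∀ n, ∀ j : ℕ, j + 1 < p → P.sfA ((P.q ^ j)⁻¹ / b n) ≠ 0) ∧
        -- the pseudo-spectrum is simple
        (∀ j, bm j ≠ 0) ∧
        (∀ n, b n ^ (2 * p) ≠ 1 ∧ b n ^ (2 * p) ≠ -1) ∧
        (∀ n m, n ≠ m → b n ^ p ≠ b m ^ p) ∧
        (∀ j, ∀ h h' : Lab p (N + 1),
          (∀ x : ℂ, x ≠ 0 → P.pseudoEig p (bm j) b h x = P.pseudoEig p (bm j) b h' x) →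
            h = h') ∧
        -- pseudo-diagonalization
        (∀ j, ∀ x : ℂ, x ≠ 0 → ∀ h,
          Matrix.vecMul (bra j h) (P.gaugeB x (βj j)) =
            P.pseudoEig p (bm j) b h x • bra (j + 1) h) ∧
        -- left bases
        (∀ j, LinearIndependent ℂ (bra j) ∧ Submodule.span ℂ (Set.range (bra j)) = ⊤)) ∧
    -- right part
    ((β = P.ga * P.w (ε (Fin.last N)) (k (Fin.last N)) (Fin.last N) ∧
        ∀ i : Fin N, P.z (ε i.succ) (k i.succ - 2) i.succ =
          1 / P.w (ε i.castSucc) (k i.castSucc) i.castSucc) →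
      ∀ (bm : ℤ → ℂ), (∀ j, bm j = P.prefactor ε (βj j) (P.z (ε 0) (k 0 + 2 * j - 1) 0)) →
      ∀ (Ωbar : ℤ → State p (N + 1)),
        (∀ j, Ωbar j = (βj j / P.q) ^ (N + 1) • P.rightRef p ε fun n => k n + 2 * j + 1) →
      ∀ (ket : ℤ → Lab p (N + 1) → State p (N + 1)),
        (∀ j, ket j = P.rightState nrm (P.rightOmega (Ωbar j) b (βj j)) b (βj j)) →
        -- the states are well defined
        (∀ n, ∀ j : ℕ, j + 1 < p → P.sfD ((P.q ^ j)⁻¹ / b n) ≠ 0) ∧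
        -- the pseudo-spectrum is simple
        (∀ j, bm j ≠ 0) ∧
        (∀ n, b n ^ (2 * p) ≠ 1 ∧ b n ^ (2 * p) ≠ -1) ∧
        (∀ n m, n ≠ m → b n ^ p ≠ b m ^ p) ∧
        (∀ j, ∀ h h' : Lab p (N + 1),
          (∀ x : ℂ, x ≠ 0 → P.pseudoEig p (bm j) b h x = P.pseudoEig p (bm j) b h' x) →
            h = h') ∧
        -- the tensor product state is a pseudo-eigenstate with zeros `μ_{n,ε_n} q^{-1/2}`
        (∀ j, Ωbar j ≠ 0 ∧ ∀ x : ℂ, x ≠ 0 →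
          Matrix.mulVec (P.gaugeB x (βj j)) (Ωbar j) =
            P.pseudoEig p (bm j) (fun n => P.mu (ε n) n / P.s) (fun _ => 0) x •
              Ωbar (j - 1)) ∧
        -- pseudo-diagonalization
        (∀ j, ∀ x : ℂ, x ≠ 0 → ∀ h,
          Matrix.mulVec (P.gaugeB x (βj j)) (ket j h) =
            P.pseudoEig p (bm j) b h x • ket (j - 1) h) ∧
        -- right bases
        (∀ j, LinearIndependent ℂ (ket j) ∧ Submodule.span ℂ (Set.range (ket j)) = ⊤)) := by
  have hG : P.Generic p ε := ⟨hμ1, hμα, hμβ, hμpm, hμμ⟩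
  obtain rfl : b = fun n => P.mu (ε n) n * P.s := funext hb
  have hb₀ (n : Fin (N + 1)) : P.mu (ε n) n * P.s ≠ 0 :=
    mul_ne_zero (Params.mu_ne_zero hP _ n) (Params.s_ne hP)
  have hlow (n : Fin (N + 1)) {i : ℕ} (hi : i + 1 < p) := hG.regular_lower hp hP n hi
  obtain ⟨hs₁, hs₂⟩ := hG.zeros_simple hP
  have hbeta (h₀ : β = P.ga * P.w (ε (Fin.last N)) (k (Fin.last N)) (Fin.last N)) :=
    Params.gaugeOrbit_of_pow_ne_one hP hβj
      (by rw [h₀]; exact mul_ne_zero hP.ga_ne (Params.w_ne_zero hP _ _ _)) hβ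
  -- The hypothesis on z₁ at k₁ covers every shift m, since z₁^p does not depend on it.
  have hpre (h₀ : β = P.ga * P.w (ε (Fin.last N)) (k (Fin.last N)) (Fin.last N)) (j m : ℤ) :
      P.prefactor ε (βj j) (P.z (ε 0) (k 0 + m) 0) ≠ 0 :=
    Params.prefactor_ne_zero hP ε ((hbeta h₀).1.ne_zero j) ((hbeta h₀).1.sq_ne_one j)
      ((hbeta h₀).2 j) (Params.z_ne_zero hP _ _ _)
      (P.boundaryFactor_ne_zero hP (Params.z_ne_zero hP _ _ _) (Params.z_pow hP _ _ _ _) hz)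
  constructor
  · rintro ⟨h₀, h₁⟩ bm hbm bra hbra
    obtain ⟨hO, hO₂⟩ := hbeta h₀
    have hbm₀ (j : ℤ) : bm j ≠ 0 := by
      rw [hbm, add_assoc]; exact hpre h₀ j _
    have hchain (l : Lab p (N + 1)) : P.BraChain βj bm
        (fun n => P.mu (ε n) n * P.s * P.q ^ (l n : ℕ)) fun j => bra j l := by
      simp only [hbra]
      exact Params.leftState_chain hP hO hb₀ (fun n i hi => (hlow n hi).sfA_ne_zero hP)
        (fun n i hi => (hlow n hi).refDet_ne_zero hP)
        (Params.leftRef_chain hp hP ε k hβj hO hO₂ h₀ h₁ hbm) hnrm l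
    refine ⟨fun n j hj => (hlow n hj).sfA_ne_zero hP, hbm₀, hs₁, hs₂,
      fun j => hG.eigenvalue_injective hp hP (hbm₀ j), fun j x hx h => ?_,
      hG.bra_basis hp hP hbm₀ hchain⟩
    rw [Params.pseudoEig_eq]
    exact (hchain h).eig j x hx
  · rintro ⟨h₀, h₁⟩ bm hbm Ωbar hΩ ket hket
    obtain ⟨hO, hO₂⟩ := hbeta h₀
    have hbm₀ (j : ℤ) : bm j ≠ 0 := by
      rw [hbm, add_sub_assoc]; exact hpre h₀ j _
    have hD (n : Fin (N + 1)) (i : ℕ) (hi : i + 1 < p) :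
        P.sfD ((P.q ^ i)⁻¹ / (P.mu (ε n) n * P.s)) ≠ 0 :=
      hG.sfD_ne_zero hP n ((hlow n hi).reflect hP)
    have href : P.KetChain βj bm (fun n => P.mu (ε n) n * P.s / P.q) Ωbar := by
      rw [funext hΩ]
      exact Params.rightRef_chain hp hP ε k hβj hO hO₂ h₀ h₁ hbm
    have hchain (l : Lab p (N + 1)) : P.KetChain βj bm
        (fun n => P.mu (ε n) n * P.s * P.q ^ (l n : ℕ)) fun j => ket j l := by
      simp only [hket]
      exact Params.rightState_chain hP hO hb₀ hD
        (fun n i hi => ((hlow n hi).reflect hP).refDet_ne_zero hP)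
        (Params.rightOmega_chain hP hO hb₀
          (fun n i hi => (hG.regular_upper hp hP n hi).refDet_ne_zero hP) href) hnrm l
    refine ⟨hD, hbm₀, hs₁, hs₂, fun j => hG.eigenvalue_injective hp hP (hbm₀ j),
      fun j => ⟨href.ne_zero j, fun x hx => ?_⟩, fun j x hx h => ?_,
      hG.ket_basis hp hP hbm₀ hchain⟩
    -- The zeros μ q^{-1/2} are the ladder's starting zeros μ q^{1/2}/q, read at the label 0.
    · have e : (fun n => P.mu (ε n) n / P.s * P.q ^ (((fun _ => 0 : Lab p (N + 1)) n : Fin p) : ℕ)) =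
          fun n => P.mu (ε n) n * P.s / P.q := by
        have hs := Params.s_ne hP
        ext n
        simp only [Fin.val_zero, pow_zero, mul_one, Params.q]
        field_simp
      rw [Params.pseudoEig_eq, e]
      exact href.eig j x hx
    · rw [Params.pseudoEig_eq]
      exact (hchain h).eig j x hx
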